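/- Let $\mathfrak g$ be one of the following complex Lie superalgebras, where $m,n\ge 0$: $\mathfrak{sl}(m|n)$ with $m\neq n$, $\mathfrak{gl}(n|n)$, $\mathfrak{osp}(2m+1|2n)$, or $\mathfrak{osp}(2m|2n)$, realized by matrices in the standard way (the orthosymplectic ones with respect to the split forms $(e_0,e_0)=1$, $(e_i,e_{-i})=(e_{-i},e_i)=1$ on the even part and $(f_j,f_{-j})=1=-(f_{-j},f_j)$ on the odd part). Let $\mathfrak h\subseteq\mathfrak g$ be the subalgebra of diagonal matrices, and let $I=\{1,\dots,N\}$ with $N=m+n-1$ for $\mathfrak{sl}(m|n)$, $N=\max(2n-1,0)$ for $\mathfrak{gl}(n|n)$ and $N=m+n$ for the orthosymplectic Lie superalgebras. An *ordered root base* is a sequence $\Pi=(\beta_i)_{i\in I}$ of linearly independent roots in $\mathfrak h^*$ for which there are homogeneous Chevalley generators $e_i\in\mathfrak g_{\beta_i}$, $f_i\in\mathfrak g_{-\beta_i}$ of the same parity $\tau_i$ that generate $\mathfrak g$ together with $\mathfrak h$ and satisfy $[e_i,f_j]=0$ for $i\ne j$. Put $h_i=[e_i,f_i]\in\mathfrak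 h$ and $b_{ij}=\beta_j(h_i)$. The simple root $\beta_i$ is *odd isotropic* if $\tau_i=1$ and $b_{ii}=0$. The odd reflection of $\Pi$ at an odd isotropic $\beta_i$ is the sequence $(\beta'_j)$ with $\beta'_i=-\beta_i$, and for $j\neq i$, $\beta'_j=\beta_j$ if $b_{ij}=0$ and $\beta'_j=\beta_j+\beta_i$ if $b_{ij}\ne0$. The Serre matrix $A=(a_{ij})$ of $\Pi$ has $a_{ii}=2$, and for $i\neq j$, $a_{ij}=0$ if $b_{ij}=0$, $a_{ij}=-1$ if $b_{ij}\ne0=b_{ii}$, and $a_{ij}=2b_{ij}/b_{ii}$ otherwise. The *Cartan graph* of $\mathfrak g$ has as vertices all ordered root bases; for each vertex $x$ and $i\in I$ there is an edge of color $i$ from $x$ to its odd reflection at the $i$-th simple root if this root is odd isotropic, and a loop of color $i$ at $x$ otherwise; each vertex $x$ carries its Serre matrix $A(x)$. The *Weyl groupoid* $\mathcal W$ of $\mathfrak g$ has the vertices as objects. For each edge of color $i$ from $x$ to $y$ let $s_i\colon\mathbb Z^I_x\to\mathbb Z^I_y$ be the linear map $\alpha^x_j\mapsto\alpha^y_j-A(x)_{ij}\alpha^y_i$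 between the lattices with bases $(\alpha^x_j)_{j\in I}$ and $(\alpha^y_j)_{j\in I}$; the morphisms of $\mathcal W$ are the linear maps generated by these $s_i$ under composition (two morphisms $x\to y$ being equal if and only if they are equal as linear maps). Then for every vertex $x$ of the Cartan graph of $\mathfrak g$, the group $\operatorname{Aut}_{\mathcal W}(x)$ is isomorphic to the Weyl group of the even part $\mathfrak g_{0}$, i.e. the subgroup of $\mathrm{GL}(\mathfrak h^*)$ generated by the reflections $\lambda\mapsto\lambda-\lambda(\alpha^\vee)\alpha$ at the roots $\alpha$ of $\mathfrak g_0$. -/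

import Mathlib

open CategoryTheory

noncomputable section

/-! ### Lie superalgebras over the complex numbers -/

/-- The sign `(-1)^(a b)` for parities `a`, `b`. -/
def superSign (a b : ZMod 2) : ℂ := if a = 1 ∧ b = 1 then -1 else 1

/-- A Lie superalgebra structure on a complex vector space `V`. -/
structure LieSuperalgebra (V : Type) [AddCommGroup V] [Module ℂ V] where
  /-- the even (`part 0`) and the odd (`part 1`) subspace -/
  part : ZMod 2 → Submodule ℂ V
  isCompl : IsCompl (part 0) (part 1)
  /-- the superbracket -/
  bracket : V →ₗ[ℂ] V →ₗ[ℂ] V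
  bracket_mem : ∀ (a b : ZMod 2) (x y : V), x ∈ part a → y ∈ part b → bracket x y ∈ part (a + b)
  skew : ∀ (a b : ZMod 2) (x y : V), x ∈ part a → y ∈ part b →
    bracket x y = -(superSign a b • bracket y x)
  jacobi : ∀ (a b : ZMod 2) (x y z : V), x ∈ part a → y ∈ part b →
    bracket x (bracket y z) = bracket (bracket x y) z + superSign a b • bracket y (bracket x z)

namespace LieSuperalgebra

section Restrict

variable {V : Type} [AddCommGroup V] [Module ℂ V]

/-- A graded subspace that is closed under the bracket of homogeneous elements is itself a
Lie superalgebra. -/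
def restrict (L : LieSuperalgebra V) (S : Submodule ℂ V)
    (hgr : S ≤ (S ⊓ L.part 0) ⊔ (S ⊓ L.part 1))
    (hcl : ∀ (a b : ZMod 2) (x y : V), x ∈ S → y ∈ S → x ∈ L.part a → y ∈ L.part b →
      L.bracket x y ∈ S) : LieSuperalgebra S where
  part a := (L.part a).comap S.subtype
  isCompl := by
    constructor
    · rw [Submodule.disjoint_def]
      intro x h0 h1
      have := Submodule.disjoint_def.1 L.isCompl.disjoint x.1 h0 h1
      exact Subtype.ext this
    · rw [codisjoint_iff, eq_top_iff]
      rintro ⟨x, hx⟩ -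
      obtain ⟨y, hy, z, hz, rfl⟩ := Submodule.mem_sup.1 (hgr hx)
      exact Submodule.mem_sup.2 ⟨⟨y, hy.1⟩, hy.2, ⟨z, hz.1⟩, hz.2, rfl⟩
  bracket := by
    refine LinearMap.mk₂ ℂ (fun x y => ⟨L.bracket x.1 y.1, ?_⟩) ?_ ?_ ?_ ?_
    · obtain ⟨x, hx⟩ := x
      obtain ⟨y, hy⟩ := y
      obtain ⟨x0, hx0, x1, hx1, rfl⟩ := Submodule.mem_sup.1 (hgr hx)
      obtain ⟨y0, hy0, y1, hy1, rfl⟩ := Submodule.mem_sup.1 (hgr hy)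
      simp only [map_add, LinearMap.add_apply]
      exact S.add_mem
        (S.add_mem (hcl 0 0 _ _ hx0.1 hy0.1 hx0.2 hy0.2) (hcl 1 0 _ _ hx1.1 hy0.1 hx1.2 hy0.2))
        (S.add_mem (hcl 0 1 _ _ hx0.1 hy1.1 hx0.2 hy1.2) (hcl 1 1 _ _ hx1.1 hy1.1 hx1.2 hy1.2))
    all_goals intros; apply Subtype.ext; simp
  bracket_mem a b x y hx hy := L.bracket_mem a b x.1 y.1 hx hy
  skew a b x y hx hy := Subtype.ext (L.skew a b x.1 y.1 hx hy)
  jacobi a b x y z hx hy := Subtype.ext (L.jacobi a b x.1 y.1 z.1 hx hy)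

end Restrict

/-! ### Roots, ordered root bases and the Weyl group of the even part

Below `L` is a Lie superalgebra and `𝔥` a subspace of it, to be thought of as a Cartan
subalgebra. -/

section Roots

variable {V : Type} [AddCommGroup V] [Module ℂ V] (L : LieSuperalgebra V) (𝔥 : Submodule ℂ V)

/-- The root space of weight `α`. -/
def rootSpace (α : Module.Dual ℂ 𝔥) : Submodule ℂ V where
  carrier := {x | ∀ h : 𝔥, L.bracket h x = α h • x}
  add_mem' := by
    intro x y hx hy h
    rw [map_add, hx h, hy h, smul_add]
  zero_mem' := by intro h; simp
  smul_mem' := by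
    intro c x hx h
    rw [map_smul, hx h, smul_comm]

/-- The (nonzero) roots. -/
def IsRoot (α : Module.Dual ℂ 𝔥) : Prop := α ≠ 0 ∧ L.rootSpace 𝔥 α ≠ ⊥

/-- The roots of the even part. -/
def IsEvenRoot (α : Module.Dual ℂ 𝔥) : Prop := α ≠ 0 ∧ L.rootSpace 𝔥 α ⊓ L.part 0 ≠ ⊥

/-- `s` generates `L` as a Lie superalgebra. -/
def Generates (s : Set V) : Prop :=
  ∀ S : Submodule ℂ V, s ⊆ S → (∀ x ∈ S, ∀ y ∈ S, L.bracket x y ∈ S) → S = ⊤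

/-- `t` is the coroot of the even root `α`: it lies in `[𝔤_α, 𝔤_{-α}]` (computed in the even part)
and satisfies `α t = 2`. -/
def IsEvenCoroot (α : Module.Dual ℂ 𝔥) (t : 𝔥) : Prop :=
  α t = 2 ∧ ∃ e ∈ L.rootSpace 𝔥 α ⊓ L.part 0, ∃ f ∈ L.rootSpace 𝔥 (-α) ⊓ L.part 0,
    L.bracket e f = t

/-- The Weyl group of the even part: the subgroup of `GL(𝔥*)` generated by the reflections
`lam ↦ lam - lam(t) α` for all even roots `α`, with coroot `t`. -/
def evenWeylGroup : Subgroup (Module.Dual ℂ 𝔥 ≃ₗ[ℂ] Module.Dual ℂ 𝔥) :=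
  Subgroup.closure {w | ∃ (α : Module.Dual ℂ 𝔥) (t : 𝔥), L.IsEvenRoot 𝔥 α ∧ L.IsEvenCoroot 𝔥 α t ∧
    ∀ lam : Module.Dual ℂ 𝔥, w lam = lam - lam t • α}

/-- Chevalley generators `e i`, `f i` of parity `parity i` for a family of roots `β`.
The coroots `[e i, f i]` have weight zero, hence lie in `𝔥` when `𝔥` is its own centralizer. -/
structure ChevalleyGenerators {ι : Type} (β : ι → Module.Dual ℂ 𝔥) where
  parity : ι → ZMod 2
  e : ι → V
  f : ι → V
  coroot : ι → 𝔥
  e_mem : ∀ i, e i ∈ L.rootSpace 𝔥 (β i) ⊓ L.part (parity i)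
  f_mem : ∀ i, f i ∈ L.rootSpace 𝔥 (-β i) ⊓ L.part (parity i)
  bracket_self : ∀ i, L.bracket (e i) (f i) = coroot i
  bracket_ne : ∀ i j, i ≠ j → L.bracket (e i) (f j) = 0
  generates : L.Generates (𝔥 ∪ Set.range e ∪ Set.range f)

/-- An ordered root base, indexed by `ι`. -/
structure OrderedRootBase (ι : Type) where
  root : ι → Module.Dual ℂ 𝔥
  isRoot : ∀ i, L.IsRoot 𝔥 (root i)
  linearIndependent : LinearIndependent ℂ root
  exists_generators : Nonempty (L.ChevalleyGenerators 𝔥 root)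

end Roots

namespace OrderedRootBase

variable {V : Type} [AddCommGroup V] [Module ℂ V] {L : LieSuperalgebra V} {𝔥 : Submodule ℂ V}
  {ι : Type}

/-- A fixed choice of Chevalley generators for an ordered root base. -/
def gens (x : L.OrderedRootBase 𝔥 ι) : L.ChevalleyGenerators 𝔥 x.root :=
  Classical.choice x.exists_generators

/-- The matrix `b i j = β_j(h_i)` of the Cartan datum. -/
def cartanMatrix (x : L.OrderedRootBase 𝔥 ι) : Matrix ι ι ℂ :=
  Matrix.of fun i j => x.root j (x.gens.coroot i)

/-- The parity vector of the Cartan datum. -/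
def parity (x : L.OrderedRootBase 𝔥 ι) : ι → ZMod 2 := x.gens.parity

/-- The `i`-th simple root is odd isotropic. -/
def IsOddIsotropic (x : L.OrderedRootBase 𝔥 ι) (i : ι) : Prop :=
  x.parity i = 1 ∧ x.cartanMatrix i i = 0

/-- The simple roots obtained by the odd reflection at the `i`-th simple root. -/
def oddReflection [DecidableEq ι] (x : L.OrderedRootBase 𝔥 ι) (i : ι) : ι → Module.Dual ℂ 𝔥 :=
  fun j => if j = i then -x.root i
    else if x.cartanMatrix i j = 0 then x.root j else x.root j + x.root i

end OrderedRootBase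

end LieSuperalgebra

/-- The Serre matrix of a Cartan datum with matrix `B`. In the last case `2 b_ij / b_ii` is an
integer for the Cartan data of interest; taking the floor of the real part merely reads it off. -/
def serreMatrix {ι : Type} [DecidableEq ι] (B : Matrix ι ι ℂ) : Matrix ι ι ℤ :=
  Matrix.of fun i j => if i = j then 2
    else if B i j = 0 then 0
    else if B i i = 0 then -1
    else ⌊(2 * B i j / B i i).re⌋

/-! ### Labelled graphs and their Weyl groupoids -/

/-- An undirected graph with edges colored by `ι` and an integer matrix with diagonal entries `2` at
each vertex. (Semi-)Cartan graphs are of this form. `Adj i x y` says that there is an edge of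
color `i` between `x` and `y`; an edge is presented here in the direction from `x` to `y`. -/
structure LabelledGraph (ι : Type) where
  Vertex : Type
  Adj : ι → Vertex → Vertex → Prop
  A : Vertex → Matrix ι ι ℤ
  A_diag : ∀ x i, A x i i = 2

namespace LabelledGraph

variable {ι : Type} [Fintype ι] [DecidableEq ι]

/-- The map `s_i` at the vertex `x`, with `s_i(α_j) = α_j - A(x)_ij α_i`, where the lattice at every
vertex is `ι → ℤ` and `α_j` is the `j`-th standard basis vector. -/
def simpleReflection (G : LabelledGraph ι) (i : ι) (x : G.Vertex) : (ι → ℤ) ≃ₗ[ℤ] (ι → ℤ) :=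
  Module.reflection (x := (Pi.single i 1 : ι → ℤ))
    (f := Fintype.linearCombination ℤ (fun j => G.A x i j)) (by
      rw [Fintype.linearCombination_apply_single, G.A_diag]; simp)

/-- `G.IsMorphism x y w`: the map `w` from the lattice at `x` to the lattice at `y` is a composition
of simple reflections along edges and their inverses. -/
inductive IsMorphism (G : LabelledGraph ι) :
    G.Vertex → G.Vertex → ((ι → ℤ) ≃ₗ[ℤ] (ι → ℤ)) → Prop
  | refl (x : G.Vertex) : IsMorphism G x x (LinearEquiv.refl ℤ (ι → ℤ))
  | step (x y z : G.Vertex) (i : ι) (w : (ι → ℤ) ≃ₗ[ℤ] (ι → ℤ)) (hw : IsMorphism G x y w)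
      (h : G.Adj i y z) : IsMorphism G x z (w.trans (G.simpleReflection i y))
  | stepInv (x y z : G.Vertex) (i : ι) (w : (ι → ℤ) ≃ₗ[ℤ] (ι → ℤ)) (hw : IsMorphism G x y w)
      (h : G.Adj i z y) : IsMorphism G x z (w.trans (G.simpleReflection i z).symm)

theorem IsMorphism.trans {G : LabelledGraph ι} {x y z : G.Vertex} {v w : (ι → ℤ) ≃ₗ[ℤ] (ι → ℤ)}
    (hv : G.IsMorphism x y v) (hw : G.IsMorphism y z w) : G.IsMorphism x z (v.trans w) := by
  induction hw with
  | refl => exact hv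
  | step y z i w _ h ih => exact IsMorphism.step _ _ _ _ _ ih h
  | stepInv y z i w _ h ih => exact IsMorphism.stepInv _ _ _ _ _ ih h

theorem IsMorphism.symm {G : LabelledGraph ι} {x y : G.Vertex} {w : (ι → ℤ) ≃ₗ[ℤ] (ι → ℤ)}
    (hw : G.IsMorphism x y w) : G.IsMorphism y x w.symm := by
  induction hw with
  | refl => exact IsMorphism.refl _
  | step y z i w _ h ih =>
    exact (IsMorphism.stepInv _ _ _ i _ (IsMorphism.refl z) h).trans ih
  | stepInv y z i w _ h ih =>
    exact (IsMorphism.step _ _ _ i _ (IsMorphism.refl z) h).trans ih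

/-- The Weyl groupoid of a labelled graph; its objects are the vertices. -/
structure WeylGroupoid (G : LabelledGraph ι) where
  vertex : G.Vertex

instance (G : LabelledGraph ι) : Groupoid G.WeylGroupoid where
  Hom x y := {w : (ι → ℤ) ≃ₗ[ℤ] (ι → ℤ) // G.IsMorphism x.vertex y.vertex w}
  id x := ⟨LinearEquiv.refl ℤ (ι → ℤ), IsMorphism.refl x.vertex⟩
  comp v w := ⟨v.1.trans w.1, v.2.trans w.2⟩
  id_comp _ := rfl
  comp_id _ := rfl
  assoc _ _ _ := rfl
  inv w := ⟨w.1.symm, w.2.symm⟩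
  inv_comp w := Subtype.ext (LinearEquiv.symm_trans_self w.1)
  comp_inv w := Subtype.ext (LinearEquiv.self_trans_symm w.1)

end LabelledGraph

/-- The Cartan graph of `L` with respect to `𝔥`, with colors `ι`. The vertices are the ordered root
bases; edges are given by odd reflections at odd isotropic simple roots, and there are loops for
the other simple roots. -/
def LieSuperalgebra.cartanGraph {V : Type} [AddCommGroup V] [Module ℂ V] (L : LieSuperalgebra V)
    (𝔥 : Submodule ℂ V) (ι : Type) [DecidableEq ι] : LabelledGraph ι where
  Vertex := L.OrderedRootBase 𝔥 ι
  Adj i x y := (x.IsOddIsotropic i ∧ y.root = x.oddReflection i) ∨ (¬ x.IsOddIsotropic i ∧ y = x)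
  A x := serreMatrix x.cartanMatrix
  A_diag x i := by simp [serreMatrix]

/-! ### Matrix Lie superalgebras -/

section Matrices

variable (κ μ : Type)

/-- The parity of the indices: those in `κ` are even, those in `μ` are odd. -/
def indexParity : κ ⊕ μ → ZMod 2 := Sum.elim (fun _ => 0) (fun _ => 1)

/-- Matrices of parity `a`, for `a = 0` the block-diagonal and for `a = 1` the block-off-diagonal
ones. -/
def matrixPart (a : ZMod 2) : Submodule ℂ (Matrix (κ ⊕ μ) (κ ⊕ μ) ℂ) where
  carrier := {x | ∀ i j, indexParity κ μ i + indexParity κ μ j ≠ a → x i j = 0}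
  add_mem' := by
    intro x y hx hy i j h
    simp [hx i j h, hy i j h]
  zero_mem' := by intro i j _; rfl
  smul_mem' := by
    intro c x hx i j h
    simp [hx i j h]

/-- The component of parity `a` of a matrix. -/
def matrixComponent (a : ZMod 2) (x : Matrix (κ ⊕ μ) (κ ⊕ μ) ℂ) : Matrix (κ ⊕ μ) (κ ⊕ μ) ℂ :=
  Matrix.of fun i j => if indexParity κ μ i + indexParity κ μ j = a then x i j else 0

variable {κ μ}

theorem matrixComponent_mem (a : ZMod 2) (x : Matrix (κ ⊕ μ) (κ ⊕ μ) ℂ) :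
    matrixComponent κ μ a x ∈ matrixPart κ μ a := by
  intro i j h
  simp [matrixComponent, h]

theorem matrixComponent_add (x : Matrix (κ ⊕ μ) (κ ⊕ μ) ℂ) :
    matrixComponent κ μ 0 x + matrixComponent κ μ 1 x = x := by
  ext i j
  have : ∀ c : ZMod 2, c = 0 ∨ c = 1 := by decide
  rcases this (indexParity κ μ i + indexParity κ μ j) with h | h <;> simp [matrixComponent, h]

variable (κ μ) [Fintype κ] [Fintype μ]

/-- The supercommutator, on all matrices. -/
def superCommutator : Matrix (κ ⊕ μ) (κ ⊕ μ) ℂ →ₗ[ℂ] Matrix (κ ⊕ μ) (κ ⊕ μ) ℂ →ₗ[ℂ]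
    Matrix (κ ⊕ μ) (κ ⊕ μ) ℂ :=
  LinearMap.mk₂ ℂ
    (fun x y => Matrix.of fun i k => ∑ j, (x i j * y j k -
      superSign (indexParity κ μ j + indexParity κ μ k) (indexParity κ μ i + indexParity κ μ j) *
        (y i j * x j k)))
    (by intro x x' y; ext i k; simp only [Matrix.of_apply, Matrix.add_apply]
        rw [← Finset.sum_add_distrib]; exact Finset.sum_congr rfl fun j _ => by ring)
    (by intro c x y; ext i k; simp only [Matrix.of_apply, Matrix.smul_apply, smul_eq_mul]
        rw [Finset.mul_sum]; exact Finset.sum_congr rfl fun j _ => by ring)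
    (by intro x y y'; ext i k; simp only [Matrix.of_apply, Matrix.add_apply]
        rw [← Finset.sum_add_distrib]; exact Finset.sum_congr rfl fun j _ => by ring)
    (by intro c x y; ext i k; simp only [Matrix.of_apply, Matrix.smul_apply, smul_eq_mul]
        rw [Finset.mul_sum]; exact Finset.sum_congr rfl fun j _ => by ring)

variable {κ μ}

/-- On homogeneous matrices, the supercommutator is `x y - (-1)^(|x| |y|) y x`. -/
theorem superCommutator_eq {a b : ZMod 2} {x y : Matrix (κ ⊕ μ) (κ ⊕ μ) ℂ}
    (hx : x ∈ matrixPart κ μ a) (hy : y ∈ matrixPart κ μ b) :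
    superCommutator κ μ x y = x * y - superSign a b • (y * x) := by
  ext i k
  simp only [superCommutator, LinearMap.mk₂_apply, Matrix.of_apply, Matrix.sub_apply,
    Matrix.smul_apply, Matrix.mul_apply, smul_eq_mul, Finset.mul_sum]
  rw [← Finset.sum_sub_distrib]
  refine Finset.sum_congr rfl fun j _ => ?_
  by_cases h1 : indexParity κ μ j + indexParity κ μ k = a
  · by_cases h2 : indexParity κ μ i + indexParity κ μ j = b
    · rw [h1, h2]
    · rw [hy i j h2]; ring
  · rw [hx j k h1]; ring

theorem mul_mem_matrixPart {a b : ZMod 2} {x y : Matrix (κ ⊕ μ) (κ ⊕ μ) ℂ}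
    (hx : x ∈ matrixPart κ μ a) (hy : y ∈ matrixPart κ μ b) : x * y ∈ matrixPart κ μ (a + b) := by
  intro i k h
  rw [Matrix.mul_apply]
  refine Finset.sum_eq_zero fun j _ => ?_
  by_cases h1 : indexParity κ μ i + indexParity κ μ j = a
  · by_cases h2 : indexParity κ μ j + indexParity κ μ k = b
    · exfalso
      apply h
      rw [← h1, ← h2]
      have : ∀ u v w : ZMod 2, u + w = u + v + (v + w) := by decide
      exact this _ _ _
    · rw [hy j k h2, mul_zero]
  · rw [hx i j h1, zero_mul]

theorem superCommutator_mem {a b : ZMod 2} {x y : Matrix (κ ⊕ μ) (κ ⊕ μ) ℂ}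
    (hx : x ∈ matrixPart κ μ a) (hy : y ∈ matrixPart κ μ b) :
    superCommutator κ μ x y ∈ matrixPart κ μ (a + b) := by
  rw [superCommutator_eq hx hy]
  refine Submodule.sub_mem _ (mul_mem_matrixPart hx hy) (Submodule.smul_mem _ _ ?_)
  rw [add_comm]
  exact mul_mem_matrixPart hy hx

variable (κ μ)

/-- The general linear Lie superalgebra, with even indices `κ` and odd indices `μ`. -/
def glSuper : LieSuperalgebra (Matrix (κ ⊕ μ) (κ ⊕ μ) ℂ) where
  part := matrixPart κ μ
  isCompl := by
    constructor
    · rw [Submodule.disjoint_def]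
      intro x h0 h1
      ext i j
      by_cases h : indexParity κ μ i + indexParity κ μ j = 0
      · exact h1 i j (by rw [h]; decide)
      · exact h0 i j h
    · rw [codisjoint_iff, eq_top_iff]
      intro x _
      exact Submodule.mem_sup.2 ⟨_, matrixComponent_mem 0 x, _, matrixComponent_mem 1 x,
        matrixComponent_add x⟩
  bracket := superCommutator κ μ
  bracket_mem a b x y hx hy := superCommutator_mem hx hy
  skew a b x y hx hy := by
    rw [superCommutator_eq hx hy, superCommutator_eq hy hx]
    unfold superSign
    by_cases ha : a = 1 <;> by_cases hb : b = 1 <;> simp [ha, hb, add_comm]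
  jacobi := by
    have key : ∀ (a b c : ZMod 2) (x y z : Matrix (κ ⊕ μ) (κ ⊕ μ) ℂ), x ∈ matrixPart κ μ a →
        y ∈ matrixPart κ μ b → z ∈ matrixPart κ μ c →
        superCommutator κ μ x (superCommutator κ μ y z) =
          superCommutator κ μ (superCommutator κ μ x y) z +
            superSign a b • superCommutator κ μ y (superCommutator κ μ x z) := by
      intro a b c x y z hx hy hz
      rw [superCommutator_eq hx (superCommutator_mem hy hz),
        superCommutator_eq (superCommutator_mem hx hy) hz,
        superCommutator_eq hy (superCommutator_mem hx hz),
        superCommutator_eq hx hy, superCommutator_eq hx hz, superCommutator_eq hy hz]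
      have h01 : ∀ c : ZMod 2, c = 0 ∨ c = 1 := by decide
      have e : (1 : ZMod 2) + 1 = 0 := by decide
      rcases h01 a with rfl | rfl <;> rcases h01 b with rfl | rfl <;>
        rcases h01 c with rfl | rfl <;> simp [superSign, e] <;> noncomm_ring
    intro a b x y z hx hy
    have h0 := key a b 0 x y _ hx hy (matrixComponent_mem 0 z)
    have h1 := key a b 1 x y _ hx hy (matrixComponent_mem 1 z)
    rw [← matrixComponent_add z]
    simp only [map_add, smul_add]
    rw [h0, h1]
    abel

/-- The supertrace `tr A - tr D`. -/
def superTrace : Matrix (κ ⊕ μ) (κ ⊕ μ) ℂ →ₗ[ℂ] ℂ where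
  toFun x := (∑ i : κ, x (Sum.inl i) (Sum.inl i)) - ∑ j : μ, x (Sum.inr j) (Sum.inr j)
  map_add' x y := by simp [Finset.sum_add_distrib]; ring
  map_smul' c x := by simp [← Finset.mul_sum]; ring

/-- The matrices of supertrace zero. -/
def slSubmodule : Submodule ℂ (Matrix (κ ⊕ μ) (κ ⊕ μ) ℂ) := LinearMap.ker (superTrace κ μ)

/-- The special linear Lie superalgebra. -/
def slSuper : LieSuperalgebra (slSubmodule κ μ) :=
  (glSuper κ μ).restrict (slSubmodule κ μ)
    (by
      intro x hx
      have h1 : superTrace κ μ (matrixComponent κ μ 1 x) = 0 := by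
        simp [superTrace, matrixComponent, indexParity, show (1 : ZMod 2) + 1 ≠ 1 by decide]
      have h0 : superTrace κ μ (matrixComponent κ μ 0 x) = 0 := by
        have hx' : superTrace κ μ x = 0 := hx
        rw [← matrixComponent_add x, map_add, h1, add_zero] at hx'
        exact hx'
      exact Submodule.mem_sup.2 ⟨_, ⟨h0, matrixComponent_mem 0 x⟩, _,
        ⟨h1, matrixComponent_mem 1 x⟩, matrixComponent_add x⟩)
    (by
      intro a b x y _ _ _ _
      change superTrace κ μ (superCommutator κ μ x y) = 0
      simp only [superTrace, superCommutator, LinearMap.mk₂_apply, LinearMap.coe_mk,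
        AddHom.coe_mk, Matrix.of_apply, Fintype.sum_sum_type, indexParity, Sum.elim_inl,
        Sum.elim_inr, superSign, show (1 : ZMod 2) + 1 = 0 by decide, Finset.sum_add_distrib,
        Finset.sum_sub_distrib]
      simp only [zero_add, add_zero, zero_ne_one, and_self, if_true, if_false, one_mul, neg_mul,
        Finset.sum_neg_distrib]
      rw [Finset.sum_comm (f := fun i j : κ => y (Sum.inl i) (Sum.inl j) * x (Sum.inl j) (Sum.inl i)),
        Finset.sum_comm (f := fun i j : μ => y (Sum.inr i) (Sum.inr j) * x (Sum.inr j) (Sum.inr i)),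
        Finset.sum_comm (f := fun (i : κ) (j : μ) =>
          y (Sum.inl i) (Sum.inr j) * x (Sum.inr j) (Sum.inl i)),
        Finset.sum_comm (f := fun (i : κ) (j : μ) =>
          x (Sum.inl i) (Sum.inr j) * y (Sum.inr j) (Sum.inl i))]
      simp only [mul_comm]
      ring)

variable {κ μ}

/-- The matrices `X` that satisfy `(X u, v) + (-1)^(|X| |u|) (u, X v) = 0` for the bilinear form with
Gram matrix `Je` on the even and `Jo` on the odd part, the two parts being orthogonal. The condition
is written for basis vectors `u = e_a`, `v = e_b`, where only the component of `X` of parity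
`|a| + |b|` contributes. -/
def ospSubmodule (Je : Matrix κ κ ℂ) (Jo : Matrix μ μ ℂ) :
    Submodule ℂ (Matrix (κ ⊕ μ) (κ ⊕ μ) ℂ) where
  carrier := {X | ∀ a b, (X.transpose * Matrix.fromBlocks Je 0 0 Jo) a b +
    superSign (indexParity κ μ a + indexParity κ μ b) (indexParity κ μ a) *
      (Matrix.fromBlocks Je 0 0 Jo * X) a b = 0}
  add_mem' := by
    intro X Y hX hY a b
    have h1 := hX a b
    have h2 := hY a b
    rw [Matrix.transpose_add, Matrix.add_mul, Matrix.mul_add, Matrix.add_apply, Matrix.add_apply]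
    linear_combination h1 + h2
  zero_mem' := by intro a b; simp
  smul_mem' := by
    intro c X hX a b
    have h1 := hX a b
    rw [Matrix.transpose_smul, Matrix.smul_mul, Matrix.mul_smul, Matrix.smul_apply,
      Matrix.smul_apply, smul_eq_mul, smul_eq_mul]
    linear_combination c * h1

theorem formMatrix_eq_zero {κ μ : Type} (Je : Matrix κ κ ℂ) (Jo : Matrix μ μ ℂ) (i j : κ ⊕ μ)
    (h : indexParity κ μ i ≠ indexParity κ μ j) : Matrix.fromBlocks Je 0 0 Jo i j = 0 := by
  rcases i with i | i <;> rcases j with j | j <;> simp_all [indexParity]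

theorem transpose_mul_form_eq_zero (Je : Matrix κ κ ℂ) (Jo : Matrix μ μ ℂ) {c : ZMod 2}
    {X : Matrix (κ ⊕ μ) (κ ⊕ μ) ℂ} (hX : X ∈ matrixPart κ μ c) (a b : κ ⊕ μ)
    (h : indexParity κ μ a + indexParity κ μ b ≠ c) :
    (X.transpose * Matrix.fromBlocks Je 0 0 Jo) a b = 0 ∧
      (Matrix.fromBlocks Je 0 0 Jo * X) a b = 0 := by
  rw [Matrix.mul_apply, Matrix.mul_apply]
  constructor <;> refine Finset.sum_eq_zero fun d _ => ?_
  · by_cases hd : indexParity κ μ d = indexParity κ μ b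
    · rw [Matrix.transpose_apply, hX d a (by rwa [hd, add_comm]), zero_mul]
    · rw [formMatrix_eq_zero Je Jo d b hd, mul_zero]
  · by_cases hd : indexParity κ μ a = indexParity κ μ d
    · rw [hX d b (by rwa [← hd]), mul_zero]
    · rw [formMatrix_eq_zero Je Jo a d hd, zero_mul]

/-- For a homogeneous matrix, membership is the matrix identity `Xᵀ J = -(D J X)`. -/
theorem mem_ospSubmodule_iff (Je : Matrix κ κ ℂ) (Jo : Matrix μ μ ℂ) {c : ZMod 2}
    {X : Matrix (κ ⊕ μ) (κ ⊕ μ) ℂ} (hX : X ∈ matrixPart κ μ c) :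
    X ∈ ospSubmodule Je Jo ↔ ∀ a b, (X.transpose * Matrix.fromBlocks Je 0 0 Jo) a b =
      -(superSign c (indexParity κ μ a) * (Matrix.fromBlocks Je 0 0 Jo * X) a b) := by
  refine forall_congr' fun a => forall_congr' fun b => ?_
  by_cases h : indexParity κ μ a + indexParity κ μ b = c
  · rw [h, add_eq_zero_iff_eq_neg]
  · obtain ⟨h1, h2⟩ := transpose_mul_form_eq_zero Je Jo hX a b h
    rw [h1, h2]; simp

theorem ospSubmodule_graded (Je : Matrix κ κ ℂ) (Jo : Matrix μ μ ℂ) :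
    ospSubmodule Je Jo ≤ (ospSubmodule Je Jo ⊓ matrixPart κ μ 0) ⊔
      (ospSubmodule Je Jo ⊓ matrixPart κ μ 1) := by
  intro x hx
  have key : ∀ c, matrixComponent κ μ c x ∈ ospSubmodule Je Jo := by
    intro c a b
    by_cases h : indexParity κ μ a + indexParity κ μ b = c
    · rw [← hx a b]
      congr 1
      · rw [Matrix.mul_apply, Matrix.mul_apply]
        refine Finset.sum_congr rfl fun d _ => ?_
        by_cases hd : indexParity κ μ d = indexParity κ μ b
        · have : indexParity κ μ d + indexParity κ μ a = c := by rwa [hd, add_comm]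
          simp [matrixComponent, this]
        · rw [formMatrix_eq_zero Je Jo d b hd, mul_zero, mul_zero]
      · congr 1
        rw [Matrix.mul_apply, Matrix.mul_apply]
        refine Finset.sum_congr rfl fun d _ => ?_
        by_cases hd : indexParity κ μ a = indexParity κ μ d
        · have : indexParity κ μ d + indexParity κ μ b = c := by rwa [← hd]
          simp [matrixComponent, this]
        · rw [formMatrix_eq_zero Je Jo a d hd, zero_mul, zero_mul]
    · obtain ⟨h1, h2⟩ :=
        transpose_mul_form_eq_zero Je Jo (matrixComponent_mem c x) a b h
      rw [h1, h2]; simp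
  exact Submodule.mem_sup.2 ⟨_, ⟨key 0, matrixComponent_mem 0 x⟩, _,
    ⟨key 1, matrixComponent_mem 1 x⟩, matrixComponent_add x⟩

theorem transpose_mul_mul_form (Je : Matrix κ κ ℂ) (Jo : Matrix μ μ ℂ) {c d : ZMod 2}
    {X Y : Matrix (κ ⊕ μ) (κ ⊕ μ) ℂ} (hX : X ∈ ospSubmodule Je Jo) (hY : Y ∈ ospSubmodule Je Jo)
    (hXc : X ∈ matrixPart κ μ c) (hYd : Y ∈ matrixPart κ μ d) (a b : κ ⊕ μ) :
    ((X * Y).transpose * Matrix.fromBlocks Je 0 0 Jo) a b =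
      superSign c d * (superSign (c + d) (indexParity κ μ a) *
        (Matrix.fromBlocks Je 0 0 Jo * (Y * X)) a b) := by
  rw [mem_ospSubmodule_iff Je Jo hXc] at hX
  rw [mem_ospSubmodule_iff Je Jo hYd] at hY
  have e1 : ((X * Y).transpose * Matrix.fromBlocks Je 0 0 Jo) a b =
      ∑ k, Y k a * (X.transpose * Matrix.fromBlocks Je 0 0 Jo) k b := by
    rw [Matrix.transpose_mul, Matrix.mul_assoc, Matrix.mul_apply]
    rfl
  have e2 : ∀ k, Y k a * (X.transpose * Matrix.fromBlocks Je 0 0 Jo) k b =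
      -(superSign c (indexParity κ μ a + d)) *
        (Y k a * (Matrix.fromBlocks Je 0 0 Jo * X) k b) := by
    intro k
    rw [hX]
    by_cases h : indexParity κ μ k + indexParity κ μ a = d
    · have : indexParity κ μ k = indexParity κ μ a + d := by
        rw [← h]
        have : ∀ u v : ZMod 2, u = v + (u + v) := by decide
        exact this _ _
      rw [this]; ring
    · rw [hYd k a h]; ring
  have e3 : ∑ k, Y k a * (Matrix.fromBlocks Je 0 0 Jo * X) k b =
      (Y.transpose * Matrix.fromBlocks Je 0 0 Jo * X) a b := by
    rw [Matrix.mul_assoc, Matrix.mul_apply]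
    rfl
  have e4 : (Y.transpose * Matrix.fromBlocks Je 0 0 Jo * X) a b =
      -(superSign d (indexParity κ μ a)) * (Matrix.fromBlocks Je 0 0 Jo * (Y * X)) a b := by
    rw [← Matrix.mul_assoc, Matrix.mul_apply, Matrix.mul_apply, Finset.mul_sum]
    refine Finset.sum_congr rfl fun k _ => ?_
    rw [hY]; ring
  rw [e1, Finset.sum_congr rfl fun k _ => e2 k, ← Finset.mul_sum, e3, e4]
  generalize (Matrix.fromBlocks Je 0 0 Jo * (Y * X)) a b = t
  have h01 : ∀ c : ZMod 2, c = 0 ∨ c = 1 := by decide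
  have e : (1 : ZMod 2) + 1 = 0 := by decide
  rcases h01 (indexParity κ μ a) with h | h <;> rcases h01 c with rfl | rfl <;>
    rcases h01 d with rfl | rfl <;> simp [h, superSign, e]

theorem ospSubmodule_closed (Je : Matrix κ κ ℂ) (Jo : Matrix μ μ ℂ) (c d : ZMod 2)
    (X Y : Matrix (κ ⊕ μ) (κ ⊕ μ) ℂ) (hX : X ∈ ospSubmodule Je Jo) (hY : Y ∈ ospSubmodule Je Jo)
    (hXc : X ∈ matrixPart κ μ c) (hYd : Y ∈ matrixPart κ μ d) :
    superCommutator κ μ X Y ∈ ospSubmodule Je Jo := by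
  rw [mem_ospSubmodule_iff Je Jo (superCommutator_mem hXc hYd)]
  intro a b
  have h1 := transpose_mul_mul_form Je Jo hX hY hXc hYd a b
  have h2 := transpose_mul_mul_form Je Jo hY hX hYd hXc a b
  have hs : superSign d c = superSign c d := by simp [superSign, and_comm]
  have hs2 : superSign c d * superSign c d = 1 := by
    unfold superSign; split_ifs <;> ring
  rw [superCommutator_eq hXc hYd, Matrix.transpose_sub, Matrix.transpose_smul, Matrix.sub_mul,
    Matrix.smul_mul, Matrix.mul_sub, Matrix.mul_smul, Matrix.sub_apply, Matrix.sub_apply,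
    Matrix.smul_apply, Matrix.smul_apply, smul_eq_mul, smul_eq_mul, h1, h2, hs, add_comm d c]
  linear_combination (-superSign (c + d) (indexParity κ μ a) *
    (Matrix.fromBlocks Je 0 0 Jo * (X * Y)) a b) * hs2

/-- The orthosymplectic Lie superalgebra of a form. -/
def ospSuper (Je : Matrix κ κ ℂ) (Jo : Matrix μ μ ℂ) : LieSuperalgebra (ospSubmodule Je Jo) :=
  (glSuper κ μ).restrict (ospSubmodule Je Jo) (ospSubmodule_graded Je Jo)
    (ospSubmodule_closed Je Jo)

/-- The diagonal matrices. -/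
def diagonalMatrices (ν : Type) : Submodule ℂ (Matrix ν ν ℂ) where
  carrier := {x | ∀ i j, i ≠ j → x i j = 0}
  add_mem' := by
    intro x y hx hy i j h
    simp [hx i j h, hy i j h]
  zero_mem' := by intro i j _; rfl
  smul_mem' := by
    intro c x hx i j h
    simp [hx i j h]

/-- The diagonal matrices in a space of matrices. -/
def diagonalIn {ν : Type} (S : Submodule ℂ (Matrix ν ν ℂ)) : Submodule ℂ S :=
  (diagonalMatrices ν).comap S.subtype

/-- The symmetric form on `ℂ^(2m)` with isotropic basis `e_1, …, e_m, e_{-1}, …, e_{-m}` and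
`(e_i, e_{-i}) = 1`. -/
def symmetricFormEven (m : ℕ) : Matrix (Fin m ⊕ Fin m) (Fin m ⊕ Fin m) ℂ :=
  Matrix.fromBlocks 0 1 1 0

/-- The symmetric form on `ℂ^(2m+1)`: a vector `e_0` of length one is added. -/
def symmetricFormOdd (m : ℕ) : Matrix (Unit ⊕ (Fin m ⊕ Fin m)) (Unit ⊕ (Fin m ⊕ Fin m)) ℂ :=
  Matrix.fromBlocks 1 0 0 (symmetricFormEven m)

/-- The symplectic form on `ℂ^(2n)`. -/
def symplecticForm (n : ℕ) : Matrix (Fin n ⊕ Fin n) (Fin n ⊕ Fin n) ℂ :=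
  Matrix.fromBlocks 0 1 (-1) 0

/-- `𝔰𝔩(m|n)`. -/
abbrev slMN (m n : ℕ) : LieSuperalgebra (slSubmodule (Fin m) (Fin n)) := slSuper (Fin m) (Fin n)

/-- `𝔤𝔩(m|n)`. -/
abbrev glMN (m n : ℕ) : LieSuperalgebra (Matrix (Fin m ⊕ Fin n) (Fin m ⊕ Fin n) ℂ) :=
  glSuper (Fin m) (Fin n)

/-- `𝔬𝔰𝔭(2m+1|2n)`. -/
abbrev ospOdd (m n : ℕ) : LieSuperalgebra (ospSubmodule (symmetricFormOdd m) (symplecticForm n)) :=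
  ospSuper (symmetricFormOdd m) (symplecticForm n)

/-- `𝔬𝔰𝔭(2m|2n)`. -/
abbrev ospEven (m n : ℕ) :
    LieSuperalgebra (ospSubmodule (symmetricFormEven m) (symplecticForm n)) :=
  ospSuper (symmetricFormEven m) (symplecticForm n)

end Matrices

end

/-! Sending the basis vector `α_j` at a vertex to the simple root `β_j` embeds each lattice in `𝔥*`,
because simple roots are linearly independent. Through these embeddings an odd reflection edge
becomes the identity of `𝔥*`: the base changes, the vectors do not. A loop becomes the reflection in
its simple root, which lies in the Weyl group `W` of the even part, since a simple root that is not
odd isotropic is an even root or half of one. So every morphism is induced by an element of `W`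
(`exists_realization`). If `W` acts faithfully on the span of the simple roots, that element is
unique, and `Aut(x) → W` is an injective homomorphism (`nonempty_aut_mulEquiv`).

Surjectivity means that every even reflection `s_α` comes from a closed path at `x`
(`realizes_rootReflection_of_functional`). Take an additive `f : 𝔥* → ℝ` without zeros on the roots,
such that every root with `0 < f γ ≤ f α` is a multiple of `α` (`exists_functional`). While some
simple root has negative value, cross its edge, or at a loop apply the simple reflection to `f` and
`α`. The number of positive roots with negative value drops each time. At the end all simple roots
have positive value, `α` is a nonnegative combination of them, and some simple root has value at
most `f α`. It is proportional to `α`, so `s_α` is its loop.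

The argument rests on three facts: roots are nonnegative or nonpositive combinations of simple roots
(triangular decomposition), odd reflections of bases are bases, and simple reflections permute the
roots. The last two use a nondegenerate invariant form, which is the supertrace form in all four
families. Faithfulness holds for `sl` and `osp` because the simple roots span `𝔥*`. For `gl(n|n)`
with `n > 0` they span only a hyperplane, but `W` fixes the trace, which lies outside it. -/

noncomputable section

set_option linter.unusedSectionVars false

namespace LieSuperalgebra

/-! ### Weight spaces of the Cartan subspace -/

section Basic

variable {V : Type} [AddCommGroup V] [Module ℂ V] {L : LieSuperalgebra V} {𝔥 : Submodule ℂ V}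

theorem superSign_mul_self (a b : ZMod 2) : superSign a b * superSign a b = 1 := by
  unfold superSign; split_ifs <;> ring

theorem superSign_ne_zero (a b : ZMod 2) : superSign a b ≠ 0 := by
  unfold superSign; split_ifs <;> norm_num

@[simp] theorem superSign_zero_left (b : ZMod 2) : superSign 0 b = 1 := by simp [superSign]

@[simp] theorem superSign_zero_right (b : ZMod 2) : superSign b 0 = 1 := by simp [superSign]

@[simp] theorem superSign_one_one : superSign 1 1 = -1 := by simp [superSign]

theorem exists_homogeneous_add (L : LieSuperalgebra V) (x : V) :
    ∃ x₀ ∈ L.part 0, ∃ x₁ ∈ L.part 1, x₀ + x₁ = x :=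
  Submodule.mem_sup.1 (L.isCompl.sup_eq_top ▸ Submodule.mem_top)

/-- All signs against an even element are `1`, so the second argument need not be homogeneous. -/
theorem skew_even {x : V} (hx : x ∈ L.part 0) (y : V) : L.bracket x y = -L.bracket y x := by
  obtain ⟨y₀, h₀, y₁, h₁, rfl⟩ := L.exists_homogeneous_add y
  rw [map_add, L.skew 0 0 x y₀ hx h₀, L.skew 0 1 x y₁ hx h₁]
  simp [add_comm]

theorem jacobi_even {x : V} (hx : x ∈ L.part 0) (y z : V) :
    L.bracket x (L.bracket y z) = L.bracket (L.bracket x y) z + L.bracket y (L.bracket x z) := by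
  obtain ⟨y₀, h₀, y₁, h₁, rfl⟩ := L.exists_homogeneous_add y
  simp only [map_add, LinearMap.add_apply]
  rw [L.jacobi 0 0 x y₀ z hx h₀, L.jacobi 0 1 x y₁ z hx h₁]
  simp only [superSign_zero_left, one_smul]
  abel

/-- A split Cartan subspace in the even part together with a nondegenerate invariant form, such that
coroots of even roots are not isotropic. -/
structure InvariantForm (L : LieSuperalgebra V) (𝔥 : Submodule ℂ V) where
  form : V →ₗ[ℂ] V →ₗ[ℂ] ℂ
  form_bracket : ∀ x y z, form (L.bracket x y) z = form x (L.bracket y z)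
  form_nondegenerate : ∀ x, (∀ y, form x y = 0) → x = 0
  form_comm : ∀ h h' : 𝔥, form h h' = form h' h
  cartan_even : 𝔥 ≤ L.part 0
  bracket_cartan : ∀ h h' : 𝔥, L.bracket h h' = 0
  rootSpace_zero_le : L.rootSpace 𝔥 0 ≤ 𝔥
  even_coroot : ∀ (α : Module.Dual ℂ 𝔥) (e f : V) (t : 𝔥), e ∈ L.rootSpace 𝔥 α ⊓ L.part 0 →
    f ∈ L.rootSpace 𝔥 (-α) ⊓ L.part 0 → L.bracket e f = t → α t = 0 → t = 0

/-- The operators `[h, ·]` commute, so their joint generalized eigenspaces are independent, and root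
spaces lie in these. -/
theorem iSupIndep_rootSpace (h𝔥 : 𝔥 ≤ L.part 0) (hc : ∀ h h' : 𝔥, L.bracket h h' = 0) :
    iSupIndep (L.rootSpace 𝔥) := by
  have hcomm : ∀ h h' : 𝔥, Commute (L.bracket (h : V)) (L.bracket (h' : V)) := by
    intro h h'
    refine LinearMap.ext fun z => ?_
    have := jacobi_even (h𝔥 h.2) (h' : V) z
    rw [hc, map_zero, LinearMap.zero_apply, zero_add] at this
    exact this
  have h1 : iSupIndep fun χ : 𝔥 → ℂ =>
      ⨅ h : 𝔥, Module.End.maxGenEigenspace (L.bracket (h : V)) (χ h) :=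
    Module.End.independent_iInf_maxGenEigenspace_of_forall_mapsTo (R := ℂ)
      (fun h : 𝔥 => L.bracket (h : V))
      (fun i j φ => Module.End.mapsTo_maxGenEigenspace_of_comm (hcomm j i) φ)
  refine (h1.comp (f := fun α : Module.Dual ℂ 𝔥 => (α : 𝔥 → ℂ)) DFunLike.coe_injective).mono ?_
  intro α x hx
  refine (Submodule.mem_iInf _).2 fun h => ?_
  exact Module.End.mem_maxGenEigenspace _ _ _ |>.2 ⟨1, by simp [hx h]⟩

theorem bracket_mem_rootSpace (h𝔥 : 𝔥 ≤ L.part 0) {α β : Module.Dual ℂ 𝔥} {x y : V}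
    (hx : x ∈ L.rootSpace 𝔥 α) (hy : y ∈ L.rootSpace 𝔥 β) :
    L.bracket x y ∈ L.rootSpace 𝔥 (α + β) := by
  intro h
  rw [jacobi_even (h𝔥 h.2), hx h, hy h, map_smul, map_smul, LinearMap.smul_apply, ← add_smul]
  rfl

theorem finite_isRoot [FiniteDimensional ℂ V] (h𝔥 : 𝔥 ≤ L.part 0)
    (hc : ∀ h h' : 𝔥, L.bracket h h' = 0) : {α | L.IsRoot 𝔥 α}.Finite :=
  (WellFoundedGT.finite_ne_bot_of_iSupIndep (iSupIndep_rootSpace h𝔥 hc)).subset fun _ h => h.2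

theorem bracket_cartan_right (h𝔥 : 𝔥 ≤ L.part 0) {α : Module.Dual ℂ 𝔥} {x : V}
    (hx : x ∈ L.rootSpace 𝔥 α) (h : 𝔥) : L.bracket x h = -(α h • x) := by
  rw [← hx h, skew_even (h𝔥 h.2), neg_neg]

/-- A family of subspaces of an independent family that spans everything is the whole family. -/
theorem eq_of_iSupIndep {ι : Type*} {A B : ι → Submodule ℂ V} (hB : iSupIndep B)
    (hAB : ∀ i, A i ≤ B i) (hA : ⨆ i, A i = ⊤) (i : ι) : A i = B i := by
  refine le_antisymm (hAB i) fun x hx => ?_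
  have h1 : x ∈ A i ⊔ ⨆ (j) (_ : j ≠ i), A j := by
    have : (⊤ : Submodule ℂ V) ≤ A i ⊔ ⨆ (j) (_ : j ≠ i), A j := by
      rw [← hA]
      refine iSup_le fun j => ?_
      by_cases h : j = i
      · exact h ▸ le_sup_left
      · exact le_sup_of_le_right (le_iSup₂_of_le j h le_rfl)
    exact this trivial
  obtain ⟨a, ha, b, hb, rfl⟩ := Submodule.mem_sup.1 h1
  have hb' : b ∈ B i := (Submodule.add_mem_iff_right _ (hAB i ha)).1 hx
  have hb2 : b ∈ ⨆ (j) (_ : j ≠ i), B j := (iSup₂_mono fun j _ => hAB j) hb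
  rw [Submodule.disjoint_def.1 (hB i) b hb' hb2, add_zero]
  exact ha

end Basic

/-! ### Iterated brackets of Chevalley generators -/

section Words

variable {V : Type} [AddCommGroup V] [Module ℂ V] {L : LieSuperalgebra V} {𝔥 : Submodule ℂ V}
  {ι : Type} [DecidableEq ι]

/-- `IsWord L e μ w`: the vector `w` is an iterated bracket `[e i₁, [e i₂, …, e iₖ]]` in which
every `e i` occurs `μ i` times. -/
inductive IsWord (L : LieSuperalgebra V) (e : ι → V) : (ι → ℤ) → V → Prop
  | gen (i : ι) : IsWord L e (Pi.single i 1) (e i)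
  | step (i : ι) (μ : ι → ℤ) (w : V) (hw : IsWord L e μ w) :
      IsWord L e (μ + Pi.single i 1) (L.bracket (e i) w)

theorem IsWord.nonneg {e : ι → V} {μ : ι → ℤ} {w : V} (hw : L.IsWord e μ w) : 0 ≤ μ := by
  induction hw with
  | gen i => exact Pi.single_nonneg.2 zero_le_one
  | step i μ w _ ih => exact add_nonneg ih (Pi.single_nonneg.2 zero_le_one)

theorem IsWord.ne_zero {e : ι → V} {μ : ι → ℤ} {w : V} (hw : L.IsWord e μ w) : μ ≠ 0 := by
  cases hw with
  | gen i => simp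
  | step i μ w hw =>
    intro h
    have h1 := congrFun h i
    have h2 := hw.nonneg i
    simp at h1 h2
    omega

variable [Fintype ι]

/-- The integral combination of the roots `β i` with coefficients `μ`. -/
abbrev weight (β : ι → Module.Dual ℂ 𝔥) : (ι → ℤ) →ₗ[ℤ] Module.Dual ℂ 𝔥 :=
  Fintype.linearCombination ℤ β

theorem weight_single (β : ι → Module.Dual ℂ 𝔥) (i : ι) : weight β (Pi.single i 1) = β i := by
  rw [Fintype.linearCombination_apply_single, one_smul]

theorem weight_injective {β : ι → Module.Dual ℂ 𝔥} (hβ : LinearIndependent ℂ β) :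
    Function.Injective (weight β) := by
  have h := hβ.restrict_scalars (R := ℤ) (fun a b h => by simpa using h)
  exact LinearIndependent.fintypeLinearCombination_injective h

theorem weight_neg (β : ι → Module.Dual ℂ 𝔥) (μ : ι → ℤ) :
    weight (fun i => -β i) μ = -weight β μ := by
  simp [Fintype.linearCombination_apply]

theorem IsWord.mem_rootSpace (h𝔥 : 𝔥 ≤ L.part 0) {β : ι → Module.Dual ℂ 𝔥} {e : ι → V}
    (he : ∀ i, e i ∈ L.rootSpace 𝔥 (β i)) {μ : ι → ℤ} {w : V} (hw : L.IsWord e μ w) :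
    w ∈ L.rootSpace 𝔥 (weight β μ) := by
  induction hw with
  | gen i => rw [weight_single]; exact he i
  | step i μ w _ ih =>
    rw [map_add, weight_single, add_comm]
    exact bracket_mem_rootSpace h𝔥 (he i) ih

/-- A word with at least one bracket has total degree at least two. This is what makes the simple
root spaces one-dimensional. -/
theorem IsWord.eq_gen {e : ι → V} {i : ι} {w : V} (hw : L.IsWord e (Pi.single i 1) w) :
    w = e i := by
  generalize hμ : (Pi.single i 1 : ι → ℤ) = μ at hw
  cases hw with
  | gen j =>
    have h := congrFun hμ i
    by_cases hij : i = j
    · rw [hij]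
    · simp [hij] at h
  | step j μ w hw =>
    exfalso
    refine hw.ne_zero (le_antisymm (fun k => ?_) hw.nonneg)
    have h1 := congrFun hμ k
    have h2 := congrFun hμ j
    have h3 := hw.nonneg j
    by_cases hij : i = j
    · subst hij
      simp at h1
      simp [← h1]
    · simp [hij] at h2 h3
      have : (Pi.single i 1 : ι → ℤ) j = 0 := Pi.single_eq_of_ne (Ne.symm hij) _
      omega

/-! ### Triangular decomposition -/

namespace ChevalleyGenerators

variable {β : ι → Module.Dual ℂ 𝔥} (g : L.ChevalleyGenerators 𝔥 β)

/-- The Chevalley generators with the roles of `e` and `f` interchanged. -/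
def opp : L.ChevalleyGenerators 𝔥 (fun i => -β i) where
  parity := g.parity
  e := g.f
  f := g.e
  coroot i := -(superSign (g.parity i) (g.parity i) • g.coroot i)
  e_mem := g.f_mem
  f_mem i := by rw [neg_neg]; exact g.e_mem i
  bracket_self i := by
    rw [L.skew _ _ _ _ (g.f_mem i).2 (g.e_mem i).2, g.bracket_self]; rfl
  bracket_ne i j h := by
    rw [L.skew _ _ _ _ (g.f_mem i).2 (g.e_mem j).2, g.bracket_ne j i h.symm]; simp
  generates := by
    rw [Set.union_assoc, Set.union_comm (Set.range g.f), ← Set.union_assoc]; exact g.generates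

/-- The span of the iterated brackets of the `e i`. -/
def posSpan : Submodule ℂ V := Submodule.span ℂ {w | ∃ μ, L.IsWord g.e μ w}

theorem bracket_e_posSpan (i : ι) {x : V} (hx : x ∈ g.posSpan) :
    L.bracket (g.e i) x ∈ g.posSpan := by
  induction hx using Submodule.span_induction with
  | mem x hx =>
    obtain ⟨μ, hw⟩ := hx
    exact Submodule.subset_span ⟨_, .step i μ x hw⟩
  | zero => simp
  | add x y _ _ hx hy => rw [map_add]; exact add_mem hx hy
  | smul c x _ hx => rw [map_smul]; exact Submodule.smul_mem _ _ hx

theorem bracket_e_cartan (h𝔥 : 𝔥 ≤ L.part 0) (i : ι) {x : V} (hx : x ∈ 𝔥) :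
    L.bracket (g.e i) x ∈ g.posSpan := by
  rw [bracket_cartan_right h𝔥 (g.e_mem i).1 ⟨x, hx⟩]
  exact neg_mem (Submodule.smul_mem _ _ (Submodule.subset_span ⟨_, .gen i⟩))

theorem bracket_cartan_posSpan (h𝔥 : 𝔥 ≤ L.part 0) (h : 𝔥) {x : V} (hx : x ∈ g.posSpan) :
    L.bracket h x ∈ g.posSpan := by
  induction hx using Submodule.span_induction with
  | mem x hx =>
    obtain ⟨μ, hw⟩ := hx
    rw [hw.mem_rootSpace h𝔥 (fun i => (g.e_mem i).1) h]
    exact Submodule.smul_mem _ _ (Submodule.subset_span ⟨_, hw⟩)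
  | zero => simp
  | add x y _ _ hx hy => rw [map_add]; exact add_mem hx hy
  | smul c x _ hx => rw [map_smul]; exact Submodule.smul_mem _ _ hx

/-- Induction on words: by the Jacobi identity `f i` either meets a letter, where `[f i, e j]` is
zero or in `𝔥`, or moves on to a shorter word. -/
theorem bracket_f_posSpan (h𝔥 : 𝔥 ≤ L.part 0) (i : ι) {x : V} (hx : x ∈ g.posSpan) :
    L.bracket (g.f i) x ∈ g.posSpan ⊔ 𝔥 := by
  induction hx using Submodule.span_induction with
  | mem x hx =>
    obtain ⟨μ, hw⟩ := hx
    induction hw with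
    | gen j =>
      by_cases h : i = j
      · subst h
        have := g.opp.bracket_self i
        change L.bracket (g.f i) (g.e i) = _ at this
        rw [this]
        exact Submodule.mem_sup_right (Subtype.property _)
      · have := g.opp.bracket_ne i j h
        change L.bracket (g.f i) (g.e j) = 0 at this
        rw [this]
        exact zero_mem _
    | step j μ w hw ih =>
      rw [L.jacobi _ _ _ _ _ (g.f_mem i).2 (g.e_mem j).2]
      refine add_mem ?_ (Submodule.smul_mem _ _ ?_)
      · have hws : w ∈ g.posSpan := Submodule.subset_span ⟨_, hw⟩
        by_cases h : i = j
        · subst h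
          have := g.opp.bracket_self i
          change L.bracket (g.f i) (g.e i) = _ at this
          rw [this]
          exact Submodule.mem_sup_left (g.bracket_cartan_posSpan h𝔥 _ hws)
        · have := g.opp.bracket_ne i j h
          change L.bracket (g.f i) (g.e j) = 0 at this
          rw [this]
          simp
      · obtain ⟨a, ha, b, hb, hab⟩ := Submodule.mem_sup.1 ih
        rw [← hab, map_add]
        exact Submodule.mem_sup_left
          (add_mem (g.bracket_e_posSpan j ha) (g.bracket_e_cartan h𝔥 j hb))
  | zero => simp
  | add x y _ _ hx hy => rw [map_add]; exact add_mem hx hy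
  | smul c x _ hx => rw [map_smul]; exact Submodule.smul_mem _ _ hx

theorem bracket_e_total (h𝔥 : 𝔥 ≤ L.part 0) (i : ι) {x : V}
    (hx : x ∈ g.posSpan ⊔ 𝔥 ⊔ g.opp.posSpan) :
    L.bracket (g.e i) x ∈ g.posSpan ⊔ 𝔥 ⊔ g.opp.posSpan := by
  obtain ⟨a, ha, c, hc, rfl⟩ := Submodule.mem_sup.1 hx
  obtain ⟨a, ha', b, hb, rfl⟩ := Submodule.mem_sup.1 ha
  rw [map_add, map_add]
  refine add_mem (add_mem ?_ ?_) ?_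
  · exact Submodule.mem_sup_left (Submodule.mem_sup_left (g.bracket_e_posSpan i ha'))
  · exact Submodule.mem_sup_left (Submodule.mem_sup_left (g.bracket_e_cartan h𝔥 i hb))
  · have := g.opp.bracket_f_posSpan h𝔥 i hc
    exact (sup_le le_sup_right (le_sup_of_le_left le_sup_right) :
      g.opp.posSpan ⊔ 𝔥 ≤ g.posSpan ⊔ 𝔥 ⊔ g.opp.posSpan) this

/-- The triangular decomposition (without directness). -/
theorem triangular (h𝔥 : 𝔥 ≤ L.part 0) (hc : ∀ h h' : 𝔥, L.bracket h h' = 0) :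
    g.posSpan ⊔ 𝔥 ⊔ g.opp.posSpan = ⊤ := by
  set S := g.posSpan ⊔ 𝔥 ⊔ g.opp.posSpan with hS
  have hS' : S = g.opp.posSpan ⊔ 𝔥 ⊔ g.opp.opp.posSpan := by
    rw [hS, sup_assoc, sup_comm, sup_comm 𝔥]; rfl
  have hE : ∀ i, ∀ x ∈ S, L.bracket (g.e i) x ∈ S := fun i x hx => g.bracket_e_total h𝔥 i hx
  have hF : ∀ i, ∀ x ∈ S, L.bracket (g.f i) x ∈ S := by
    intro i x hx
    rw [hS'] at hx ⊢
    exact g.opp.bracket_e_total h𝔥 i hx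
  have hH : ∀ h ∈ 𝔥, ∀ x ∈ S, L.bracket h x ∈ S := by
    intro h hh x hx
    obtain ⟨a, ha, c, hc', rfl⟩ := Submodule.mem_sup.1 hx
    obtain ⟨a, ha', b, hb, rfl⟩ := Submodule.mem_sup.1 ha
    rw [map_add, map_add, hc ⟨h, hh⟩ ⟨b, hb⟩, add_zero]
    exact add_mem
      (Submodule.mem_sup_left (Submodule.mem_sup_left (g.bracket_cartan_posSpan h𝔥 ⟨h, hh⟩ ha')))
      (Submodule.mem_sup_right (g.opp.bracket_cartan_posSpan h𝔥 ⟨h, hh⟩ hc'))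
  -- The homogeneous elements whose bracket preserves `S`. Jacobi makes their span a subalgebra, and
  -- it contains all generators, so everything preserves `S`.
  let T : ZMod 2 → Submodule ℂ V := fun a =>
    L.part a ⊓ ⨅ x ∈ S, S.comap (L.bracket.flip x)
  have hT : ∀ a x, x ∈ T a ↔ x ∈ L.part a ∧ ∀ y ∈ S, L.bracket x y ∈ S := by
    intro a x
    simp [T, Submodule.mem_iInf]
  have hbr : ∀ a b x y, x ∈ T a → y ∈ T b → L.bracket x y ∈ T (a + b) := by
    intro a b x y hx hy
    rw [hT] at hx hy ⊢
    refine ⟨L.bracket_mem _ _ _ _ hx.1 hy.1, fun z hz => ?_⟩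
    have h1 := L.jacobi a b x y z hx.1 hy.1
    rw [← sub_eq_iff_eq_add] at h1
    rw [← h1]
    exact sub_mem (hx.2 _ (hy.2 _ hz)) (Submodule.smul_mem _ _ (hy.2 _ (hx.2 _ hz)))
  have hle : ∀ a, T a ≤ T 0 ⊔ T 1 := by
    have h01 : ∀ c : ZMod 2, c = 0 ∨ c = 1 := by decide
    intro a
    rcases h01 a with rfl | rfl
    exacts [le_sup_left, le_sup_right]
  have hTtop : T 0 ⊔ T 1 = ⊤ := by
    apply g.generates
    · rintro x ((hx | ⟨i, rfl⟩) | ⟨i, rfl⟩)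
      · exact hle 0 ((hT 0 x).2 ⟨h𝔥 hx, hH x hx⟩)
      · exact hle _ ((hT (g.parity i) _).2 ⟨(g.e_mem i).2, hE i⟩)
      · exact hle _ ((hT (g.parity i) _).2 ⟨(g.f_mem i).2, hF i⟩)
    · intro x hx y hy
      obtain ⟨x0, hx0, x1, hx1, rfl⟩ := Submodule.mem_sup.1 hx
      obtain ⟨y0, hy0, y1, hy1, rfl⟩ := Submodule.mem_sup.1 hy
      simp only [map_add, LinearMap.add_apply]
      exact add_mem (add_mem (hle _ (hbr _ _ _ _ hx0 hy0)) (hle _ (hbr _ _ _ _ hx1 hy0)))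
        (add_mem (hle _ (hbr _ _ _ _ hx0 hy1)) (hle _ (hbr _ _ _ _ hx1 hy1)))
  -- Now `S` is stable under every bracket, hence is a subalgebra containing the generators.
  apply g.generates
  · rintro x ((hx | ⟨i, rfl⟩) | ⟨i, rfl⟩)
    · exact Submodule.mem_sup_left (Submodule.mem_sup_right hx)
    · exact Submodule.mem_sup_left (Submodule.mem_sup_left (Submodule.subset_span ⟨_, .gen i⟩))
    · exact Submodule.mem_sup_right (Submodule.subset_span ⟨_, .gen (e := g.opp.e) i⟩)
  · intro x hx y hy
    obtain ⟨x0, hx0, x1, hx1, rfl⟩ := Submodule.mem_sup.1 (hTtop ▸ Submodule.mem_top : x ∈ _)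
    rw [map_add, LinearMap.add_apply]
    exact add_mem (((hT _ _).1 hx0).2 y hy) (((hT _ _).1 hx1).2 y hy)

/-- The part of weight `lam` of the triangular decomposition. -/
def wordSpan (lam : Module.Dual ℂ 𝔥) : Submodule ℂ V :=
  Submodule.span ℂ {w | (∃ μ, L.IsWord g.e μ w ∧ weight β μ = lam) ∨
    (∃ μ, L.IsWord g.f μ w ∧ -weight β μ = lam) ∨ (lam = 0 ∧ w ∈ 𝔥)}

theorem iSup_wordSpan (h𝔥 : 𝔥 ≤ L.part 0) (hc : ∀ h h' : 𝔥, L.bracket h h' = 0) :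
    ⨆ lam, g.wordSpan lam = ⊤ := by
  rw [eq_top_iff]
  rw [← g.triangular h𝔥 hc]
  refine sup_le (sup_le (Submodule.span_le.2 ?_) ?_) (Submodule.span_le.2 ?_)
  · rintro w ⟨μ, hw⟩
    exact Submodule.mem_iSup_of_mem (weight β μ)
      (Submodule.subset_span (Or.inl ⟨μ, hw, rfl⟩))
  · intro w hw
    exact Submodule.mem_iSup_of_mem 0 (Submodule.subset_span (Or.inr (Or.inr ⟨rfl, hw⟩)))
  · rintro w ⟨μ, hw⟩
    exact Submodule.mem_iSup_of_mem (-weight β μ)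
      (Submodule.subset_span (Or.inr (Or.inl ⟨μ, hw, rfl⟩)))

/-- The word spans sit inside the independent root spaces and already add up to everything, so no
inclusion can be strict. -/
theorem wordSpan_eq_rootSpace (h𝔥 : 𝔥 ≤ L.part 0) (hc : ∀ h h' : 𝔥, L.bracket h h' = 0)
    (lam : Module.Dual ℂ 𝔥) : g.wordSpan lam = L.rootSpace 𝔥 lam := by
  refine eq_of_iSupIndep (A := g.wordSpan) (iSupIndep_rootSpace h𝔥 hc)
    (fun lam => Submodule.span_le.2 ?_) (top_le_iff.1 ?_) lam
  · rintro w (⟨μ, hw, h⟩ | ⟨μ, hw, h⟩ | ⟨h, hw⟩)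
    · rw [← h]
      exact hw.mem_rootSpace h𝔥 (fun i => (g.e_mem i).1)
    · rw [← h, ← weight_neg]
      exact hw.mem_rootSpace h𝔥 (fun i => (g.f_mem i).1)
    · intro h'
      rw [hc h' ⟨w, hw⟩, h]; simp
  · exact (g.iSup_wordSpan h𝔥 hc).ge

/-- A nonzero root space needs at least one spanning word, in the `e i` or in the `f i`; its degree
gives the coefficients. -/
theorem exists_weight_of_isRoot (g : L.ChevalleyGenerators 𝔥 β) (h𝔥 : 𝔥 ≤ L.part 0) (hc : ∀ h h' : 𝔥, L.bracket h h' = 0)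
    {α : Module.Dual ℂ 𝔥} (hα : L.IsRoot 𝔥 α) :
    ∃ μ : ι → ℤ, 0 ≤ μ ∧ μ ≠ 0 ∧ (α = weight β μ ∨ α = -weight β μ) := by
  obtain ⟨h0, h1⟩ := hα
  rw [← g.wordSpan_eq_rootSpace h𝔥 hc] at h1
  by_contra hcon
  push Not at hcon
  refine h1 (eq_bot_iff.2 (Submodule.span_le.2 ?_))
  rintro w (⟨μ, hw, rfl⟩ | ⟨μ, hw, rfl⟩ | ⟨rfl, hw⟩)
  · exact absurd rfl (hcon μ hw.nonneg hw.ne_zero).1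
  · exact absurd rfl (hcon μ hw.nonneg hw.ne_zero).2
  · exact absurd rfl h0

/-- By linear independence of the roots a weight determines its coefficients, which rules out words
in the `f i` and elements of `𝔥`. -/
theorem rootSpace_weight (h𝔥 : 𝔥 ≤ L.part 0) (hc : ∀ h h' : 𝔥, L.bracket h h' = 0)
    (hβ : LinearIndependent ℂ β) {μ : ι → ℤ} (h0 : 0 ≤ μ) (h1 : μ ≠ 0) :
    L.rootSpace 𝔥 (weight β μ) = Submodule.span ℂ {w | L.IsWord g.e μ w} := by
  rw [← g.wordSpan_eq_rootSpace h𝔥 hc, wordSpan]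
  congr 1
  ext w
  constructor
  · rintro (⟨ν, hw, h⟩ | ⟨ν, hw, h⟩ | ⟨h, hw⟩)
    · rw [← weight_injective hβ h]; exact hw
    · rw [← map_neg] at h
      have h2 := weight_injective hβ h
      have h3 := hw.nonneg
      rw [← h2] at h0
      exact absurd (le_antisymm (neg_nonneg.1 h0) h3) hw.ne_zero
    · rw [← map_zero (weight β)] at h
      exact absurd (weight_injective hβ h) h1
  · intro hw
    exact Or.inl ⟨μ, hw, rfl⟩

theorem rootSpace_eq_span_e (h𝔥 : 𝔥 ≤ L.part 0) (hc : ∀ h h' : 𝔥, L.bracket h h' = 0)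
    (hβ : LinearIndependent ℂ β) (i : ι) : L.rootSpace 𝔥 (β i) = Submodule.span ℂ {g.e i} := by
  rw [← weight_single β i, g.rootSpace_weight h𝔥 hc hβ (Pi.single_nonneg.2 zero_le_one) (by simp)]
  congr 1
  ext w
  exact ⟨fun h => IsWord.eq_gen h, fun h => by rw [Set.mem_singleton_iff.1 h]; exact .gen i⟩

theorem rootSpace_eq_span_f (h𝔥 : 𝔥 ≤ L.part 0) (hc : ∀ h h' : 𝔥, L.bracket h h' = 0)
    (hβ : LinearIndependent ℂ β) (i : ι) : L.rootSpace 𝔥 (-β i) = Submodule.span ℂ {g.f i} :=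
  g.opp.rootSpace_eq_span_e h𝔥 hc
    (by convert hβ.units_smul (fun _ => (-1 : ℂˣ)) using 2; simp) i

theorem iSup_rootSpace (g : L.ChevalleyGenerators 𝔥 β) (h𝔥 : 𝔥 ≤ L.part 0)
    (hc : ∀ h h' : 𝔥, L.bracket h h' = 0) : ⨆ lam, L.rootSpace 𝔥 lam = ⊤ := by
  simp only [← g.wordSpan_eq_rootSpace h𝔥 hc, g.iSup_wordSpan h𝔥 hc]

end ChevalleyGenerators

end Words

end LieSuperalgebra

namespace LieSuperalgebra

/-! ### The invariant form on weight spaces -/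

section Form

variable {V : Type} [AddCommGroup V] [Module ℂ V] {L : LieSuperalgebra V} {𝔥 : Submodule ℂ V}

namespace InvariantForm

variable (F : L.InvariantForm 𝔥)

include F in
-- Moving some `t ∈ 𝔥` with `(α + β) t ≠ 0` across the form gives `(α + β) t * form x y = 0`.
theorem form_eq_zero {α β : Module.Dual ℂ 𝔥} {x y : V} (hx : x ∈ L.rootSpace 𝔥 α)
    (hy : y ∈ L.rootSpace 𝔥 β) (h : α + β ≠ 0) : F.form x y = 0 := by
  obtain ⟨t, ht⟩ : ∃ t, (α + β) t ≠ 0 := by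
    by_contra! hcon
    exact h (LinearMap.ext hcon)
  have h1 := F.form_bracket x t y
  rw [bracket_cartan_right F.cartan_even hx, hy t, map_neg, map_smul, map_smul, LinearMap.neg_apply,
    LinearMap.smul_apply, smul_eq_mul, smul_eq_mul] at h1
  have h2 : (α + β) t * F.form x y = 0 := by
    rw [LinearMap.add_apply]; linear_combination -h1
  exact (mul_eq_zero.1 h2).resolve_left ht

theorem exists_form_ne_zero (htop : ⨆ lam, L.rootSpace 𝔥 lam = ⊤) {α : Module.Dual ℂ 𝔥} {x : V}
    (hx : x ∈ L.rootSpace 𝔥 α) (h0 : x ≠ 0) : ∃ y ∈ L.rootSpace 𝔥 (-α), F.form x y ≠ 0 := by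
  by_contra! hcon
  refine h0 (F.form_nondegenerate x fun y => ?_)
  have hy : y ∈ ⨆ lam, L.rootSpace 𝔥 lam := htop ▸ Submodule.mem_top
  induction hy using Submodule.iSup_induction' with
  | mem lam y hy =>
    by_cases h : α + lam = 0
    · exact hcon y (by rwa [← eq_neg_of_add_eq_zero_right h])
    · exact F.form_eq_zero hx hy h
  | zero => simp
  | add y z _ _ hy hz => rw [map_add, hy, hz, add_zero]

/-- Through the form, every `[e, f] ∈ 𝔥` with `f` of weight `-α` corresponds to a multiple of `α`.
-/
theorem form_coroot {α : Module.Dual ℂ 𝔥} {e f : V} (hf : f ∈ L.rootSpace 𝔥 (-α)) (h : 𝔥) :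
    F.form (L.bracket e f) h = F.form e f * α h := by
  rw [F.form_bracket, bracket_cartan_right F.cartan_even hf]
  simp [mul_comm]

/-- The form is nondegenerate on the Cartan subspace. -/
theorem eq_zero_of_form_cartan (htop : ⨆ lam, L.rootSpace 𝔥 lam = ⊤) (t : 𝔥)
    (ht : ∀ h : 𝔥, F.form t h = 0) : t = 0 := by
  have h0 : (t : V) ∈ L.rootSpace 𝔥 0 := fun h => by rw [F.bracket_cartan]; simp
  by_contra hne
  obtain ⟨y, hy, hy'⟩ := F.exists_form_ne_zero htop h0 (fun h => hne (Subtype.ext h))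
  rw [neg_zero] at hy
  exact hy' (ht ⟨y, F.rootSpace_zero_le hy⟩)

end InvariantForm

end Form

/-! ### Odd reflections of root bases -/

section OddReflection

variable {V : Type} [AddCommGroup V] [Module ℂ V] {L : LieSuperalgebra V} {𝔥 : Submodule ℂ V}
  {ι : Type} [DecidableEq ι]

theorem IsWord.eq_of_two [Fintype ι] {f : ι → V} {i j : ι} {w : V}
    (hw : L.IsWord f (Pi.single i 1 + Pi.single j 1) w) :
    w = L.bracket (f i) (f j) ∨ w = L.bracket (f j) (f i) := by
  generalize hμ : (Pi.single i 1 + Pi.single j 1 : ι → ℤ) = μ at hw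
  cases hw with
  | gen k =>
    exfalso
    have h1 := congrFun hμ i
    have h2 := congrFun hμ j
    simp only [Pi.add_apply, Pi.single_apply, if_true] at h1 h2
    grind
  | step k μ w hw =>
    have hk : k = i ∨ k = j := by
      by_contra! hcon
      have h1 := congrFun hμ k
      have h2 := hw.nonneg k
      simp only [Pi.add_apply, Pi.single_apply, if_true, hcon.1, hcon.2, if_false] at h1 h2
      simp at h2
      omega
    rcases hk with rfl | rfl
    · rw [add_comm, add_left_inj] at hμ
      rw [← hμ] at hw
      rw [hw.eq_gen]; exact Or.inl rfl
    · rw [add_left_inj] at hμ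
      rw [← hμ] at hw
      rw [hw.eq_gen]; exact Or.inr rfl

variable [Fintype ι]

namespace ChevalleyGenerators

variable {β : ι → Module.Dual ℂ 𝔥} (g : L.ChevalleyGenerators 𝔥 β)

theorem bracket_f_e (i : ι) :
    L.bracket (g.f i) (g.e i) = -(superSign (g.parity i) (g.parity i) • (g.coroot i : V)) := by
  rw [L.skew _ _ _ _ (g.f_mem i).2 (g.e_mem i).2, g.bracket_self]

theorem bracket_f_e_ne {i j : ι} (h : i ≠ j) : L.bracket (g.f i) (g.e j) = 0 :=
  g.opp.bracket_ne i j h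

theorem bracket_coroot_e (i j : ι) :
    L.bracket (g.coroot i) (g.e j) = β j (g.coroot i) • g.e j := (g.e_mem j).1 _

/-- If `b i j ≠ 0` this recovers `e j` from `[e i, e j]`, so that reflected generators are nonzero
and still generate. -/
theorem bracket_f_bracket_e {i j : ι} (h : i ≠ j) :
    L.bracket (g.f i) (L.bracket (g.e i) (g.e j)) =
      -(superSign (g.parity i) (g.parity i) * β j (g.coroot i)) • g.e j := by
  rw [L.jacobi _ _ _ _ _ (g.f_mem i).2 (g.e_mem i).2, g.bracket_f_e_ne h, map_zero, smul_zero,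
    add_zero, g.bracket_f_e, map_neg, map_smul, LinearMap.neg_apply, LinearMap.smul_apply,
    g.bracket_coroot_e, smul_smul, neg_smul]

theorem bracket_e_bracket_f {i j : ι} (h : i ≠ j) :
    L.bracket (g.e i) (L.bracket (g.f i) (g.f j)) = -(β j (g.coroot i)) • g.f j := by
  have h1 := g.opp.bracket_f_bracket_e h
  change L.bracket (g.e i) (L.bracket (g.f i) (g.f j)) =
    -(superSign (g.parity i) (g.parity i) *
      (-β j) (-(superSign (g.parity i) (g.parity i) • g.coroot i))) • g.f j at h1
  rw [h1, LinearMap.neg_apply, map_neg, neg_neg, map_smul, smul_eq_mul, ← mul_assoc,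
    superSign_mul_self, one_mul]

theorem bracket_f_bracket_e_self (i : ι) (h : g.parity i = 1) :
    L.bracket (g.f i) (L.bracket (g.e i) (g.e i)) = (2 * β i (g.coroot i)) • g.e i := by
  have hm := (g.e_mem i).2
  rw [L.jacobi _ _ _ _ _ (g.f_mem i).2 hm, g.bracket_f_e, h]
  simp only [superSign_one_one, neg_smul, one_smul, neg_neg]
  rw [g.bracket_coroot_e, ← sub_eq_add_neg, sub_eq_iff_eq_add, two_mul, add_smul]
  have := skew_even (L := L) (x := g.coroot i) (by
    have := L.bracket_mem _ _ _ _ hm (g.f_mem i).2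
    rw [g.bracket_self, h] at this
    exact this) (g.e i)
  rw [g.bracket_coroot_e] at this
  rw [this]
  abel

/-- A weight with coefficients of both signs is neither zero nor a root. -/
theorem rootSpace_weight_eq_bot (g : L.ChevalleyGenerators 𝔥 β) (h𝔥 : 𝔥 ≤ L.part 0) (hc : ∀ h h' : 𝔥, L.bracket h h' = 0)
    (hβ : LinearIndependent ℂ β) {μ : ι → ℤ} {j k : ι} (hj : 0 < μ j) (hk : μ k < 0) :
    L.rootSpace 𝔥 (weight β μ) = ⊥ := by
  by_contra hne
  have h0 : weight β μ ≠ 0 := by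
    intro h
    rw [← map_zero (weight β)] at h
    rw [weight_injective hβ h] at hj
    exact lt_irrefl _ hj
  obtain ⟨ν, hν, -, h | h⟩ := g.exists_weight_of_isRoot h𝔥 hc ⟨h0, hne⟩
  · rw [weight_injective hβ h] at hk
    exact absurd (hν k) (not_le.2 hk)
  · rw [← map_neg] at h
    rw [weight_injective hβ h, Pi.neg_apply] at hj
    have := hν j
    simp at this hj
    omega

theorem e_ne_zero (h𝔥 : 𝔥 ≤ L.part 0) (hc : ∀ h h' : 𝔥, L.bracket h h' = 0)
    (hβ : LinearIndependent ℂ β) {i : ι} (hi : L.IsRoot 𝔥 (β i)) : g.e i ≠ 0 := by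
  intro h
  have := hi.2
  rw [g.rootSpace_eq_span_e h𝔥 hc hβ, h, Submodule.span_zero_singleton] at this
  exact this rfl

/-- Some vector of weight `-β i` pairs nontrivially with `e i`, and that space is the line of `f i`.
-/
theorem form_e_f_ne_zero (F : L.InvariantForm 𝔥) (hβ : LinearIndependent ℂ β) {i : ι}
    (hi : L.IsRoot 𝔥 (β i)) : F.form (g.e i) (g.f i) ≠ 0 := by
  obtain ⟨y, hy, h⟩ := F.exists_form_ne_zero
    (g.iSup_rootSpace F.cartan_even F.bracket_cartan) (g.e_mem i).1
    (g.e_ne_zero F.cartan_even F.bracket_cartan hβ hi)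
  rw [g.rootSpace_eq_span_f F.cartan_even F.bracket_cartan hβ] at hy
  obtain ⟨c, rfl⟩ := Submodule.mem_span_singleton.1 hy
  intro h0
  rw [map_smul, h0, smul_zero] at h
  exact h rfl

theorem f_ne_zero (F : L.InvariantForm 𝔥) (hβ : LinearIndependent ℂ β) {i : ι}
    (hi : L.IsRoot 𝔥 (β i)) : g.f i ≠ 0 := by
  intro h
  apply g.form_e_f_ne_zero F hβ hi
  rw [h, map_zero]

/-- Let `x = [e i, e j]`. If `b i j = 0` then `[x, f i] = 0`, and invariance gives `(x, [f i, f j])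
= 0`. The space of weight `-(β i + β j)` is spanned by `[f i, f j]` and `[f j, f i]`, so `x` is
orthogonal to it and vanishes. The case `i = j` is included and says that an odd isotropic `e i` has
square zero. -/
theorem bracket_e_e_eq_zero (F : L.InvariantForm 𝔥) (hβ : LinearIndependent ℂ β) {i j : ι}
    (hij : β j (g.coroot i) = 0) : L.bracket (g.e i) (g.e j) = 0 := by
  by_contra hne
  have hmem := bracket_mem_rootSpace F.cartan_even (g.e_mem i).1 (g.e_mem j).1
  have hfx : L.bracket (g.f i) (L.bracket (g.e i) (g.e j)) = 0 := by
    by_cases h : i = j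
    · subst h
      rw [L.jacobi _ _ _ _ _ (g.f_mem i).2 (g.e_mem i).2, g.bracket_f_e, map_neg, map_smul, map_neg,
        map_smul, LinearMap.neg_apply, LinearMap.smul_apply, g.bracket_coroot_e,
        bracket_cartan_right F.cartan_even (g.e_mem i).1, hij]
      simp
    · rw [g.bracket_f_bracket_e h, hij]; simp
  have hxf : L.bracket (L.bracket (g.e i) (g.e j)) (g.f i) = 0 := by
    rw [L.skew _ _ _ _ (L.bracket_mem _ _ _ _ (g.e_mem i).2 (g.e_mem j).2) (g.f_mem i).2, hfx]
    simp
  obtain ⟨y, hy, h⟩ := F.exists_form_ne_zero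
    (g.iSup_rootSpace F.cartan_even F.bracket_cartan) hmem hne
  have hw : -(β i + β j) = weight (fun i => -β i) (Pi.single i 1 + Pi.single j 1) := by
    rw [weight_neg, map_add, weight_single, weight_single]
  rw [hw, g.opp.rootSpace_weight F.cartan_even F.bracket_cartan
    (by convert hβ.units_smul (fun _ => (-1 : ℂˣ)) using 2; simp)
    (add_nonneg (Pi.single_nonneg.2 zero_le_one) (Pi.single_nonneg.2 zero_le_one))
    (fun h0 => by
      have h1 := congrFun h0 i
      have : (0 : ι → ℤ) ≤ Pi.single j 1 := Pi.single_nonneg.2 zero_le_one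
      replace this : (0 : ℤ) ≤ _ := this i
      simp at h1
      omega)] at hy
  apply h
  clear h
  have h1 : F.form (L.bracket (g.e i) (g.e j)) (L.bracket (g.f i) (g.f j)) = 0 := by
    rw [← F.form_bracket, hxf, map_zero, LinearMap.zero_apply]
  induction hy using Submodule.span_induction with
  | mem y hy =>
    rcases IsWord.eq_of_two hy with rfl | rfl
    · exact h1
    · change F.form _ (L.bracket (g.f j) (g.f i)) = 0
      rw [L.skew _ _ _ _ (g.f_mem j).2 (g.f_mem i).2, map_neg, map_smul, h1]
      simp
  | zero => simp
  | add y z _ _ hy hz => rw [map_add, hy, hz, add_zero]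
  | smul c y _ hy => rw [map_smul, hy, smul_zero]

/-- For odd `e` the Jacobi identity reads `2 [e, [e, y]] = [[e, e], y]`. -/
theorem bracket_e_bracket_e (F : L.InvariantForm 𝔥) (hβ : LinearIndependent ℂ β) {i : ι}
    (hp : g.parity i = 1) (hi : β i (g.coroot i) = 0) (y : V) :
    L.bracket (g.e i) (L.bracket (g.e i) y) = 0 := by
  have h1 := L.jacobi _ _ _ _ y (g.e_mem i).2 (g.e_mem i).2
  rw [g.bracket_e_e_eq_zero F hβ hi, hp, superSign_one_one, map_zero, LinearMap.zero_apply,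
    zero_add, neg_one_smul, eq_neg_iff_add_eq_zero, ← two_smul ℂ] at h1
  exact (smul_eq_zero.1 h1).resolve_left two_ne_zero

theorem bracket_f_bracket_f (F : L.InvariantForm 𝔥) (hβ : LinearIndependent ℂ β) {i : ι}
    (hp : g.parity i = 1) (hi : β i (g.coroot i) = 0) (y : V) :
    L.bracket (g.f i) (L.bracket (g.f i) y) = 0 :=
  g.opp.bracket_e_bracket_e F (by convert hβ.units_smul (fun _ => (-1 : ℂˣ)) using 2; simp) hp
    (by simp [opp, hi]) y

/-- The simple roots of the odd reflection. -/
def reflectedRoot (i j : ι) : Module.Dual ℂ 𝔥 :=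
  if j = i then -β i else if β j (g.coroot i) = 0 then β j else β j + β i

/-- The coefficients of the simple roots of the odd reflection. -/
def reflectedCoeff (i j : ι) : ι → ℤ :=
  if j = i then -Pi.single i 1
    else if β j (g.coroot i) = 0 then Pi.single j 1 else Pi.single j 1 + Pi.single i 1

theorem weight_reflectedCoeff (i j : ι) : weight β (g.reflectedCoeff i j) = g.reflectedRoot i j := by
  unfold reflectedCoeff reflectedRoot
  split_ifs <;> simp only [map_neg, map_add, weight_single]

/-- The positive generators of the odd reflection. -/
def reflectedE (i j : ι) : V :=
  if j = i then g.f i else if β j (g.coroot i) = 0 then g.e j else L.bracket (g.e i) (g.e j)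

/-- The negative generators of the odd reflection. -/
def reflectedF (i j : ι) : V :=
  if j = i then g.e i else if β j (g.coroot i) = 0 then g.f j else L.bracket (g.f i) (g.f j)

/-- The parities of the generators of the odd reflection. -/
def reflectedParity (i j : ι) : ZMod 2 :=
  if j = i then g.parity i else if β j (g.coroot i) = 0 then g.parity j
    else g.parity i + g.parity j

theorem reflectedE_mem (h𝔥 : 𝔥 ≤ L.part 0) (i j : ι) :
    g.reflectedE i j ∈ L.rootSpace 𝔥 (g.reflectedRoot i j) ⊓ L.part (g.reflectedParity i j) := by
  unfold reflectedE reflectedRoot reflectedParity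
  split_ifs
  · exact g.f_mem i
  · exact g.e_mem j
  · rw [add_comm (β j)]
    exact ⟨bracket_mem_rootSpace h𝔥 (g.e_mem i).1 (g.e_mem j).1,
      L.bracket_mem _ _ _ _ (g.e_mem i).2 (g.e_mem j).2⟩

theorem reflectedF_mem (h𝔥 : 𝔥 ≤ L.part 0) (i j : ι) :
    g.reflectedF i j ∈ L.rootSpace 𝔥 (-g.reflectedRoot i j) ⊓ L.part (g.reflectedParity i j) := by
  unfold reflectedF reflectedRoot reflectedParity
  split_ifs
  · rw [neg_neg]; exact g.e_mem i
  · exact g.f_mem j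
  · rw [neg_add_rev]
    exact ⟨bracket_mem_rootSpace h𝔥 (g.f_mem i).1 (g.f_mem j).1,
      L.bracket_mem _ _ _ _ (g.f_mem i).2 (g.f_mem j).2⟩

theorem linearIndependent_reflectedRoot (hβ : LinearIndependent ℂ β) (i : ι) :
    LinearIndependent ℂ (g.reflectedRoot i) := by
  -- The reflected roots arise by adding multiples of `β i` to the other roots and then negating `β
  -- i`, both invertible operations.
  have h1 := (linearIndependent_add_smul_iff (R := ℂ) (v := β) (i := i)
    (c := fun j => if j = i then 0 else if β j (g.coroot i) = 0 then 0 else 1) (by simp)).2 hβ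
  have h2 := h1.units_smul (fun j => if j = i then (-1 : ℂˣ) else 1)
  suffices h : g.reflectedRoot i = (fun j => if j = i then (-1 : ℂˣ) else 1) •
      (β + fun j => (if j = i then (0 : ℂ) else if β j (g.coroot i) = 0 then 0 else 1) • β i) by
    rw [h]; exact h2
  funext j
  by_cases h : j = i
  · subst h; simp [reflectedRoot]
  · simp only [reflectedRoot, h, if_false, Pi.smul_apply', Pi.add_apply, one_smul]
    split_ifs <;> simp

/-- If `j` or `k` is `i`, this is `[e i, [e i, ·]] = 0`, its counterpart for `f`, or the vanishing
of a bracket with zero matrix entry. Otherwise the weight of the bracket has coefficient `1` at `j`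
and `-1` at `k`, and that weight space is zero. -/
theorem bracket_reflected_ne (F : L.InvariantForm 𝔥) (hβ : LinearIndependent ℂ β) {i : ι}
    (hp : g.parity i = 1) (hi : β i (g.coroot i) = 0) {j k : ι} (hjk : j ≠ k) :
    L.bracket (g.reflectedE i j) (g.reflectedF i k) = 0 := by
  by_cases hji : j = i
  · subst hji
    simp only [reflectedE, reflectedF, if_true, hjk.symm, if_false]
    split_ifs with h
    · exact g.opp.bracket_e_e_eq_zero F
        (by convert hβ.units_smul (fun _ => (-1 : ℂˣ)) using 2; simp) (by simp [opp, h])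
    · exact g.bracket_f_bracket_f F hβ hp hi _
  by_cases hki : k = i
  · subst hki
    rw [L.skew _ _ _ _ (g.reflectedE_mem F.cartan_even _ _).2
      (g.reflectedF_mem F.cartan_even _ _).2]
    simp only [reflectedE, reflectedF, if_true, hjk, if_false]
    split_ifs with h
    · rw [g.bracket_e_e_eq_zero F hβ h]; simp
    · rw [g.bracket_e_bracket_e F hβ hp hi]; simp
  have h1 := bracket_mem_rootSpace F.cartan_even (g.reflectedE_mem F.cartan_even i j).1
    (g.reflectedF_mem F.cartan_even i k).1
  rw [← weight_reflectedCoeff, ← weight_reflectedCoeff, ← sub_eq_add_neg, ← map_sub,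
    g.rootSpace_weight_eq_bot F.cartan_even F.bracket_cartan hβ (j := j) (k := k)] at h1
  · exact (Submodule.mem_bot ℂ).1 h1
  · simp only [reflectedCoeff, hji, hki, if_false, Pi.sub_apply]
    split_ifs <;> simp [hji, hjk]
  · simp only [reflectedCoeff, hji, hki, if_false, Pi.sub_apply]
    split_ifs <;> simp [hki, hjk.symm]

/-- The Chevalley generators of the odd reflection. -/
def reflected (F : L.InvariantForm 𝔥) (hβ : LinearIndependent ℂ β) {i : ι}
    (hp : g.parity i = 1) (hi : β i (g.coroot i) = 0) :
    L.ChevalleyGenerators 𝔥 (g.reflectedRoot i) where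
  parity := g.reflectedParity i
  e := g.reflectedE i
  f := g.reflectedF i
  coroot j := ⟨L.bracket (g.reflectedE i j) (g.reflectedF i j), F.rootSpace_zero_le (by
    have := bracket_mem_rootSpace F.cartan_even (g.reflectedE_mem F.cartan_even i j).1
      (g.reflectedF_mem F.cartan_even i j).1
    rwa [add_neg_cancel] at this)⟩
  e_mem := g.reflectedE_mem F.cartan_even i
  f_mem := g.reflectedF_mem F.cartan_even i
  bracket_self _ := rfl
  bracket_ne j k h := g.bracket_reflected_ne F hβ hp hi h
  generates := by
    intro S hS hcl
    have hei : g.e i ∈ S := hS (Or.inr ⟨i, if_pos rfl⟩)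
    have hfi : g.f i ∈ S := hS (Or.inl (Or.inr ⟨i, if_pos rfl⟩))
    refine g.generates S ?_ hcl
    rintro x ((hx | ⟨j, rfl⟩) | ⟨j, rfl⟩)
    · exact hS (Or.inl (Or.inl hx))
    · by_cases hj : j = i
      · rwa [hj]
      have h1 : g.reflectedE i j ∈ S := hS (Or.inl (Or.inr ⟨j, rfl⟩))
      rw [reflectedE, if_neg hj] at h1
      split_ifs at h1 with h
      · exact h1
      -- Bracketing with `f i`, which is a reflected generator, recovers a nonzero multiple of `e
      -- j`.
      · have h2 := hcl _ hfi _ h1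
        rw [g.bracket_f_bracket_e (Ne.symm hj)] at h2
        exact (Submodule.smul_mem_iff _
          (neg_ne_zero.2 (mul_ne_zero (superSign_ne_zero _ _) h))).1 h2
    · by_cases hj : j = i
      · rwa [hj]
      have h1 : g.reflectedF i j ∈ S := hS (Or.inr ⟨j, rfl⟩)
      rw [reflectedF, if_neg hj] at h1
      split_ifs at h1 with h
      · exact h1
      · have h2 := hcl _ hei _ h1
        rw [g.bracket_e_bracket_f (Ne.symm hj)] at h2
        exact (Submodule.smul_mem_iff _ (neg_ne_zero.2 h)).1 h2

theorem reflectedE_ne_zero (F : L.InvariantForm 𝔥) (hβ : LinearIndependent ℂ β)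
    (hroot : ∀ i, L.IsRoot 𝔥 (β i)) (i j : ι) : g.reflectedE i j ≠ 0 := by
  have he := fun i => g.e_ne_zero F.cartan_even F.bracket_cartan hβ (hroot i)
  unfold reflectedE
  split_ifs with h1 h2
  · exact g.f_ne_zero F hβ (hroot i)
  · exact he j
  · intro h
    have h3 := g.bracket_f_bracket_e (Ne.symm h1)
    rw [h, map_zero, eq_comm, smul_eq_zero] at h3
    exact h3.elim (neg_ne_zero.2 (mul_ne_zero (superSign_ne_zero _ _) h2)) (he j)

end ChevalleyGenerators

/-- Odd reflections of ordered root bases are ordered root bases. -/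
theorem OrderedRootBase.exists_oddReflection (F : L.InvariantForm 𝔥) (x : L.OrderedRootBase 𝔥 ι)
    {i : ι} (hi : x.IsOddIsotropic i) :
    ∃ y : L.OrderedRootBase 𝔥 ι, y.root = x.oddReflection i := by
  have hli := x.gens.linearIndependent_reflectedRoot x.linearIndependent i
  refine ⟨⟨x.gens.reflectedRoot i, fun j => ⟨hli.ne_zero j, ?_⟩, hli,
    ⟨x.gens.reflected F x.linearIndependent hi.1 hi.2⟩⟩, rfl⟩
  intro h
  have := (x.gens.reflectedE_mem F.cartan_even i j).1
  rw [h] at this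
  exact x.gens.reflectedE_ne_zero F x.linearIndependent x.isRoot i j ((Submodule.mem_bot ℂ).1 this)

end OddReflection

end LieSuperalgebra

namespace LieSuperalgebra

/-! ### Root strings through even roots -/

section Strings

attribute [local instance] LieRing.ofAssociativeRing

variable {V : Type} [AddCommGroup V] [Module ℂ V] {L : LieSuperalgebra V} {𝔥 : Submodule ℂ V}

/-- A triple of even root vectors gives an `𝔰𝔩₂`-triple of endomorphisms. -/
theorem isSl2Triple_bracket (h𝔥 : 𝔥 ≤ L.part 0) {α : Module.Dual ℂ 𝔥} {e f : V} {t : 𝔥}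
    (he : e ∈ L.rootSpace 𝔥 α ⊓ L.part 0) (hf : f ∈ L.rootSpace 𝔥 (-α) ⊓ L.part 0)
    (hef : L.bracket e f = t) (ht : α t = 2) :
    IsSl2Triple (L := Module.End ℂ V) (L.bracket (t : V)) (L.bracket e) (L.bracket f) where
  h_ne_zero := by
    intro h
    have h1 := he.1 t
    rw [h, ht, LinearMap.zero_apply, eq_comm, smul_eq_zero] at h1
    have h2 : (t : V) = 0 := by rw [← hef, h1.resolve_left two_ne_zero]; simp
    rw [Subtype.ext (a1 := t) (a2 := 0) h2, map_zero] at ht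
    exact two_ne_zero ht.symm
  lie_e_f := by
    refine LinearMap.ext fun z => ?_
    have := jacobi_even he.2 f z
    rw [hef] at this
    rw [LieRing.of_associative_ring_bracket, LinearMap.sub_apply, Module.End.mul_apply,
      Module.End.mul_apply, this, add_sub_cancel_right]
  lie_h_e_nsmul := by
    refine LinearMap.ext fun z => ?_
    have := jacobi_even (h𝔥 t.2) e z
    rw [he.1 t, ht] at this
    rw [LieRing.of_associative_ring_bracket, LinearMap.sub_apply, Module.End.mul_apply,
      Module.End.mul_apply, this, add_sub_cancel_right, map_smul, ← Nat.cast_smul_eq_nsmul ℂ]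
    rfl
  lie_h_f_nsmul := by
    refine LinearMap.ext fun z => ?_
    have := jacobi_even (h𝔥 t.2) f z
    rw [hf.1 t, LinearMap.neg_apply, ht] at this
    rw [LieRing.of_associative_ring_bracket, LinearMap.sub_apply, Module.End.mul_apply,
      Module.End.mul_apply, this, add_sub_cancel_right, map_smul, ← Nat.cast_smul_eq_nsmul ℂ,
      neg_smul]
    rfl

/-- Climb from `v` with `e` to the top `e^q v` of its string. This is a primitive vector of weight
`n = γ t + 2q`, a natural number. If `γ t ≥ 0` then `q ≤ n`, and applying `f` another `n - q` times
gives a nonzero vector of weight `γ + (2q - n) α = γ - γ t α`. -/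
theorem exists_int_of_even_triple [FiniteDimensional ℂ V] (h𝔥 : 𝔥 ≤ L.part 0)
    (hc : ∀ h h' : 𝔥, L.bracket h h' = 0) {α : Module.Dual ℂ 𝔥} {e f : V} {t : 𝔥}
    (he : e ∈ L.rootSpace 𝔥 α ⊓ L.part 0) (hf : f ∈ L.rootSpace 𝔥 (-α) ⊓ L.part 0)
    (hef : L.bracket e f = t) (ht : α t = 2) {γ : Module.Dual ℂ 𝔥} (hγ : L.rootSpace 𝔥 γ ≠ ⊥) :
    ∃ n : ℤ, γ t = n ∧ (0 ≤ n → L.rootSpace 𝔥 (γ - γ t • α) ≠ ⊥) := by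
  have hα : α ≠ 0 := by rintro rfl; simp at ht
  have htr := isSl2Triple_bracket h𝔥 he hf hef ht
  obtain ⟨v, hv, hv0⟩ := (Submodule.ne_bot_iff _).1 hγ
  have hpow : ∀ q : ℕ, (L.bracket e ^ q) v ∈ L.rootSpace 𝔥 (γ + (q : ℂ) • α) := by
    intro q
    induction q with
    | zero => simpa using hv
    | succ q ih =>
      rw [pow_succ', Module.End.mul_apply]
      have := bracket_mem_rootSpace h𝔥 he.1 ih
      convert this using 2
      push_cast
      module
  have hex : ∃ q : ℕ, (L.bracket e ^ q) v = 0 := by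
    by_contra! hcon
    -- Only finitely many weight spaces are nonzero, so the string must end.
    have hfin := WellFoundedGT.finite_ne_bot_of_iSupIndep (iSupIndep_rootSpace (L := L) h𝔥 hc)
    refine Set.infinite_of_injective_forall_mem (f := fun q : ℕ => γ + (q : ℂ) • α) ?_ ?_ hfin
    · intro a b hab
      have := smul_left_injective ℂ hα (add_left_cancel hab)
      exact_mod_cast this
    · intro q hq
      have := hpow q
      rw [hq] at this
      exact hcon q ((Submodule.mem_bot ℂ).1 this)
  obtain ⟨q, hq, hq'⟩ := Nat.exists_not_and_succ_of_not_zero_of_exists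
    (p := fun q => (L.bracket e ^ q) v = 0) (by simpa using hv0) hex
  have P : htr.HasPrimitiveVectorWith ((L.bracket e ^ q) v) (γ t + 2 * q) :=
    { ne_zero := hq
      lie_h := by
        refine (hpow q t).trans ?_
        rw [LinearMap.add_apply, LinearMap.smul_apply, ht, smul_eq_mul, mul_comm]
      lie_e := by
        rw [pow_succ'] at hq'
        exact hq' }
  obtain ⟨n, hn⟩ := P.exists_nat
  refine ⟨n - 2 * q, by push_cast; linear_combination hn, fun h0 => ?_⟩
  have hqn : q ≤ n := by omega
  have hne := P.pow_toEnd_f_ne_zero_of_eq_nat hn (Nat.sub_le n q)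
  have hmem : ∀ k : ℕ, ((LieModule.toEnd ℂ (Module.End ℂ V) V (L.bracket f)) ^ k)
      ((L.bracket e ^ q) v) ∈ L.rootSpace 𝔥 (γ + ((q : ℂ) - k) • α) := by
    intro k
    induction k with
    | zero => simpa using hpow q
    | succ k ih =>
      rw [pow_succ', Module.End.mul_apply]
      have := bracket_mem_rootSpace h𝔥 hf.1 ih
      rw [show -α + (γ + ((q : ℂ) - k) • α) = γ + ((q : ℂ) - (k + 1 : ℕ)) • α by
        push_cast; module] at this
      exact this
  refine (Submodule.ne_bot_iff _).2 ⟨_, ?_, hne⟩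
  convert hmem (n - q) using 2
  rw [Nat.cast_sub hqn, show γ t = n - 2 * q by linear_combination hn]
  module

/-- Integrality of roots on even coroots, and invariance of the roots under reflections. -/
theorem isRoot_reflection [FiniteDimensional ℂ V] (h𝔥 : 𝔥 ≤ L.part 0)
    (hc : ∀ h h' : 𝔥, L.bracket h h' = 0) {α : Module.Dual ℂ 𝔥} {t : 𝔥}
    (hα : L.IsEvenCoroot 𝔥 α t) {γ : Module.Dual ℂ 𝔥} (hγ : L.IsRoot 𝔥 γ) :
    (∃ n : ℤ, γ t = n) ∧ L.IsRoot 𝔥 (γ - γ t • α) := by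
  obtain ⟨ht, e, he, f, hf, hef⟩ := hα
  obtain ⟨n, hn, hn'⟩ := exists_int_of_even_triple h𝔥 hc he hf hef ht hγ.2
  refine ⟨⟨n, hn⟩, fun h0 => ?_, ?_⟩
  · have h1 := congrArg (fun lam : Module.Dual ℂ 𝔥 => lam t) h0
    simp only [LinearMap.sub_apply, LinearMap.smul_apply, ht, smul_eq_mul,
      LinearMap.zero_apply] at h1
    have h2 : γ t = 0 := by linear_combination -h1
    rw [h2, zero_smul, sub_zero] at h0
    exact hγ.1 h0
  · rcases le_total 0 n with h | h
    · exact hn' h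
    -- The opposite triple `(f, e, -t)` of the root `-α` turns a nonpositive value into a
    -- nonnegative one and gives the same reflection.
    · obtain ⟨k, hk, hk'⟩ := exists_int_of_even_triple h𝔥 hc (α := -α) (t := -t) hf
        (by rw [neg_neg]; exact he) (by rw [skew_even hf.2, hef]; rfl)
        (by rw [map_neg, LinearMap.neg_apply, neg_neg, ht]) hγ.2
      rw [map_neg, smul_neg, neg_smul, neg_neg] at hk'
      refine hk' ?_
      rw [map_neg, hn] at hk
      have : -n = k := by exact_mod_cast hk
      omega

end Strings

/-! ### Simple reflections and Serre matrices -/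

section Reflections

variable {V : Type} [AddCommGroup V] [Module ℂ V] {L : LieSuperalgebra V} {𝔥 : Submodule ℂ V}

/-- The reflection of `𝔥*` in the root `α` with coroot `t`. -/
def rootReflection (α : Module.Dual ℂ 𝔥) (t : 𝔥) (h : α t = 2) :
    Module.Dual ℂ 𝔥 ≃ₗ[ℂ] Module.Dual ℂ 𝔥 :=
  Module.reflection (x := α) (f := Module.Dual.eval ℂ 𝔥 t) h

theorem rootReflection_apply (α : Module.Dual ℂ 𝔥) (t : 𝔥) (h : α t = 2)
    (lam : Module.Dual ℂ 𝔥) : rootReflection α t h lam = lam - lam t • α := rfl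

variable {ι : Type} [DecidableEq ι] [Fintype ι]

namespace OrderedRootBase

variable (x : L.OrderedRootBase 𝔥 ι) (F : L.InvariantForm 𝔥)

include F in
-- Under the form the coroot corresponds to `(e i, f i) β i`, and both factors are nonzero.
theorem coroot_ne_zero (i : ι) : x.gens.coroot i ≠ 0 := by
  intro h
  refine (x.isRoot i).1 (LinearMap.ext fun t => ?_)
  have h1 := F.form_coroot (e := x.gens.e i) (x.gens.f_mem i).1 t
  rw [x.gens.bracket_self, h] at h1
  simp only [ZeroMemClass.coe_zero, map_zero, LinearMap.zero_apply] at h1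
  exact (mul_eq_zero.1 h1.symm).resolve_left
    (x.gens.form_e_f_ne_zero F x.linearIndependent (x.isRoot i))

include F in
theorem cartanMatrix_self_ne_zero {i : ι} (hi : ¬ x.IsOddIsotropic i) :
    x.cartanMatrix i i ≠ 0 := by
  intro h
  have h01 : ∀ c : ZMod 2, c = 0 ∨ c = 1 := by decide
  rcases h01 (x.parity i) with h0 | h1
  · refine x.coroot_ne_zero F i (F.even_coroot (x.root i) (x.gens.e i) (x.gens.f i) _ ?_ ?_
      (x.gens.bracket_self i) h)
    · have := x.gens.e_mem i
      rwa [show x.gens.parity i = 0 from h0] at this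
    · have := x.gens.f_mem i
      rwa [show x.gens.parity i = 0 from h0] at this
  · exact hi ⟨h1, h⟩

/-- The normalized coroot of a simple root that is not odd isotropic. -/
def simpleCoroot (i : ι) : 𝔥 := (2 / x.cartanMatrix i i) • x.gens.coroot i

include F in
theorem root_simpleCoroot {i : ι} (hi : ¬ x.IsOddIsotropic i) :
    x.root i (x.simpleCoroot i) = 2 := by
  have h := x.cartanMatrix_self_ne_zero F hi
  rw [simpleCoroot, map_smul]
  exact div_mul_cancel₀ 2 h

theorem form_simpleCoroot (i : ι) :
    ∃ c, ∀ h : 𝔥, F.form (x.simpleCoroot i) h = c * x.root i h := by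
  refine ⟨2 / x.cartanMatrix i i * F.form (x.gens.e i) (x.gens.f i), fun h => ?_⟩
  have h1 := F.form_coroot (e := x.gens.e i) (x.gens.f_mem i).1 h
  rw [x.gens.bracket_self] at h1
  rw [simpleCoroot, Submodule.coe_smul, map_smul, LinearMap.smul_apply, h1, smul_eq_mul, mul_assoc]

include F in
/-- A simple root that is not odd isotropic is an even root or half an even root. -/
theorem exists_evenCoroot {i : ι} (hi : ¬ x.IsOddIsotropic i) :
    ∃ (k : ℤ) (α : Module.Dual ℂ 𝔥) (t : 𝔥), L.IsEvenRoot 𝔥 α ∧ L.IsEvenCoroot 𝔥 α t ∧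
      α = (k : ℂ) • x.root i ∧ x.simpleCoroot i = (k : ℂ) • t := by
  have hb := x.cartanMatrix_self_ne_zero F hi
  have hroot := x.root_simpleCoroot F hi
  have he0 := x.gens.e_ne_zero F.cartan_even F.bracket_cartan x.linearIndependent (x.isRoot i)
  have hem := x.gens.e_mem i
  have hfm := x.gens.f_mem i
  have hef := x.gens.bracket_self i
  have hfe := x.gens.bracket_f_e i
  have hfee := x.gens.bracket_f_bracket_e_self i
  have hbe : x.root i (x.gens.coroot i) = x.cartanMatrix i i := rfl
  set b := x.cartanMatrix i i with hb'
  set e := x.gens.e i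
  set f := x.gens.f i
  have h01 : ∀ c : ZMod 2, c = 0 ∨ c = 1 := by decide
  rcases h01 (x.gens.parity i) with h0 | h1
  · rw [h0] at hem hfm
    refine ⟨1, x.root i, x.simpleCoroot i, ⟨(x.isRoot i).1, ?_⟩, ⟨hroot, e, hem, (2 / b) • f,
      Submodule.smul_mem _ _ hfm, ?_⟩, by simp, by simp⟩
    · exact (Submodule.ne_bot_iff _).2 ⟨e, hem, he0⟩
    · rw [map_smul, hef]; rfl
  -- In the odd case `[e, e]` and `[f, f]` are even root vectors for `±2 β i`, with `[[e, e], [f,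
  -- f]] = -4b h i`.
  · specialize hfee h1
    rw [h1] at hem hfm hfe
    rw [hbe] at hfee
    simp only [superSign_one_one, neg_smul, one_smul, neg_neg] at hfe
    have hE : L.bracket e e ∈ L.rootSpace 𝔥 ((2 : ℂ) • x.root i) ⊓ L.part 0 := by
      rw [two_smul]
      exact ⟨bracket_mem_rootSpace F.cartan_even hem.1 hem.1, L.bracket_mem _ _ _ _ hem.2 hem.2⟩
    have hF : L.bracket f f ∈ L.rootSpace 𝔥 (-((2 : ℂ) • x.root i)) ⊓ L.part 0 := by
      rw [two_smul, neg_add]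
      exact ⟨bracket_mem_rootSpace F.cartan_even hfm.1 hfm.1, L.bracket_mem _ _ _ _ hfm.2 hfm.2⟩
    have hE0 : L.bracket e e ≠ 0 := by
      intro h
      rw [h, map_zero, eq_comm, smul_eq_zero] at hfee
      exact hfee.elim (mul_ne_zero two_ne_zero hb) he0
    have hEf : L.bracket (L.bracket e e) f = -((2 * b) • e) := by
      rw [skew_even hE.2, hfee]
    have hEF : L.bracket (L.bracket e e) (L.bracket f f) = (-(4 * b)) • (x.gens.coroot i : V) := by
      rw [jacobi_even hE.2, hEf, map_neg, map_neg, map_smul, map_smul, LinearMap.neg_apply,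
        LinearMap.smul_apply, hef, hfe]
      module
    -- The coroot of `2 β i` is `h i / b`, half that of `β i`; the factor `-1 / (4 b²)` on `[f, f]`
    -- produces it.
    refine ⟨2, (2 : ℂ) • x.root i, (1 / 2 : ℂ) • x.simpleCoroot i, ⟨?_, ?_⟩, ⟨?_, _, hE,
      (-(1 / (4 * b ^ 2))) • L.bracket f f, Submodule.smul_mem _ _ hF, ?_⟩, by simp, ?_⟩
    · exact smul_ne_zero two_ne_zero (x.isRoot i).1
    · exact (Submodule.ne_bot_iff _).2 ⟨_, hE, hE0⟩
    · rw [map_smul, LinearMap.smul_apply, hroot]; norm_num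
    · rw [map_smul, hEF, simpleCoroot, ← hb', smul_smul, smul_smul, Submodule.coe_smul]
      congr 1
      field_simp
    · rw [smul_smul]; norm_num

include F in
-- Scaling the root by `k` and its coroot by `1 / k` does not change the reflection.
theorem rootReflection_mem {i : ι} (hi : ¬ x.IsOddIsotropic i) :
    rootReflection (x.root i) (x.simpleCoroot i) (x.root_simpleCoroot F hi) ∈
      L.evenWeylGroup 𝔥 := by
  obtain ⟨k, α, t, h1, h2, h3, h4⟩ := x.exists_evenCoroot F hi
  refine Subgroup.subset_closure ⟨α, t, h1, h2, fun lam => ?_⟩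
  rw [rootReflection_apply, h3, h4, map_smul, smul_smul, smul_eq_mul, mul_comm]

include F in
theorem isRoot_simple_reflection [FiniteDimensional ℂ V] {i : ι} (hi : ¬ x.IsOddIsotropic i)
    {γ : Module.Dual ℂ 𝔥} (hγ : L.IsRoot 𝔥 γ) :
    (∃ n : ℤ, γ (x.simpleCoroot i) = n) ∧
      L.IsRoot 𝔥 (rootReflection (x.root i) (x.simpleCoroot i) (x.root_simpleCoroot F hi) γ) := by
  obtain ⟨k, α, t, h1, h2, h3, h4⟩ := x.exists_evenCoroot F hi
  obtain ⟨⟨n, hn⟩, h5⟩ := isRoot_reflection F.cartan_even F.bracket_cartan h2 hγ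
  refine ⟨⟨k * n, ?_⟩, ?_⟩
  · rw [h4, map_smul, hn]; push_cast; rfl
  · rw [rootReflection_apply, h4, map_smul, smul_eq_mul, mul_comm, ← smul_smul, ← h3]
    exact h5

include F in
-- Integrality on even coroots makes `2 b i j / b i i` an integer, so the floor does not alter it.
theorem serreMatrix_eq [FiniteDimensional ℂ V] {i : ι} (hi : ¬ x.IsOddIsotropic i) (j : ι) :
    (serreMatrix x.cartanMatrix i j : ℂ) = x.root j (x.simpleCoroot i) := by
  have hb := x.cartanMatrix_self_ne_zero F hi
  obtain ⟨n, hn⟩ := (x.isRoot_simple_reflection F hi (x.isRoot j)).1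
  have h1 : x.root j (x.simpleCoroot i) = 2 * x.cartanMatrix i j / x.cartanMatrix i i := by
    rw [simpleCoroot, map_smul, smul_eq_mul, div_mul_eq_mul_div]; rfl
  by_cases hij : i = j
  · subst hij
    rw [x.root_simpleCoroot F hi]; simp [serreMatrix]
  · simp only [serreMatrix, Matrix.of_apply, if_neg hij, if_neg hb]
    by_cases h0 : x.cartanMatrix i j = 0
    · rw [h1, h0]; simp
    · rw [if_neg h0, ← h1, hn]; simp

end OrderedRootBase

end Reflections

end LieSuperalgebra

namespace LabelledGraph

variable {ι : Type} [Fintype ι] [DecidableEq ι]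

theorem simpleReflection_apply (G : LabelledGraph ι) (i : ι) (x : G.Vertex) (a : ι → ℤ) :
    G.simpleReflection i x a = a - (∑ j, a j * G.A x i j) • Pi.single i 1 := by
  rw [simpleReflection, Module.reflection_apply]
  rfl

theorem simpleReflection_single (G : LabelledGraph ι) (i j : ι) (x : G.Vertex) :
    G.simpleReflection i x (Pi.single j 1) = Pi.single j 1 - G.A x i j • Pi.single i 1 := by
  rw [simpleReflection_apply]
  simp [Pi.single_apply]

theorem simpleReflection_apply_of_ne (G : LabelledGraph ι) {i j : ι} (h : j ≠ i) (x : G.Vertex)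
    (a : ι → ℤ) : G.simpleReflection i x a j = a j := by
  rw [simpleReflection_apply]
  simp [Pi.single_eq_of_ne h]

end LabelledGraph

namespace LieSuperalgebra

/-! ### Morphisms of the Weyl groupoid as maps on `𝔥*` -/

section Groupoid

variable {V : Type} [AddCommGroup V] [Module ℂ V] {L : LieSuperalgebra V} {𝔥 : Submodule ℂ V}
  {ι : Type} [DecidableEq ι] [Fintype ι]

/-- The ordered root base at a vertex of the Cartan graph. -/
def vertexBase (x : (L.cartanGraph 𝔥 ι).Vertex) : L.OrderedRootBase 𝔥 ι := x

/-- The vertex of the Cartan graph given by an ordered root base. -/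
def OrderedRootBase.toVertex (x : L.OrderedRootBase 𝔥 ι) : (L.cartanGraph 𝔥 ι).Vertex := x

/-- The map `s_i` of the Weyl groupoid at an ordered root base. -/
def OrderedRootBase.latticeReflection (x : L.OrderedRootBase 𝔥 ι) (i : ι) :
    (ι → ℤ) ≃ₗ[ℤ] (ι → ℤ) := (L.cartanGraph 𝔥 ι).simpleReflection i x.toVertex

theorem OrderedRootBase.latticeReflection_single (x : L.OrderedRootBase 𝔥 ι) (i j : ι) :
    x.latticeReflection i (Pi.single j 1) =
      Pi.single j 1 - serreMatrix x.cartanMatrix i j • Pi.single i 1 :=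
  LabelledGraph.simpleReflection_single _ _ _ _

theorem OrderedRootBase.latticeReflection_apply_of_ne (x : L.OrderedRootBase 𝔥 ι) {i j : ι}
    (h : j ≠ i) (a : ι → ℤ) : x.latticeReflection i a j = a j :=
  LabelledGraph.simpleReflection_apply_of_ne _ h _ _

/-- If `b i j ≠ 0` then `a i j = -1` and `α_j` goes to `(β_j + β_i) + (-β_i) = β_j`, so odd edges
act as the identity on `𝔥*`. -/
theorem weight_latticeReflection_odd {x y : L.OrderedRootBase 𝔥 ι} {i : ι}
    (hi : x.IsOddIsotropic i) (hy : y.root = x.oddReflection i) (a : ι → ℤ) :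
    weight y.root (x.latticeReflection i a) = weight x.root a := by
  suffices h : (weight y.root).comp
      (x.latticeReflection i).toLinearMap = weight x.root from
    LinearMap.congr_fun h a
  refine (Pi.basisFun ℤ ι).ext fun j => ?_
  rw [Pi.basisFun_apply, LinearMap.comp_apply, LinearEquiv.coe_coe,
    OrderedRootBase.latticeReflection_single, map_sub, map_smul, weight_single, weight_single,
    weight_single, hy]
  have h0 : x.cartanMatrix i i = 0 := hi.2
  by_cases hj : j = i
  · subst hj
    simp [OrderedRootBase.oddReflection, serreMatrix]
    module
  · by_cases hb : x.cartanMatrix i j = 0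
    · simp [OrderedRootBase.oddReflection, serreMatrix, hj, Ne.symm hj, hb]
    · simp [OrderedRootBase.oddReflection, serreMatrix, hj, Ne.symm hj, hb, h0]

theorem weight_latticeReflection_loop [FiniteDimensional ℂ V] (F : L.InvariantForm 𝔥)
    {x : L.OrderedRootBase 𝔥 ι} {i : ι} (hi : ¬ x.IsOddIsotropic i) (a : ι → ℤ) :
    weight x.root (x.latticeReflection i a) =
      rootReflection (x.root i) (x.simpleCoroot i) (x.root_simpleCoroot F hi)
        (weight x.root a) := by
  suffices h : (weight x.root).comp
      (x.latticeReflection i).toLinearMap =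
        ((rootReflection (x.root i) (x.simpleCoroot i)
          (x.root_simpleCoroot F hi)).toLinearMap.restrictScalars ℤ).comp (weight x.root) from
    LinearMap.congr_fun h a
  refine (Pi.basisFun ℤ ι).ext fun j => ?_
  rw [Pi.basisFun_apply, LinearMap.comp_apply, LinearEquiv.coe_coe,
    OrderedRootBase.latticeReflection_single, map_sub, map_smul, weight_single, weight_single,
    LinearMap.comp_apply, weight_single, LinearMap.restrictScalars_apply, LinearEquiv.coe_coe,
    rootReflection_apply, ← x.serreMatrix_eq F hi, Int.cast_smul_eq_zsmul]

/-- `g` is induced by a morphism from `x` to `y` in the Weyl groupoid. -/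
def Realizes (x y : L.OrderedRootBase 𝔥 ι)
    (g : Module.Dual ℂ 𝔥 ≃ₗ[ℂ] Module.Dual ℂ 𝔥) : Prop :=
  ∃ w, (L.cartanGraph 𝔥 ι).IsMorphism x.toVertex y.toVertex w ∧ ∀ a, weight y.root (w a) = g (weight x.root a)

theorem Realizes.refl (x : L.OrderedRootBase 𝔥 ι) : Realizes x x 1 :=
  ⟨_, LabelledGraph.IsMorphism.refl _, fun _ => rfl⟩

theorem Realizes.trans {x y z : L.OrderedRootBase 𝔥 ι}
    {g g' : Module.Dual ℂ 𝔥 ≃ₗ[ℂ] Module.Dual ℂ 𝔥} (h : Realizes x y g) (h' : Realizes y z g') :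
    Realizes x z (g' * g) := by
  obtain ⟨w, hw, hwg⟩ := h
  obtain ⟨w', hw', hwg'⟩ := h'
  refine ⟨_, hw.trans hw', fun a => ?_⟩
  rw [LinearEquiv.trans_apply, hwg', hwg]; rfl

theorem Realizes.symm {x y : L.OrderedRootBase 𝔥 ι}
    {g : Module.Dual ℂ 𝔥 ≃ₗ[ℂ] Module.Dual ℂ 𝔥} (h : Realizes x y g) : Realizes y x g⁻¹ := by
  obtain ⟨w, hw, hwg⟩ := h
  refine ⟨_, hw.symm, fun a => ?_⟩
  apply g.injective
  rw [← hwg, LinearEquiv.apply_symm_apply]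
  exact (g.apply_symm_apply _).symm

theorem realizes_odd {x y : L.OrderedRootBase 𝔥 ι} {i : ι}
    (hi : x.IsOddIsotropic i) (hy : y.root = x.oddReflection i) : Realizes x y 1 :=
  ⟨_, LabelledGraph.IsMorphism.step x.toVertex x.toVertex y.toVertex i _
    (LabelledGraph.IsMorphism.refl _) (Or.inl ⟨hi, hy⟩), weight_latticeReflection_odd hi hy⟩

theorem realizes_loop [FiniteDimensional ℂ V] (F : L.InvariantForm 𝔥)
    {x : L.OrderedRootBase 𝔥 ι} {i : ι} (hi : ¬ x.IsOddIsotropic i) :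
    Realizes x x (rootReflection (x.root i) (x.simpleCoroot i) (x.root_simpleCoroot F hi)) :=
  ⟨_, LabelledGraph.IsMorphism.step x.toVertex x.toVertex x.toVertex i _
    (LabelledGraph.IsMorphism.refl _) (Or.inr ⟨hi, rfl⟩), weight_latticeReflection_loop F hi⟩

theorem exists_realization_of_adj [FiniteDimensional ℂ V] (F : L.InvariantForm 𝔥)
    {x y : (L.cartanGraph 𝔥 ι).Vertex} {i : ι} (h : (L.cartanGraph 𝔥 ι).Adj i x y) :
    ∃ g ∈ L.evenWeylGroup 𝔥, ∀ a,
      weight (vertexBase y).root ((L.cartanGraph 𝔥 ι).simpleReflection i x a) = g (weight (vertexBase x).root a) := by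
  obtain ⟨hi, hy⟩ | ⟨hi, hy⟩ := h
  · exact ⟨1, one_mem _, weight_latticeReflection_odd (x := vertexBase x) (y := vertexBase y) hi hy⟩
  · rw [show y = x from hy]
    exact ⟨_, (vertexBase x).rootReflection_mem F hi, weight_latticeReflection_loop (x := vertexBase x) F hi⟩

theorem exists_realization [FiniteDimensional ℂ V] (F : L.InvariantForm 𝔥)
    {x y : (L.cartanGraph 𝔥 ι).Vertex} {w : (ι → ℤ) ≃ₗ[ℤ] (ι → ℤ)}
    (hw : (L.cartanGraph 𝔥 ι).IsMorphism x y w) :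
    ∃ g ∈ L.evenWeylGroup 𝔥, ∀ a, weight (vertexBase y).root (w a) = g (weight (vertexBase x).root a) := by
  induction hw with
  | refl => exact ⟨1, one_mem _, fun _ => rfl⟩
  | step y z i w _ h ih =>
    obtain ⟨g, hg, hgw⟩ := ih
    obtain ⟨g', hg', hgw'⟩ := exists_realization_of_adj F h
    refine ⟨g' * g, mul_mem hg' hg, fun a => ?_⟩
    rw [LinearEquiv.trans_apply, hgw', hgw]; rfl
  | stepInv y z i w _ h ih =>
    obtain ⟨g, hg, hgw⟩ := ih
    obtain ⟨g', hg', hgw'⟩ := exists_realization_of_adj F h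
    refine ⟨g'⁻¹ * g, mul_mem (inv_mem hg') hg, fun a => ?_⟩
    rw [LinearEquiv.trans_apply]
    apply g'.injective
    rw [← hgw', LinearEquiv.apply_symm_apply, hgw]
    exact (g'.apply_symm_apply _).symm

/-- A root that is a nonnegative combination of the simple roots. -/
def OrderedRootBase.IsPos (x : L.OrderedRootBase 𝔥 ι) (γ : Module.Dual ℂ 𝔥) : Prop :=
  L.IsRoot 𝔥 γ ∧ ∃ μ : ι → ℤ, 0 ≤ μ ∧ γ = weight x.root μ

/-- A positive root whose image under a simple transition is not positive is a multiple of the simple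
root. -/
theorem OrderedRootBase.isPos_of_isPos_transition (F : L.InvariantForm 𝔥)
    {x y : L.OrderedRootBase 𝔥 ι} {i : ι} {s : (ι → ℤ) → ι → ℤ}
    (hs : ∀ a j, j ≠ i → s a j = a j) {γ δ : Module.Dual ℂ 𝔥} (hγ : L.IsRoot 𝔥 γ)
    (hγδ : ∀ a, γ = weight x.root a → δ = weight y.root (s a)) (hδ : y.IsPos δ)
    (f : Module.Dual ℂ 𝔥 →+ ℝ) (hf : f (x.root i) < 0) (hfγ : f γ < 0) : x.IsPos γ := by
  obtain ⟨μ, hμ, -, h | h⟩ := x.gens.exists_weight_of_isRoot F.cartan_even F.bracket_cartan hγ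
  · exact ⟨hγ, μ, hμ, h⟩
  exfalso
  rw [← map_neg] at h
  obtain ⟨-, ν, hν, hδν⟩ := hδ
  have hsν := weight_injective y.linearIndependent ((hγδ _ h).symm.trans hδν)
  -- The coefficients away from `i` are unchanged by the transition, nonpositive at `x` and
  -- nonnegative at `y`.
  have h1 : ∀ j, j ≠ i → μ j = 0 := by
    intro j hj
    have h2 := hs (-μ) j hj
    rw [hsν, Pi.neg_apply] at h2
    have h3 := hμ j
    have h4 := hν j
    simp only [Pi.zero_apply] at h3 h4
    omega
  have h2 : -μ = (-μ i) • Pi.single i 1 := by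
    funext j
    by_cases hj : j = i
    · subst hj; simp
    · simp [h1 j hj, Pi.single_eq_of_ne hj]
  -- So `γ = -μ i β_i` with `μ i ≥ 0`, which makes `f γ` nonnegative.
  rw [h2, map_smul, weight_single] at h
  rw [h, map_zsmul, zsmul_eq_mul] at hfγ
  have h3 : (0 : ℝ) ≤ μ i := by exact_mod_cast hμ i
  push_cast at hfγ
  nlinarith

end Groupoid

/-! ### Every even reflection comes from a closed path -/

section Generation

variable {V : Type} [AddCommGroup V] [Module ℂ V] {L : LieSuperalgebra V} {𝔥 : Submodule ℂ V}
  {ι : Type} [DecidableEq ι] [Fintype ι]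

/-- The roots that are positive for the base `x` and negative for the functional `f`. -/
def OrderedRootBase.inversions (x : L.OrderedRootBase 𝔥 ι) (f : Module.Dual ℂ 𝔥 →+ ℝ) :
    Set (Module.Dual ℂ 𝔥) := {γ | x.IsPos γ ∧ f γ < 0}

theorem OrderedRootBase.finite_inversions [FiniteDimensional ℂ V] (F : L.InvariantForm 𝔥)
    (x : L.OrderedRootBase 𝔥 ι) (f : Module.Dual ℂ 𝔥 →+ ℝ) : (x.inversions f).Finite :=
  (finite_isRoot F.cartan_even F.bracket_cartan).subset fun _ h => h.1.1

theorem OrderedRootBase.isPos_root (x : L.OrderedRootBase 𝔥 ι) (i : ι) : x.IsPos (x.root i) :=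
  ⟨x.isRoot i, _, Pi.single_nonneg.2 (zero_le_one' ℤ), (weight_single _ i).symm⟩

theorem OrderedRootBase.not_isPos_neg_root (x : L.OrderedRootBase 𝔥 ι) (i : ι) :
    ¬ x.IsPos (-x.root i) := by
  rintro ⟨-, μ, hμ, h⟩
  rw [← weight_single x.root i, ← map_neg] at h
  have h1 := weight_injective x.linearIndependent h
  have h2 := hμ i
  rw [← h1] at h2
  simp at h2

/-- A root that is positive for `y` but not for `x` is a nonpositive multiple of `β_i` and has value
`≥ 0`, so no inversions are gained. The inversion `β_i` is lost because `-β_i` is simple for `y`. -/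
theorem ncard_inversions_odd [FiniteDimensional ℂ V] (F : L.InvariantForm 𝔥)
    {x y : L.OrderedRootBase 𝔥 ι} {i : ι} (hi : x.IsOddIsotropic i)
    (hy : y.root = x.oddReflection i) (f : Module.Dual ℂ 𝔥 →+ ℝ) (hf : f (x.root i) < 0) :
    (y.inversions f).ncard < (x.inversions f).ncard := by
  refine Set.ncard_lt_ncard ((Set.ssubset_iff_of_subset ?_).2 ⟨x.root i, ⟨x.isPos_root i, hf⟩, ?_⟩)
    (x.finite_inversions F f)
  · rintro γ ⟨hγ, hfγ⟩
    refine ⟨?_, hfγ⟩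
    refine OrderedRootBase.isPos_of_isPos_transition F (y := y) (δ := γ)
      (s := x.latticeReflection i)
      (fun a j hj => x.latticeReflection_apply_of_ne hj a) hγ.1 ?_ hγ f hf hfγ
    intro a ha
    rw [weight_latticeReflection_odd hi hy, ha]
  · rintro ⟨h, -⟩
    have h1 : y.root i = -x.root i := by rw [hy]; exact if_pos rfl
    rw [← neg_neg (x.root i), ← h1] at h
    exact y.not_isPos_neg_root i h

theorem rootReflection_involutive (α : Module.Dual ℂ 𝔥) (t : 𝔥) (h : α t = 2)
    (lam : Module.Dual ℂ 𝔥) : rootReflection α t h (rootReflection α t h lam) = lam :=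
  Module.involutive_reflection (f := Module.Dual.eval ℂ 𝔥 t) h lam

theorem rootReflection_self (α : Module.Dual ℂ 𝔥) (t : 𝔥) (h : α t = 2) :
    rootReflection α t h α = -α :=
  Module.reflection_apply_self (f := Module.Dual.eval ℂ 𝔥 t) h

/-- The simple reflection `s` carries the inversions of `f ∘ s` injectively into those of `f`, and
misses `β_i = s (-β_i)`. -/
theorem ncard_inversions_loop [FiniteDimensional ℂ V] (F : L.InvariantForm 𝔥)
    {x : L.OrderedRootBase 𝔥 ι} {i : ι} (hi : ¬ x.IsOddIsotropic i)
    (f : Module.Dual ℂ 𝔥 →+ ℝ) (hf : f (x.root i) < 0) :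
    (x.inversions (f.comp (rootReflection (x.root i) (x.simpleCoroot i)
      (x.root_simpleCoroot F hi)).toLinearMap.toAddMonoidHom)).ncard <
        (x.inversions f).ncard := by
  set s := rootReflection (x.root i) (x.simpleCoroot i) (x.root_simpleCoroot F hi) with hs
  have hss : ∀ lam, s (s lam) = lam := rootReflection_involutive _ _ _
  have hfin := x.finite_inversions F f
  rw [← Set.ncard_image_of_injective _ s.injective]
  refine Set.ncard_lt_ncard ((Set.ssubset_iff_of_subset ?_).2 ⟨x.root i, ⟨x.isPos_root i, hf⟩, ?_⟩)
    hfin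
  · rintro _ ⟨γ, ⟨hγ, hfγ⟩, rfl⟩
    refine ⟨?_, hfγ⟩
    refine OrderedRootBase.isPos_of_isPos_transition F (y := x) (δ := γ)
      (s := x.latticeReflection i)
      (fun a j hj => x.latticeReflection_apply_of_ne hj a)
      (x.isRoot_simple_reflection F hi hγ.1).2 ?_ hγ f hf hfγ
    intro a ha
    rw [weight_latticeReflection_loop F hi, ← ha, hss]
  · rintro ⟨γ, ⟨hγ, -⟩, h⟩
    have h1 : γ = -x.root i := by
      rw [← hss γ, h, hs, rootReflection_self]
    rw [h1] at hγ
    exact x.not_isPos_neg_root i hγ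

/-- Every reflection in a root with a coroot is realized, if the root is minimal for a functional. -/
theorem realizes_rootReflection_of_functional [FiniteDimensional ℂ V] (F : L.InvariantForm 𝔥)
    (x : L.OrderedRootBase 𝔥 ι) (f : Module.Dual ℂ 𝔥 →+ ℝ) (α : Module.Dual ℂ 𝔥) (t : 𝔥)
    (ht : α t = 2) (hα : L.IsRoot 𝔥 α) (hform : ∃ c, ∀ h : 𝔥, F.form t h = c * α h)
    (hf0 : ∀ γ, L.IsRoot 𝔥 γ → f γ ≠ 0) (hfα : 0 < f α)
    (hmin : ∀ γ, L.IsRoot 𝔥 γ → 0 < f γ → f γ ≤ f α → ∃ r : ℂ, γ = r • α) :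
    Realizes x x (rootReflection α t ht) := by
  induction hn : (x.inversions f).ncard using Nat.strong_induction_on generalizing x f α t with
  | _ n ih =>
  by_cases hneg : ∃ i, f (x.root i) < 0
  · obtain ⟨i, hfi⟩ := hneg
    by_cases hi : x.IsOddIsotropic i
    · obtain ⟨y, hy⟩ := x.exists_oddReflection F hi
      have hlt := ncard_inversions_odd F hi hy f hfi
      have h1 := ih _ (hn ▸ hlt) y f α t ht hα hform hf0 hfα hmin rfl
      have h2 := ((realizes_odd hi hy).trans h1).trans (realizes_odd hi hy).symm
      rwa [mul_one, inv_one, one_mul] at h2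
    · have hlt := ncard_inversions_loop F hi f hfi
      have hloop := realizes_loop F hi
      have hβ2 := x.root_simpleCoroot F hi
      have hsroot := fun γ hγ => (x.isRoot_simple_reflection (γ := γ) F hi hγ).2
      obtain ⟨c, hc⟩ := hform
      obtain ⟨d, hd⟩ := x.form_simpleCoroot F i
      set β := x.root i
      set u := x.simpleCoroot i
      set s := rootReflection β u hβ2 with hs
      have hss : ∀ lam, s (s lam) = lam := rootReflection_involutive _ _ _
      have hsapp : ∀ lam, s lam = lam - lam u • β := fun _ => rfl
      -- Symmetry of the form on `t` and `u`; it is used to check that the new coroot is again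
      -- form-dual to a multiple of `s α`.
      have hcd : c * α u = d * β t := by rw [← hc, ← hd, F.form_comm]
      have ht' : s α (t - β t • u) = 2 := by
        rw [hsapp]
        simp only [LinearMap.sub_apply, LinearMap.smul_apply, map_sub, map_smul, smul_eq_mul, ht,
          hβ2]
        ring
      -- The root `s α` has coroot `t - β(t) u`, and conjugating its reflection by the loop `s`
      -- gives back `s_α`.
      have h1 := ih _ (hn ▸ hlt) x _ (s α) (t - β t • u) ht' (hsroot α hα) ?_ ?_ ?_ ?_ rfl
      · have h2 := (hloop.trans h1).trans hloop
        convert h2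
        refine LinearEquiv.ext fun lam => ?_
        rw [LinearEquiv.mul_apply, LinearEquiv.mul_apply, rootReflection_apply (s α), map_sub,
          map_smul, hss, hss, rootReflection_apply]
        congr 2
        rw [hsapp]
        simp only [LinearMap.sub_apply, LinearMap.smul_apply, map_sub, map_smul, smul_eq_mul, hβ2]
        ring
      · refine ⟨c, fun h => ?_⟩
        rw [hsapp, Submodule.coe_sub, Submodule.coe_smul, map_sub, map_smul, LinearMap.sub_apply,
          LinearMap.smul_apply, hc, hd, LinearMap.sub_apply, LinearMap.smul_apply, smul_eq_mul,
          smul_eq_mul]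
        linear_combination β h * hcd
      · exact fun γ hγ => hf0 _ (hsroot γ hγ)
      · change 0 < f (s (s α))
        rwa [hss]
      · intro γ hγ h3 h4
        change f (s γ) ≤ f (s (s α)) at h4
        rw [hss] at h4
        obtain ⟨r, hr⟩ := hmin _ (hsroot γ hγ) h3 h4
        exact ⟨r, by rw [← map_smul, ← hr, hss]⟩
  · push Not at hneg
    have hpos : ∀ i, 0 < f (x.root i) := fun i => lt_of_le_of_ne (hneg i) (hf0 _ (x.isRoot i)).symm
    have hfw : ∀ μ, f (weight x.root μ) = ∑ j, μ j * f (x.root j) := by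
      intro μ
      rw [Fintype.linearCombination_apply, map_sum]
      simp [map_zsmul]
    obtain ⟨μ, hμ, hμ0, hαμ⟩ :=
      x.gens.exists_weight_of_isRoot F.cartan_even F.bracket_cartan hα
    have hterm : ∀ j, (0 : ℝ) ≤ μ j * f (x.root j) := fun j =>
      mul_nonneg (by exact_mod_cast hμ j) (hpos j).le
    replace hαμ : α = weight x.root μ := by
      rcases hαμ with h | h
      · exact h
      · rw [h, map_neg, hfw] at hfα
        exact absurd hfα (not_lt.2 (neg_nonpos.2 (Finset.sum_nonneg fun j _ => hterm j)))
    obtain ⟨i, hi0⟩ := Function.ne_iff.1 hμ0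
    have hμi : (1 : ℝ) ≤ μ i := by
      have h1 := hμ i
      simp only [Pi.zero_apply] at h1 hi0
      exact_mod_cast (show 1 ≤ μ i by omega)
    -- All terms of `f α = ∑ μ j f (β j)` are nonnegative, and the `i`-th has coefficient at least
    -- one.
    have hle : f (x.root i) ≤ f α := by
      rw [hαμ, hfw]
      refine le_trans ?_ (Finset.single_le_sum (fun j _ => hterm j) (Finset.mem_univ i))
      exact le_mul_of_one_le_left (hpos i).le hμi
    obtain ⟨r, hr⟩ := hmin _ (x.isRoot i) (hpos i) hle
    have hr0 : r ≠ 0 := by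
      rintro rfl
      rw [zero_smul] at hr
      exact (x.isRoot i).1 hr
    obtain ⟨c, hc⟩ := hform
    have htop := x.gens.iSup_rootSpace F.cartan_even F.bracket_cartan
    have hc0 : c ≠ 0 := by
      rintro rfl
      have : t = 0 := F.eq_zero_of_form_cartan htop t fun h => by rw [hc, zero_mul]
      rw [this, map_zero] at ht
      exact two_ne_zero ht.symm
    have hβ : ∀ h, x.root i h = r * α h := fun h => by rw [hr]; rfl
    -- The simple root is a nonzero multiple of `α`, and pairing its coroot with `t` gives a nonzero
    -- value; an isotropic root would vanish there.
    have hiso : ¬ x.IsOddIsotropic i := by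
      intro hi
      have h1 := F.form_coroot (e := x.gens.e i) (x.gens.f_mem i).1 t
      have h2 : x.root i (x.gens.coroot i) = 0 := hi.2
      rw [x.gens.bracket_self, ← F.form_comm, hc, hβ, ht] at h1
      rw [hβ] at h2
      rw [(mul_eq_zero.1 h2).resolve_left hr0, mul_zero] at h1
      exact mul_ne_zero (x.gens.form_e_f_ne_zero F x.linearIndependent (x.isRoot i))
        (mul_ne_zero hr0 two_ne_zero) h1.symm
    obtain ⟨d, hd⟩ := x.form_simpleCoroot F i
    have hβ2 := x.root_simpleCoroot F hiso
    -- Both coroots are form-dual to multiples of `α`, hence proportional; evaluating at the root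
    -- fixes the factor as `r`.
    have hcomb : c • x.simpleCoroot i = (d * r) • t := by
      rw [← sub_eq_zero]
      refine F.eq_zero_of_form_cartan htop _ fun h => ?_
      rw [Submodule.coe_sub, Submodule.coe_smul, Submodule.coe_smul, map_sub, map_smul, map_smul,
        LinearMap.sub_apply, LinearMap.smul_apply, LinearMap.smul_apply, hc, hd, hβ, smul_eq_mul,
        smul_eq_mul]
      ring
    have hcd : c = d * r * r := by
      have h1 := congrArg (x.root i) hcomb
      rw [map_smul, map_smul, hβ2, hβ, ht, smul_eq_mul, smul_eq_mul] at h1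
      linear_combination h1 / 2
    have htr : t = r • x.simpleCoroot i := by
      have hdr : d * r ≠ 0 := by
        intro h
        rw [h, zero_mul] at hcd
        exact hc0 hcd
      rw [hcd, ← smul_smul] at hcomb
      exact (smul_right_injective _ hdr hcomb).symm
    convert realizes_loop F hiso using 1
    refine LinearEquiv.ext fun lam => ?_
    rw [rootReflection_apply, rootReflection_apply, htr, map_smul, hr, smul_eq_mul, smul_smul,
      mul_comm]

/-- A functional `f₂` with `f₂ α = 1` is perturbed by a large multiple of one that kills the real
line of `α` and no root off it. Roots off the line then have absolute value above one. -/
theorem exists_functional [FiniteDimensional ℂ V] (F : L.InvariantForm 𝔥) {α : Module.Dual ℂ 𝔥}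
    (hα : α ≠ 0) : ∃ f : Module.Dual ℂ 𝔥 →+ ℝ, (∀ γ, L.IsRoot 𝔥 γ → f γ ≠ 0) ∧ 0 < f α ∧
      ∀ γ, L.IsRoot 𝔥 γ → 0 < f γ → f γ ≤ f α → ∃ r : ℂ, γ = r • α := by
  let p : Submodule ℝ (Module.Dual ℂ 𝔥) := Submodule.span ℝ {α}
  have hfin : {γ | L.IsRoot 𝔥 γ ∧ γ ∉ p}.Finite :=
    (finite_isRoot F.cartan_even F.bracket_cartan).subset fun _ h => h.1
  have := hfin.to_subtype
  obtain ⟨f₀, hf₀⟩ := Module.exists_dual_forall_apply_ne_zero (K := ℝ)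
    (fun γ : {γ | L.IsRoot 𝔥 γ ∧ γ ∉ p} => p.mkQ γ.1)
    (fun γ h => γ.2.2 ((Submodule.Quotient.mk_eq_zero p).1 h))
  obtain ⟨f₁, hf₁⟩ := Module.exists_dual_forall_apply_ne_zero (K := ℝ) (fun _ : Unit => α)
    (fun _ => hα)
  replace hf₁ := hf₁ ()
  let f₂ : Module.Dual ℝ (Module.Dual ℂ 𝔥) := (f₁ α)⁻¹ • f₁
  have hf₂ : f₂ α = 1 := by simp [f₂, hf₁]
  -- With this `M`, a root `γ` off the line has `(M + 1) |f₀ γ| - |f₂ γ| > 1`.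
  obtain ⟨M, hM⟩ := (Set.finite_range fun γ : {γ | L.IsRoot 𝔥 γ ∧ γ ∉ p} =>
    (|f₂ γ.1| + 1) / |f₀ (p.mkQ γ.1)|).bddAbove
  let f : Module.Dual ℝ (Module.Dual ℂ 𝔥) := (M + 1) • f₀.comp p.mkQ + f₂
  have hfα : f α = 1 := by
    have : p.mkQ α = 0 := (Submodule.Quotient.mk_eq_zero p).2 (Submodule.mem_span_singleton_self α)
    simp only [f, LinearMap.add_apply, LinearMap.smul_apply, LinearMap.comp_apply, this, map_zero,
      smul_zero, zero_add, hf₂]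
  have hbig : ∀ γ, L.IsRoot 𝔥 γ → γ ∉ p → 1 < |f γ| := by
    intro γ hγ hγp
    have h1 := hM ⟨⟨γ, hγ, hγp⟩, rfl⟩
    have h2 : 0 < |f₀ (p.mkQ γ)| := abs_pos.2 (hf₀ ⟨γ, hγ, hγp⟩)
    rw [div_le_iff₀ h2] at h1
    have h3 : f γ = (M + 1) * f₀ (p.mkQ γ) + f₂ γ := rfl
    have h4 : |(M + 1) * f₀ (p.mkQ γ)| ≤ |f γ| + |f₂ γ| := by
      rw [show (M + 1) * f₀ (p.mkQ γ) = f γ - f₂ γ by rw [h3]; ring]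
      exact abs_sub _ _
    rw [abs_mul] at h4
    have h5 : M + 1 ≤ |M + 1| := le_abs_self _
    nlinarith
  have hsmall : ∀ γ, L.IsRoot 𝔥 γ → γ ∈ p → f γ ≠ 0 ∧ ∃ r : ℂ, γ = r • α := by
    intro γ hγ hγp
    obtain ⟨r, rfl⟩ := Submodule.mem_span_singleton.1 hγp
    refine ⟨?_, r, rfl⟩
    rw [map_smul, hfα, smul_eq_mul, mul_one]
    rintro rfl
    exact hγ.1 (zero_smul _ _)
  refine ⟨f.toAddMonoidHom, fun γ hγ => ?_, ?_, fun γ hγ h1 h2 => ?_⟩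
  · change f γ ≠ 0
    by_cases h : γ ∈ p
    · exact (hsmall γ hγ h).1
    · intro h0
      have := hbig γ hγ h
      rw [h0, abs_zero] at this
      linarith
  · change 0 < f α
    rw [hfα]; exact zero_lt_one
  · change 0 < f γ at h1
    change f γ ≤ f α at h2
    by_cases h : γ ∈ p
    · exact (hsmall γ hγ h).2
    · have := hbig γ hγ h
      rw [abs_of_pos h1] at this
      linarith

theorem realizes_of_mem_evenWeylGroup [FiniteDimensional ℂ V] (F : L.InvariantForm 𝔥)
    (x : L.OrderedRootBase 𝔥 ι) {g : Module.Dual ℂ 𝔥 ≃ₗ[ℂ] Module.Dual ℂ 𝔥}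
    (hg : g ∈ L.evenWeylGroup 𝔥) : Realizes x x g := by
  induction hg using Subgroup.closure_induction with
  | mem g hg =>
    obtain ⟨α, t, hα, ⟨ht, e, he, f, hf, hef⟩, hgα⟩ := hg
    have hαr : L.IsRoot 𝔥 α := ⟨hα.1, fun h => hα.2 (by rw [h, bot_inf_eq])⟩
    obtain ⟨φ, h1, h2, h3⟩ := exists_functional F hα.1
    have := realizes_rootReflection_of_functional F x φ α t ht hαr
      ⟨F.form e f, fun h => by rw [← hef]; exact F.form_coroot hf.1 h⟩ h1 h2 h3
    convert this
    exact LinearEquiv.ext hgα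
  | one => exact Realizes.refl x
  | mul g g' _ _ h h' => exact h'.trans h
  | inv g _ h => exact h.symm

/-- The vertex groups of the Weyl groupoid are isomorphic to the Weyl group of the even part, if the
latter acts faithfully on the span of the roots. -/
theorem nonempty_aut_mulEquiv [FiniteDimensional ℂ V] (F : L.InvariantForm 𝔥)
    (x : (L.cartanGraph 𝔥 ι).WeylGroupoid)
    (hfaith : ∀ (y : L.OrderedRootBase 𝔥 ι), ∀ g ∈ L.evenWeylGroup 𝔥,
      (∀ i, g (y.root i) = y.root i) → g = 1) :
    Nonempty (CategoryTheory.Aut x ≃* L.evenWeylGroup 𝔥) := by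
  let y : L.OrderedRootBase 𝔥 ι := vertexBase x.vertex
  have hinj : Function.Injective (weight y.root) := weight_injective y.linearIndependent
  have huniq : ∀ g ∈ L.evenWeylGroup 𝔥, ∀ g' ∈ L.evenWeylGroup 𝔥,
      (∀ a, g (weight y.root a) = g' (weight y.root a)) → g = g' := by
    intro g hg g' hg' h
    refine (inv_mul_eq_one.1 (hfaith y _ (mul_mem (inv_mem hg') hg) fun i => ?_)).symm
    have := h (Pi.single i 1)
    rw [weight_single] at this
    rw [LinearEquiv.mul_apply, this]
    exact g'.symm_apply_apply _
  choose Φ hΦmem hΦ using fun w : CategoryTheory.Aut x => exists_realization F w.hom.2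
  -- Multiplication in `Aut` is `v * w = w ≫ v`, in agreement with composition of operators.
  have hmul : ∀ v w, Φ (v * w) = Φ v * Φ w := by
    intro v w
    refine huniq _ (hΦmem _) _ (mul_mem (hΦmem _) (hΦmem _)) fun a => ?_
    rw [LinearEquiv.mul_apply, ← hΦ, ← hΦ, ← hΦ]
    rfl
  refine ⟨MulEquiv.ofBijective (MonoidHom.mk' (fun w => (⟨Φ w, hΦmem w⟩ : L.evenWeylGroup 𝔥))
    fun v w => Subtype.ext (hmul v w)) ⟨fun v w h => ?_, fun g => ?_⟩⟩
  · have h1 : Φ v = Φ w := congrArg Subtype.val h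
    refine Iso.ext (Subtype.ext (LinearEquiv.ext fun a => hinj ?_))
    exact (hΦ v a).trans ((congrArg (fun g => g (weight y.root a)) h1).trans (hΦ w a).symm)
  · obtain ⟨w, hw, hwg⟩ := realizes_of_mem_evenWeylGroup F y g.2
    let W : CategoryTheory.Aut x := (CategoryTheory.Groupoid.isoEquivHom x x).symm ⟨w, hw⟩
    refine ⟨W, Subtype.ext (huniq _ (hΦmem _) _ g.2 fun a => ?_)⟩
    rw [← hΦ W a]
    exact hwg a

end Generation

end LieSuperalgebra

/-! ### The supertrace form -/

section MatrixForm

variable {κ μ : Type} [Fintype κ] [Fintype μ]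

/-- The sign of an index: `1` on the even and `-1` on the odd ones. -/
def indexSign (i : κ ⊕ μ) : ℂ := superSign (indexParity κ μ i) (indexParity κ μ i)

theorem indexSign_mul_self (i : κ ⊕ μ) : indexSign i * indexSign i = 1 :=
  LieSuperalgebra.superSign_mul_self _ _

theorem superTrace_eq_sum (x : Matrix (κ ⊕ μ) (κ ⊕ μ) ℂ) :
    superTrace κ μ x = ∑ i, indexSign i * x i i := by
  simp [superTrace, indexSign, indexParity, superSign, sub_eq_add_neg]

/-- Expanded as triple sums, both sides agree termwise after a cyclic renaming of indices; `hsign`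
matches the supertrace and commutator signs. -/
theorem superTrace_bracket (x y z : Matrix (κ ⊕ μ) (κ ⊕ μ) ℂ) :
    superTrace κ μ (superCommutator κ μ x y * z) =
      superTrace κ μ (x * superCommutator κ μ y z) := by
  have hsign : ∀ a b c : ZMod 2, superSign c c * superSign (a + b) (c + a) =
      superSign a a * superSign (c + a) (b + c) := by
    have h01 : ∀ c : ZMod 2, c = 0 ∨ c = 1 := by decide
    have e : (1 : ZMod 2) + 1 = 0 := by decide
    intro a b c
    rcases h01 a with rfl | rfl <;> rcases h01 b with rfl | rfl <;>
      rcases h01 c with rfl | rfl <;> simp [superSign, e]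
  have h1 : superTrace κ μ (superCommutator κ μ x y * z) =
      (∑ i, ∑ k, ∑ j, indexSign i * (x i j * y j k * z k i)) -
      ∑ i, ∑ k, ∑ j, indexSign i *
        (superSign (indexParity κ μ j + indexParity κ μ k)
          (indexParity κ μ i + indexParity κ μ j) * (y i j * x j k * z k i)) := by
    simp only [superTrace_eq_sum, Matrix.mul_apply, superCommutator, LinearMap.mk₂_apply,
      Matrix.of_apply, Finset.mul_sum, Finset.sum_mul, ← Finset.sum_sub_distrib]
    refine Finset.sum_congr rfl fun i _ => Finset.sum_congr rfl fun k _ =>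
      Finset.sum_congr rfl fun j _ => ?_
    ring
  have h2 : superTrace κ μ (x * superCommutator κ μ y z) =
      (∑ i, ∑ j, ∑ k, indexSign i * (x i j * y j k * z k i)) -
      ∑ i, ∑ j, ∑ k, indexSign i *
        (superSign (indexParity κ μ k + indexParity κ μ i)
          (indexParity κ μ j + indexParity κ μ k) * (x i j * z j k * y k i)) := by
    simp only [superTrace_eq_sum, Matrix.mul_apply, superCommutator, LinearMap.mk₂_apply,
      Matrix.of_apply, Finset.mul_sum, ← Finset.sum_sub_distrib]
    refine Finset.sum_congr rfl fun i _ => Finset.sum_congr rfl fun k _ =>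
      Finset.sum_congr rfl fun j _ => ?_
    ring
  rw [h1, h2]
  congr 1
  · exact Finset.sum_congr rfl fun i _ => Finset.sum_comm
  · calc _ = ∑ k, ∑ j, ∑ i, indexSign k *
        (superSign (indexParity κ μ i + indexParity κ μ j)
          (indexParity κ μ k + indexParity κ μ i) * (y k i * x i j * z j k)) := rfl
      _ = ∑ k, ∑ i, ∑ j, indexSign k *
        (superSign (indexParity κ μ i + indexParity κ μ j)
          (indexParity κ μ k + indexParity κ μ i) * (y k i * x i j * z j k)) :=
        Finset.sum_congr rfl fun i _ => Finset.sum_comm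
      _ = ∑ i, ∑ k, ∑ j, indexSign k *
        (superSign (indexParity κ μ i + indexParity κ μ j)
          (indexParity κ μ k + indexParity κ μ i) * (y k i * x i j * z j k)) := Finset.sum_comm
      _ = ∑ i, ∑ j, ∑ k, indexSign k *
        (superSign (indexParity κ μ i + indexParity κ μ j)
          (indexParity κ μ k + indexParity κ μ i) * (y k i * x i j * z j k)) :=
        Finset.sum_congr rfl fun i _ => Finset.sum_comm
      _ = _ := by
        refine Finset.sum_congr rfl fun i _ => Finset.sum_congr rfl fun j _ =>
          Finset.sum_congr rfl fun k _ => ?_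
        have := hsign (indexParity κ μ i) (indexParity κ μ j) (indexParity κ μ k)
        rw [← mul_assoc, ← mul_assoc, indexSign, indexSign, this]
        ring

variable [DecidableEq κ] [DecidableEq μ]

theorem eq_diagonal {ν : Type} [DecidableEq ν] {x : Matrix ν ν ℂ} (hx : x ∈ diagonalMatrices ν) :
    x = Matrix.diagonal fun i => x i i := by
  ext i j
  by_cases h : i = j
  · subst h; simp
  · rw [hx i j h, Matrix.diagonal_apply_ne _ h]

theorem diagonal_mem {ν : Type} [DecidableEq ν] (d : ν → ℂ) :
    Matrix.diagonal d ∈ diagonalMatrices ν := fun _ _ h => Matrix.diagonal_apply_ne _ h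

theorem diagonalMatrices_le : diagonalMatrices (κ ⊕ μ) ≤ matrixPart κ μ 0 := by
  intro x hx i j h
  refine hx i j ?_
  rintro rfl
  exact h (CharTwo.add_self_eq_zero _)

theorem superCommutator_diagonal_apply {h : Matrix (κ ⊕ μ) (κ ⊕ μ) ℂ}
    (hh : h ∈ diagonalMatrices (κ ⊕ μ)) (x : Matrix (κ ⊕ μ) (κ ⊕ μ) ℂ) (a b : κ ⊕ μ) :
    superCommutator κ μ h x a b = (h a a - h b b) * x a b := by
  simp only [superCommutator, LinearMap.mk₂_apply, Matrix.of_apply, Finset.sum_sub_distrib]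
  rw [Finset.sum_eq_single a (fun j _ hj => by rw [hh a j hj.symm, zero_mul]) (by simp),
    Finset.sum_eq_single b (fun j _ hj => by rw [hh j b hj]; ring) (by simp),
    CharTwo.add_self_eq_zero, LieSuperalgebra.superSign_zero_left]
  ring

/-- A diagonal commutator `[e, f]` that commutes with `e` vanishes. -/
theorem diagonal_commutator_eq_zero {ν : Type} [Fintype ν] [DecidableEq ν] {e f : Matrix ν ν ℂ}
    {d : ν → ℂ} (hef : e * f - f * e = Matrix.diagonal d)
    (hed : ∀ a b, (d a - d b) * e a b = 0) : d = 0 := by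
  funext b
  by_contra hb
  change d b ≠ 0 at hb
  -- The projection to the eigenspace of `d` for the value `d b`. It commutes with `e`, so `P [e,
  -- f]` has trace zero, but that trace is `d b` times the multiplicity.
  let P : Matrix ν ν ℂ := Matrix.diagonal fun a => if d a = d b then 1 else 0
  have hPe : P * e = e * P := by
    ext a c
    rw [Matrix.diagonal_mul, Matrix.mul_diagonal]
    rcases mul_eq_zero.1 (hed a c) with h | h
    · rw [sub_eq_zero.1 h, mul_comm]
    · rw [h]; ring
  have h1 : Matrix.trace (P * (e * f - f * e)) = 0 := by
    rw [mul_sub, Matrix.trace_sub, ← mul_assoc, ← mul_assoc, Matrix.trace_mul_comm (P * f) e,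
      ← mul_assoc, hPe, sub_self]
  rw [hef, Matrix.diagonal_mul_diagonal, Matrix.trace_diagonal] at h1
  have h2 : ∀ a, (if d a = d b then (1 : ℂ) else 0) * d a = if d a = d b then d b else 0 := by
    intro a
    split_ifs with h
    · rw [h, one_mul]
    · rw [zero_mul]
  simp only [h2, ← Finset.sum_filter, Finset.sum_const, nsmul_eq_mul, mul_eq_zero, hb, or_false,
    Nat.cast_eq_zero, Finset.card_eq_zero] at h1
  exact Finset.notMem_empty b (h1 ▸ Finset.mem_filter.2 ⟨Finset.mem_univ b, rfl⟩)

end MatrixForm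

namespace LieSuperalgebra

/-! ### Matrix realizations with diagonal Cartan subspace -/

section Realization

variable {V : Type} [AddCommGroup V] [Module ℂ V] {L : LieSuperalgebra V} {𝔥 : Submodule ℂ V}
  {κ μ : Type} [Fintype κ] [Fintype μ] [DecidableEq κ] [DecidableEq μ]

/-- A faithful realization by matrices in which `𝔥` consists of the diagonal matrices. -/
structure MatrixRealization (L : LieSuperalgebra V) (𝔥 : Submodule ℂ V)
    (ρ : V →ₗ[ℂ] Matrix (κ ⊕ μ) (κ ⊕ μ) ℂ) : Prop where
  injective : Function.Injective ρ
  map_bracket : ∀ x y, ρ (L.bracket x y) = superCommutator κ μ (ρ x) (ρ y)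
  mem_part : ∀ a x, x ∈ L.part a ↔ ρ x ∈ matrixPart κ μ a
  mem_cartan : ∀ x, x ∈ 𝔥 ↔ ρ x ∈ diagonalMatrices (κ ⊕ μ)
  separates : ∀ a b, a ≠ b → ∃ h ∈ 𝔥, ρ h a a ≠ ρ h b b
  nondegenerate : ∀ x, (∀ y, superTrace κ μ (ρ x * ρ y) = 0) → x = 0

variable {ρ : V →ₗ[ℂ] Matrix (κ ⊕ μ) (κ ⊕ μ) ℂ} (R : L.MatrixRealization 𝔥 ρ)

/-- The supertrace form of a matrix realization. -/
def MatrixRealization.invariantForm : L.InvariantForm 𝔥 where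
  form := ((LinearMap.mul ℂ (Matrix (κ ⊕ μ) (κ ⊕ μ) ℂ)).compr₂ (superTrace κ μ)).compl₁₂ ρ ρ
  form_bracket x y z := by
    change superTrace κ μ (ρ _ * ρ _) = superTrace κ μ (ρ _ * ρ _)
    rw [R.map_bracket, R.map_bracket, superTrace_bracket]
  form_nondegenerate := R.nondegenerate
  form_comm h h' := by
    change superTrace κ μ (ρ _ * ρ _) = superTrace κ μ (ρ _ * ρ _)
    rw [eq_diagonal ((R.mem_cartan _).1 h.2), eq_diagonal ((R.mem_cartan _).1 h'.2),
      Matrix.diagonal_mul_diagonal, Matrix.diagonal_mul_diagonal]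
    simp only [mul_comm]
  cartan_even h hh := (R.mem_part 0 h).2 (diagonalMatrices_le ((R.mem_cartan h).1 hh))
  bracket_cartan h h' := by
    apply R.injective
    ext a b
    rw [R.map_bracket, superCommutator_diagonal_apply ((R.mem_cartan _).1 h.2), map_zero,
      Matrix.zero_apply]
    by_cases hab : a = b
    · rw [hab, sub_self, zero_mul]
    · rw [(R.mem_cartan _).1 h'.2 a b hab, mul_zero]
  rootSpace_zero_le := by
    intro x hx
    refine (R.mem_cartan x).2 fun a b hab => ?_
    obtain ⟨h, hh, hne⟩ := R.separates a b hab
    have h1 := congrArg ρ (hx ⟨h, hh⟩)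
    rw [LinearMap.zero_apply, zero_smul, map_zero, R.map_bracket] at h1
    have h2 := congrFun (congrFun h1 a) b
    rw [superCommutator_diagonal_apply ((R.mem_cartan _).1 hh), Matrix.zero_apply] at h2
    exact (mul_eq_zero.1 h2).resolve_left (sub_ne_zero.2 hne)
  even_coroot α e f t he hf hef hαt := by
    have ht := (R.mem_cartan _).1 t.2
    have h1 := congrArg ρ hef
    rw [R.map_bracket, superCommutator_eq ((R.mem_part _ _).1 he.2) ((R.mem_part _ _).1 hf.2),
      superSign_zero_left, one_smul, eq_diagonal ht] at h1
    have h2 := diagonal_commutator_eq_zero h1 (fun a b => by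
      have h3 := congrArg ρ (he.1 t)
      rw [R.map_bracket, hαt, zero_smul, map_zero] at h3
      have h4 := congrFun (congrFun h3 a) b
      rwa [superCommutator_diagonal_apply ht] at h4)
    apply Subtype.ext
    apply R.injective
    rw [eq_diagonal ht, h2]
    simp

include R in
theorem MatrixRealization.finiteDimensional : FiniteDimensional ℂ V :=
  Module.Finite.of_injective ρ R.injective

include R in
/-- A bound on the dimension of the Cartan subspace. -/
theorem MatrixRealization.finrank_cartan_le {τ : Type} [Fintype τ] (idx : τ → κ ⊕ μ)
    (hidx : ∀ h ∈ 𝔥, (∀ i, ρ h (idx i) (idx i) = 0) → ∀ a, ρ h a a = 0) :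
    Module.finrank ℂ 𝔥 ≤ Fintype.card τ := by
  let φ : 𝔥 →ₗ[ℂ] (τ → ℂ) :=
    { toFun := fun h i => ρ h (idx i) (idx i)
      map_add' := fun x y => by funext i; simp
      map_smul' := fun c x => by funext i; simp }
  have hφ : Function.Injective φ := by
    refine (injective_iff_map_eq_zero φ).2 fun h hh => ?_
    apply Subtype.ext
    apply R.injective
    have := hidx h h.2 (congrFun hh)
    rw [eq_diagonal ((R.mem_cartan _).1 h.2)]
    simp only [this]
    simp
  have := LinearMap.finrank_le_finrank_of_injective hφ
  rwa [Module.finrank_fintype_fun_eq_card] at this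

/-- If the simple roots span `𝔥*`, the Weyl group acts faithfully on the simple roots. -/
theorem OrderedRootBase.eq_one_of_finrank_le {ι : Type} [Fintype ι] [FiniteDimensional ℂ V]
    (y : L.OrderedRootBase 𝔥 ι) (hfin : Module.finrank ℂ 𝔥 ≤ Fintype.card ι)
    {g : Module.Dual ℂ 𝔥 ≃ₗ[ℂ] Module.Dual ℂ 𝔥} (hg : ∀ i, g (y.root i) = y.root i) : g = 1 := by
  have h1 : Fintype.card ι = Module.finrank ℂ (Module.Dual ℂ 𝔥) := by
    rw [Subspace.dual_finrank_eq]
    refine le_antisymm ?_ hfin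
    rw [← Subspace.dual_finrank_eq]
    exact y.linearIndependent.fintype_card_le_finrank
  have h2 := y.linearIndependent.span_eq_top_of_card_eq_finrank' h1
  apply LinearEquiv.toLinearMap_injective
  exact LinearMap.ext_on_range h2 hg

include R in
theorem MatrixRealization.nonempty_aut_mulEquiv {ι : Type} [Fintype ι] [DecidableEq ι]
    {τ : Type} [Fintype τ] (idx : τ → κ ⊕ μ)
    (hidx : ∀ h ∈ 𝔥, (∀ i, ρ h (idx i) (idx i) = 0) → ∀ a, ρ h a a = 0)
    (hcard : Fintype.card τ ≤ Fintype.card ι) (x : (L.cartanGraph 𝔥 ι).WeylGroupoid) :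
    Nonempty (CategoryTheory.Aut x ≃* L.evenWeylGroup 𝔥) := by
  have := R.finiteDimensional
  exact LieSuperalgebra.nonempty_aut_mulEquiv R.invariantForm x fun y g _ hg =>
    y.eq_one_of_finrank_le ((R.finrank_cartan_le idx hidx).trans hcard) hg

end Realization

end LieSuperalgebra

namespace LieSuperalgebra

/-! ### The general linear case -/

section GeneralLinear

variable {κ μ : Type} [Fintype κ] [Fintype μ] [DecidableEq κ] [DecidableEq μ]

theorem superTrace_mul_single (x : Matrix (κ ⊕ μ) (κ ⊕ μ) ℂ) (a b : κ ⊕ μ) (c : ℂ) :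
    superTrace κ μ (x * Matrix.single a b c) = indexSign b * (x b a * c) := by
  rw [superTrace_eq_sum, Finset.sum_eq_single b]
  · rw [Matrix.mul_single_apply_same]
  · intro i _ hi
    rw [Matrix.mul_single_apply_of_ne _ _ _ _ _ hi, mul_zero]
  · simp

theorem indexSign_ne_zero (i : κ ⊕ μ) : indexSign i ≠ 0 := superSign_ne_zero _ _

theorem matrixRealization_gl :
    (glSuper κ μ).MatrixRealization (diagonalMatrices (κ ⊕ μ)) LinearMap.id where
  injective := Function.injective_id
  map_bracket _ _ := rfl
  mem_part _ _ := Iff.rfl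
  mem_cartan _ := Iff.rfl
  separates a b hab := ⟨_, diagonal_mem (Pi.single a 1), by simp [hab.symm]⟩
  nondegenerate x hx := by
    ext a b
    have h := hx (Matrix.single b a 1)
    rw [LinearMap.id_apply, LinearMap.id_apply, superTrace_mul_single, mul_one] at h
    exact (mul_eq_zero.1 h).resolve_left (indexSign_ne_zero a)

/-- The trace as a functional on the diagonal matrices. -/
def diagonalTrace : Module.Dual ℂ (diagonalMatrices (κ ⊕ μ)) :=
  (Matrix.traceLinearMap (κ ⊕ μ) ℂ ℂ).comp (diagonalMatrices (κ ⊕ μ)).subtype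

/-- Even coroots are ordinary commutators of matrices, so their trace is zero and each generating
reflection fixes the trace. -/
theorem evenWeylGroup_diagonalTrace
    {g : Module.Dual ℂ (diagonalMatrices (κ ⊕ μ)) ≃ₗ[ℂ] Module.Dual ℂ (diagonalMatrices (κ ⊕ μ))}
    (hg : g ∈ (glSuper κ μ).evenWeylGroup (diagonalMatrices (κ ⊕ μ))) :
    g diagonalTrace = diagonalTrace := by
  induction hg using Subgroup.closure_induction with
  | mem g hg =>
    obtain ⟨α, t, -, ⟨-, e, he, f, hf, hef⟩, hgα⟩ := hg
    have h0 : diagonalTrace t = 0 := by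
      change Matrix.trace (t : Matrix (κ ⊕ μ) (κ ⊕ μ) ℂ) = 0
      rw [← hef]
      change Matrix.trace (superCommutator κ μ e f) = 0
      rw [superCommutator_eq he.2 hf.2, superSign_zero_left, one_smul, Matrix.trace_sub,
        Matrix.trace_mul_comm, sub_self]
    rw [hgα, h0, zero_smul, sub_zero]
  | one => rfl
  | mul g g' _ _ h h' => rw [LinearEquiv.mul_apply, h', h]
  | inv g _ h =>
    exact g.symm_apply_eq.2 h.symm

theorem root_one_eq_zero {α : Module.Dual ℂ (diagonalMatrices (κ ⊕ μ))}
    (hα : (glSuper κ μ).IsRoot (diagonalMatrices (κ ⊕ μ)) α) :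
    α ⟨1, by rw [← Matrix.diagonal_one]; exact diagonal_mem _⟩ = 0 := by
  obtain ⟨x, hx, hx0⟩ := (Submodule.ne_bot_iff _).1 hα.2
  have h1 := hx ⟨1, by rw [← Matrix.diagonal_one]; exact diagonal_mem _⟩
  have h2 : (glSuper κ μ).bracket (1 : Matrix (κ ⊕ μ) (κ ⊕ μ) ℂ) x = 0 := by
    ext a b
    change superCommutator κ μ 1 x a b = 0
    rw [superCommutator_diagonal_apply (by rw [← Matrix.diagonal_one]; exact diagonal_mem _)]
    simp
  rw [h2, eq_comm, smul_eq_zero] at h1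
  exact h1.resolve_right hx0

theorem nonempty_aut_mulEquiv_gl {ι : Type} [Fintype ι] [DecidableEq ι]
    (hι : Fintype.card (κ ⊕ μ) ≤ Fintype.card ι + 1)
    (x : ((glSuper κ μ).cartanGraph (diagonalMatrices (κ ⊕ μ)) ι).WeylGroupoid) :
    Nonempty (CategoryTheory.Aut x ≃*
      (glSuper κ μ).evenWeylGroup (diagonalMatrices (κ ⊕ μ))) := by
  refine nonempty_aut_mulEquiv matrixRealization_gl.invariantForm x fun y g hg hgy => ?_
  have hfin : Module.finrank ℂ (diagonalMatrices (κ ⊕ μ)) ≤ Fintype.card (κ ⊕ μ) :=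
    matrixRealization_gl.finrank_cartan_le id fun h _ hz => hz
  by_cases h0 : Fintype.card (κ ⊕ μ) = 0
  · exact y.eq_one_of_finrank_le (hfin.trans (by omega)) hgy
  let one : diagonalMatrices (κ ⊕ μ) := ⟨1, by rw [← Matrix.diagonal_one]; exact diagonal_mem _⟩
  -- The simple roots vanish on the identity matrix while the trace does not. Adding the trace to
  -- them therefore gives a basis of `𝔥*`, which `g` fixes.
  let v : Option ι → Module.Dual ℂ (diagonalMatrices (κ ⊕ μ)) :=
    fun o => o.elim diagonalTrace y.root
  have hv : LinearIndependent ℂ v := by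
    refine linearIndependent_option.2 ⟨y.linearIndependent, fun hmem => ?_⟩
    change diagonalTrace ∈ Submodule.span ℂ (Set.range y.root) at hmem
    have hle : Submodule.span ℂ (Set.range y.root) ≤
        LinearMap.ker (Module.Dual.eval ℂ (diagonalMatrices (κ ⊕ μ)) one) := by
      rw [Submodule.span_le]
      rintro _ ⟨i, rfl⟩
      exact root_one_eq_zero (y.isRoot i)
    have h1 : Matrix.trace (1 : Matrix (κ ⊕ μ) (κ ⊕ μ) ℂ) = 0 := hle hmem
    rw [Matrix.trace_one, Nat.cast_eq_zero] at h1
    exact h0 h1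
  have hcard : Fintype.card (Option ι) =
      Module.finrank ℂ (Module.Dual ℂ (diagonalMatrices (κ ⊕ μ))) := by
    refine le_antisymm hv.fintype_card_le_finrank ?_
    rw [Subspace.dual_finrank_eq, Fintype.card_option]
    exact hfin.trans hι
  apply LinearEquiv.toLinearMap_injective
  refine LinearMap.ext_on_range (hv.span_eq_top_of_card_eq_finrank' hcard) fun o => ?_
  cases o with
  | none => exact evenWeylGroup_diagonalTrace hg
  | some i => exact hgy i

end GeneralLinear

/-! ### The special linear case -/

section SpecialLinear

variable {κ μ : Type} [Fintype κ] [Fintype μ] [DecidableEq κ] [DecidableEq μ]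

theorem indexSign_eq_or (i : κ ⊕ μ) : indexSign i = 1 ∨ indexSign i = -1 := by
  rcases i with i | i <;> simp [indexSign, indexParity]

theorem superTrace_single (a b : κ ⊕ μ) (c : ℂ) :
    superTrace κ μ (Matrix.single a b c) = if a = b then indexSign a * c else 0 := by
  have := superTrace_mul_single (1 : Matrix (κ ⊕ μ) (κ ⊕ μ) ℂ) a b c
  rw [one_mul] at this
  rw [this, Matrix.one_apply]
  by_cases h : a = b
  · subst h; simp
  · simp [h, Ne.symm h]

theorem superTrace_one : superTrace κ μ 1 = Fintype.card κ - Fintype.card μ := by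
  simp [superTrace]

theorem sub_single_mem_sl (a b : κ ⊕ μ) :
    Matrix.single a a (indexSign a) - Matrix.single b b (indexSign b) ∈ slSubmodule κ μ := by
  change superTrace κ μ _ = 0
  rw [map_sub, superTrace_single, superTrace_single, if_pos rfl, if_pos rfl, indexSign_mul_self,
    indexSign_mul_self, sub_self]

theorem matrixRealization_sl (hcard : Fintype.card κ ≠ Fintype.card μ) :
    (slSuper κ μ).MatrixRealization (diagonalIn (slSubmodule κ μ)) (slSubmodule κ μ).subtype where
  injective := Subtype.val_injective
  map_bracket _ _ := rfl
  mem_part _ _ := Iff.rfl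
  mem_cartan _ := Iff.rfl
  separates a b hab := by
    have hdiag : ∀ a b : κ ⊕ μ, Matrix.single a a (indexSign a) - Matrix.single b b (indexSign b) ∈
        diagonalMatrices (κ ⊕ μ) := by
      intro a b
      rw [← Matrix.diagonal_single, ← Matrix.diagonal_single]
      exact sub_mem (diagonal_mem _) (diagonal_mem _)
    -- Separating `a` from `b` with supertrace zero needs a third index or equal signs. Only one
    -- even and one odd index would offer neither, and then the two cardinalities agree.
    obtain ⟨c, hca, hcb⟩ | hs : (∃ c, c ≠ a ∧ c ≠ b) ∨ indexSign a = indexSign b := by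
      by_contra! hcon
      obtain ⟨h1, h2⟩ := hcon
      have huniv : (Finset.univ : Finset (κ ⊕ μ)) = {a, b} := by
        ext c
        simp only [Finset.mem_univ, Finset.mem_insert, Finset.mem_singleton, true_iff]
        by_contra! hc
        exact hc.2 (h1 c hc.1)
      have h3 := superTrace_one (κ := κ) (μ := μ)
      rw [superTrace_eq_sum, huniv, Finset.sum_pair hab, Matrix.one_apply_eq, Matrix.one_apply_eq,
        mul_one, mul_one] at h3
      have h4 : indexSign a + indexSign b = 0 := by
        rcases indexSign_eq_or a with ha | ha <;> rcases indexSign_eq_or b with hb | hb <;>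
          rw [ha, hb] at h2 ⊢ <;> first | exact absurd rfl h2 | norm_num
      rw [h4, eq_comm, sub_eq_zero] at h3
      exact hcard (by exact_mod_cast h3)
    · refine ⟨⟨_, sub_single_mem_sl a c⟩, hdiag a c, ?_⟩
      simp only [Submodule.subtype_apply, Matrix.sub_apply, Matrix.single_apply]
      simpa [hab, hca, hcb] using indexSign_ne_zero a
    · refine ⟨⟨_, sub_single_mem_sl a b⟩, hdiag a b, ?_⟩
      simp only [Submodule.subtype_apply, Matrix.sub_apply, Matrix.single_apply]
      simp only [hab, hab.symm, and_self, if_true, if_false, hs, sub_zero, zero_sub]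
      intro h
      exact indexSign_ne_zero b (self_eq_neg.1 h)
  nondegenerate x hx := by
    have hoff : ∀ a b, a ≠ b → x.1 a b = 0 := by
      intro a b hab
      have h := hx ⟨Matrix.single b a 1, by
        change superTrace κ μ _ = 0
        rw [superTrace_single, if_neg hab.symm]⟩
      change superTrace κ μ (x.1 * Matrix.single b a 1) = 0 at h
      rw [superTrace_mul_single, mul_one] at h
      exact (mul_eq_zero.1 h).resolve_left (indexSign_ne_zero a)
    have hdiag : ∀ a b, x.1 a a = x.1 b b := by
      intro a b
      have h := hx ⟨_, sub_single_mem_sl a b⟩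
      change superTrace κ μ (x.1 * (_ - _)) = 0 at h
      rw [mul_sub, map_sub, superTrace_mul_single, superTrace_mul_single, mul_comm (x.1 a a),
        mul_comm (x.1 b b), ← mul_assoc, ← mul_assoc, indexSign_mul_self, indexSign_mul_self,
        one_mul, one_mul, sub_eq_zero] at h
      exact h
    have hne : Nonempty (κ ⊕ μ) := by
      by_contra hcon
      rw [not_nonempty_iff, isEmpty_sum] at hcon
      obtain ⟨h1, h2⟩ := hcon
      exact hcard (by simp)
    obtain ⟨a⟩ := hne
    -- The radical consists of scalar matrices, whose supertrace is a multiple of `|κ| - |μ| ≠ 0`.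
    have hx1 : x.1 = x.1 a a • (1 : Matrix (κ ⊕ μ) (κ ⊕ μ) ℂ) := by
      ext b c
      by_cases h : b = c
      · subst h; simp [hdiag b a]
      · simp [hoff b c h, h]
    have hst : superTrace κ μ x.1 = 0 := x.2
    rw [hx1, map_smul, superTrace_one, smul_eq_mul, mul_eq_zero, sub_eq_zero] at hst
    have ha : x.1 a a = 0 := hst.resolve_right fun h => hcard (by exact_mod_cast h)
    rw [ha, zero_smul] at hx1
    exact Subtype.ext hx1

theorem nonempty_aut_mulEquiv_sl {ι : Type} [Fintype ι] [DecidableEq ι]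
    (hcard : Fintype.card κ ≠ Fintype.card μ)
    (hι : Fintype.card (κ ⊕ μ) ≤ Fintype.card ι + 1)
    (x : ((slSuper κ μ).cartanGraph (diagonalIn (slSubmodule κ μ)) ι).WeylGroupoid) :
    Nonempty (CategoryTheory.Aut x ≃*
      (slSuper κ μ).evenWeylGroup (diagonalIn (slSubmodule κ μ))) := by
  have hne : Nonempty (κ ⊕ μ) := by
    by_contra hcon
    rw [not_nonempty_iff, isEmpty_sum] at hcon
    obtain ⟨h1, h2⟩ := hcon
    exact hcard (by simp)
  obtain ⟨a⟩ := hne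
  refine (matrixRealization_sl hcard).nonempty_aut_mulEquiv
    (Subtype.val : {b : κ ⊕ μ // b ≠ a} → κ ⊕ μ) ?_ ?_ x
  · intro h _ hz
    have hz' : ∀ b, b ≠ a → h.1 b b = 0 := fun b hb => hz ⟨b, hb⟩
    have hst : superTrace κ μ h.1 = 0 := h.2
    rw [superTrace_eq_sum, Finset.sum_eq_single a (fun b _ hb => by rw [hz' b hb, mul_zero])
      (by simp)] at hst
    intro b
    by_cases hb : b = a
    · subst hb
      exact (mul_eq_zero.1 hst).resolve_left (indexSign_ne_zero b)
    · exact hz' b hb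
  · rw [Fintype.card_subtype_compl, Fintype.card_subtype_eq]
    omega

end SpecialLinear

/-! ### The orthosymplectic case -/

section Orthosymplectic

variable {κ μ : Type} [Fintype κ] [Fintype μ] [DecidableEq κ] [DecidableEq μ]

variable (κ μ) in
/-- The diagonal matrix of the index signs. -/
def signMatrix : Matrix (κ ⊕ μ) (κ ⊕ μ) ℂ := Matrix.diagonal indexSign

/-- The sign in the definition of the orthosymplectic Lie superalgebra. -/
def ospSign (a b : κ ⊕ μ) : ℂ :=
  superSign (indexParity κ μ a + indexParity κ μ b) (indexParity κ μ a)

/-- The form matrix `J` is real and `J * J` is the sign matrix `D`. Multiplying the defining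
relation by `J` on both sides gives one between `X * J` and `J * Xᵀ * D`; conjugated, it is the
defining relation for `Xᴴ * D`. -/
theorem conjTranspose_mul_sign_mem {Je : Matrix κ κ ℂ} {Jo : Matrix μ μ ℂ}
    (hJe : Je * Je = 1) (hJo : Jo * Jo = -1) (hJe' : Je.map star = Je) (hJo' : Jo.map star = Jo)
    {X : Matrix (κ ⊕ μ) (κ ⊕ μ) ℂ} (hX : X ∈ ospSubmodule Je Jo) :
    X.conjTranspose * signMatrix κ μ ∈ ospSubmodule Je Jo := by
  set J : Matrix (κ ⊕ μ) (κ ⊕ μ) ℂ := Matrix.fromBlocks Je 0 0 Jo with hJ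
  have hJJ : J * J = signMatrix κ μ := by
    rw [hJ, Matrix.fromBlocks_multiply, signMatrix]
    simp only [hJe, hJo, Matrix.mul_zero, Matrix.zero_mul, add_zero, zero_add]
    ext a b
    rcases a with a | a <;> rcases b with b | b <;>
      simp [Matrix.diagonal_apply, Matrix.one_apply, indexSign, indexParity, apply_ite]
  have hJstar : ∀ a b, star (J a b) = J a b := by
    intro a b
    rcases a with a | a <;> rcases b with b | b
    · exact congrFun (congrFun hJe' a) b
    · simp [hJ]
    · simp [hJ]
    · exact congrFun (congrFun hJo' a) b
  have hJpar : ∀ a b, J a b = 0 ∨ indexParity κ μ a = indexParity κ μ b := by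
    intro a b
    by_cases h : indexParity κ μ a = indexParity κ μ b
    · exact Or.inr h
    · exact Or.inl (formMatrix_eq_zero Je Jo a b h)
  have hXJ : ∀ a b, (X.transpose * J) a b = -(ospSign a b * (J * X) a b) := fun a b =>
    eq_neg_of_add_eq_zero_left (hX a b)
  have hsq : ∀ a b : κ ⊕ μ, ospSign a b * ospSign a b = 1 := fun a b => superSign_mul_self _ _
  have h1 : ∀ a b, (J * (X.transpose * J)) a b = -(ospSign a b * (indexSign a * X a b)) := by
    intro a b
    have : (J * (J * X)) a b = indexSign a * X a b := by
      rw [← mul_assoc, hJJ, signMatrix, Matrix.diagonal_mul]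
    rw [← this, Matrix.mul_apply, Matrix.mul_apply, Finset.mul_sum, ← Finset.sum_neg_distrib]
    refine Finset.sum_congr rfl fun c _ => ?_
    rw [hXJ]
    rcases hJpar a c with h | h
    · rw [h]; ring
    · rw [ospSign, ospSign, h]; ring
  have h2 : ∀ a b, (J * X.transpose * signMatrix κ μ) a b =
      -(ospSign a b * (indexSign a * (X * J) a b)) := by
    intro a b
    rw [← hJJ, show J * X.transpose * (J * J) = J * (X.transpose * J) * J by
      simp only [mul_assoc], Matrix.mul_apply, Matrix.mul_apply, Finset.mul_sum, Finset.mul_sum,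
      ← Finset.sum_neg_distrib]
    refine Finset.sum_congr rfl fun c _ => ?_
    rw [h1]
    rcases hJpar c b with h | h
    · rw [h]; ring
    · rw [ospSign, ospSign, h]; ring
  intro a b
  change ((X.conjTranspose * signMatrix κ μ).transpose * J) a b +
    ospSign a b * (J * (X.conjTranspose * signMatrix κ μ)) a b = 0
  have h3 : ((X.conjTranspose * signMatrix κ μ).transpose * J) a b =
      indexSign a * star ((X * J) a b) := by
    rw [Matrix.mul_apply, Matrix.mul_apply, star_sum, Finset.mul_sum]
    refine Finset.sum_congr rfl fun c _ => ?_
    rw [Matrix.transpose_apply, signMatrix, Matrix.mul_diagonal, Matrix.conjTranspose_apply,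
      star_mul', hJstar]
    ring
  have h4 : (J * (X.conjTranspose * signMatrix κ μ)) a b = star ((J * X.transpose * signMatrix κ μ) a b) := by
    rw [← mul_assoc, signMatrix, Matrix.mul_diagonal, Matrix.mul_diagonal, star_mul',
      Matrix.mul_apply, Matrix.mul_apply, star_sum]
    congr 1
    · refine Finset.sum_congr rfl fun c _ => ?_
      rw [star_mul', hJstar]; rfl
    · rcases indexSign_eq_or b with h | h <;> rw [h] <;> simp
  have h5 : ∀ a b : κ ⊕ μ, star (ospSign a b) = ospSign a b := by
    intro a b; unfold ospSign superSign; split_ifs <;> simp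
  have h6 : ∀ a : κ ⊕ μ, star (indexSign a) = indexSign a := by
    intro a; rcases indexSign_eq_or a with h | h <;> rw [h] <;> simp
  rw [h3, h4, h2, star_neg, star_mul', star_mul', h5, h6]
  linear_combination -(indexSign a * star ((X * J) a b)) * hsq a b

open scoped ComplexOrder in
-- Pairing `x` with `xᴴ * D` cancels the signs of the supertrace and leaves `tr (x xᴴ)`, which
-- vanishes only for `x = 0`.
theorem osp_nondegenerate {Je : Matrix κ κ ℂ} {Jo : Matrix μ μ ℂ}
    (hJe : Je * Je = 1) (hJo : Jo * Jo = -1) (hJe' : Je.map star = Je) (hJo' : Jo.map star = Jo)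
    (x : ospSubmodule Je Jo)
    (hx : ∀ y : ospSubmodule Je Jo, superTrace κ μ (x.1 * y.1) = 0) : x = 0 := by
  have h := hx ⟨_, conjTranspose_mul_sign_mem hJe hJo hJe' hJo' x.2⟩
  have h1 : superTrace κ μ (x.1 * (x.1.conjTranspose * signMatrix κ μ)) =
      Matrix.trace (x.1 * x.1.conjTranspose) := by
    rw [superTrace_eq_sum, Matrix.trace]
    refine Finset.sum_congr rfl fun i _ => ?_
    rw [← mul_assoc, signMatrix, Matrix.mul_diagonal, mul_comm, mul_assoc, indexSign_mul_self,
      mul_one, Matrix.diag_apply]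
  rw [h1] at h
  exact Subtype.ext (Matrix.trace_mul_conjTranspose_self_eq_zero_iff.1 h)

theorem diagonal_mem_osp {Je : Matrix κ κ ℂ} {Jo : Matrix μ μ ℂ} {d : κ ⊕ μ → ℂ}
    (hd : ∀ a b, Matrix.fromBlocks Je 0 0 Jo a b ≠ 0 → d a + d b = 0) :
    Matrix.diagonal d ∈ ospSubmodule Je Jo := by
  intro a b
  rw [Matrix.diagonal_transpose, Matrix.diagonal_mul, Matrix.mul_diagonal]
  by_cases h : Matrix.fromBlocks Je 0 0 Jo a b = 0
  · rw [h]; ring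
  · have hp : indexParity κ μ a = indexParity κ μ b := by
      by_contra hp
      exact h (formMatrix_eq_zero Je Jo a b hp)
    rw [hp, CharTwo.add_self_eq_zero, superSign_zero_left]
    linear_combination Matrix.fromBlocks Je 0 0 Jo a b * hd a b h

theorem diagonal_osp_add {Je : Matrix κ κ ℂ} {Jo : Matrix μ μ ℂ} {x : ospSubmodule Je Jo}
    (hx : x ∈ diagonalIn (ospSubmodule Je Jo)) {a b : κ ⊕ μ}
    (h : Matrix.fromBlocks Je 0 0 Jo a b ≠ 0) : x.1 a a + x.1 b b = 0 := by
  have h1 := x.2 a b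
  rw [eq_diagonal (x := x.1) hx, Matrix.diagonal_transpose, Matrix.diagonal_mul, Matrix.mul_diagonal] at h1
  have hp : indexParity κ μ a = indexParity κ μ b := by
    by_contra hp
    exact h (formMatrix_eq_zero Je Jo a b hp)
  rw [hp, CharTwo.add_self_eq_zero, superSign_zero_left] at h1
  have h2 : (x.1 a a + x.1 b b) * Matrix.fromBlocks Je 0 0 Jo a b = 0 := by
    linear_combination h1
  exact (mul_eq_zero.1 h2).resolve_right h

theorem matrixRealization_osp {Je : Matrix κ κ ℂ} {Jo : Matrix μ μ ℂ}
    (hJe : Je * Je = 1) (hJo : Jo * Jo = -1) (hJe' : Je.map star = Je) (hJo' : Jo.map star = Jo)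
    (d : κ ⊕ μ → ℂ) (hinj : Function.Injective d)
    (hd : ∀ a b, Matrix.fromBlocks Je 0 0 Jo a b ≠ 0 → d a + d b = 0) :
    (ospSuper Je Jo).MatrixRealization (diagonalIn (ospSubmodule Je Jo))
      (ospSubmodule Je Jo).subtype where
  injective := Subtype.val_injective
  map_bracket _ _ := rfl
  mem_part _ _ := Iff.rfl
  mem_cartan _ := Iff.rfl
  separates a b hab := ⟨⟨_, diagonal_mem_osp hd⟩, diagonal_mem d, by
    simpa using fun h => hab (hinj h)⟩
  nondegenerate := osp_nondegenerate hJe hJo hJe' hJo'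

theorem symplecticForm_mul_self (n : ℕ) : symplecticForm n * symplecticForm n = -1 := by
  rw [symplecticForm, Matrix.fromBlocks_multiply]
  simp only [Matrix.mul_zero, Matrix.zero_mul, one_mul, mul_one, zero_add, add_zero]
  rw [← Matrix.fromBlocks_one, Matrix.fromBlocks_neg]
  simp

theorem symplecticForm_map_star (n : ℕ) : (symplecticForm n).map star = symplecticForm n := by
  ext a b
  rcases a with a | a <;> rcases b with b | b <;>
    simp [symplecticForm, Matrix.one_apply, apply_ite]

theorem symmetricFormEven_mul_self (m : ℕ) : symmetricFormEven m * symmetricFormEven m = 1 := by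
  rw [symmetricFormEven, Matrix.fromBlocks_multiply, ← Matrix.fromBlocks_one]
  simp

theorem symmetricFormEven_map_star (m : ℕ) :
    (symmetricFormEven m).map star = symmetricFormEven m := by
  ext a b
  rcases a with a | a <;> rcases b with b | b <;>
    simp [symmetricFormEven, Matrix.one_apply, apply_ite]

theorem symmetricFormOdd_mul_self (m : ℕ) : symmetricFormOdd m * symmetricFormOdd m = 1 := by
  rw [symmetricFormOdd, Matrix.fromBlocks_multiply, ← Matrix.fromBlocks_one]
  simp [symmetricFormEven_mul_self]

theorem symmetricFormOdd_map_star (m : ℕ) :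
    (symmetricFormOdd m).map star = symmetricFormOdd m := by
  ext a b
  rcases a with a | a <;> rcases b with b | b
  · simp [symmetricFormOdd]
  · simp [symmetricFormOdd]
  · simp [symmetricFormOdd]
  · exact congrFun (congrFun (symmetricFormEven_map_star m) a) b

theorem nonempty_aut_mulEquiv_ospEven (m n : ℕ)
    (x : ((ospEven m n).cartanGraph (diagonalIn _) (Fin (m + n))).WeylGroupoid) :
    Nonempty (CategoryTheory.Aut x ≃* (ospEven m n).evenWeylGroup (diagonalIn _)) := by
  -- The entries `±1, …, ±m` and `±(m+1), …, ±(m+n)` are distinct, and opposite on paired basis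
  -- vectors.
  let d : (Fin m ⊕ Fin m) ⊕ (Fin n ⊕ Fin n) → ℤ := Sum.elim
    (Sum.elim (fun i => i + 1) (fun i => -(i + 1)))
    (Sum.elim (fun j => m + 1 + j) (fun j => -(m + 1 + j)))
  have hinj : Function.Injective d := by
    rintro ((a | a) | (a | a)) ((b | b) | (b | b)) h <;> simp [d] at h ⊢ <;> omega
  have hd : ∀ a b, Matrix.fromBlocks (symmetricFormEven m) 0 0 (symplecticForm n) a b ≠ 0 →
      d a + d b = 0 := by
    rintro ((a | a) | (a | a)) ((b | b) | (b | b)) h <;>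
      simp [d, symmetricFormEven, symplecticForm, Matrix.one_apply] at h ⊢ <;>
      (subst h; ring)
  refine (matrixRealization_osp (symmetricFormEven_mul_self m) (symplecticForm_mul_self n)
    (symmetricFormEven_map_star m) (symplecticForm_map_star n) (fun a => (d a : ℂ))
    (fun a b h => hinj (Int.cast_injective h))
    (fun a b h => by exact_mod_cast hd a b h)).nonempty_aut_mulEquiv
      (Sum.elim (fun i => Sum.inl (Sum.inl i)) (fun j => Sum.inr (Sum.inl j)) :
        Fin m ⊕ Fin n → _) ?_ (by simp) x
  intro h hh hz
  have hz1 := fun i => hz (Sum.inl i)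
  have hz2 := fun j => hz (Sum.inr j)
  simp only [Sum.elim_inl, Sum.elim_inr, Submodule.subtype_apply] at hz1 hz2
  have hJ1 : ∀ i : Fin m, Matrix.fromBlocks (symmetricFormEven m) 0 0 (symplecticForm n)
      (Sum.inl (Sum.inl i)) (Sum.inl (Sum.inr i)) ≠ 0 := by simp [symmetricFormEven]
  have hJ2 : ∀ j : Fin n, Matrix.fromBlocks (symmetricFormEven m) 0 0 (symplecticForm n)
      (Sum.inr (Sum.inl j)) (Sum.inr (Sum.inr j)) ≠ 0 := by simp [symplecticForm]
  rintro ((a | a) | (a | a))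
  · exact hz1 a
  · have := diagonal_osp_add hh (hJ1 a)
    rwa [hz1, zero_add] at this
  · exact hz2 a
  · have := diagonal_osp_add hh (hJ2 a)
    rwa [hz2, zero_add] at this

theorem nonempty_aut_mulEquiv_ospOdd (m n : ℕ)
    (x : ((ospOdd m n).cartanGraph (diagonalIn _) (Fin (m + n))).WeylGroupoid) :
    Nonempty (CategoryTheory.Aut x ≃* (ospOdd m n).evenWeylGroup (diagonalIn _)) := by
  let d : (Unit ⊕ (Fin m ⊕ Fin m)) ⊕ (Fin n ⊕ Fin n) → ℤ := Sum.elim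
    (Sum.elim (fun _ => 0) (Sum.elim (fun i => i + 1) (fun i => -(i + 1))))
    (Sum.elim (fun j => m + 1 + j) (fun j => -(m + 1 + j)))
  have hinj : Function.Injective d := by
    rintro ((a | (a | a)) | (a | a)) ((b | (b | b)) | (b | b)) h <;> simp [d] at h ⊢ <;> omega
  have hd : ∀ a b, Matrix.fromBlocks (symmetricFormOdd m) 0 0 (symplecticForm n) a b ≠ 0 →
      d a + d b = 0 := by
    rintro ((a | (a | a)) | (a | a)) ((b | (b | b)) | (b | b)) h <;>
      simp [d, symmetricFormOdd, symmetricFormEven, symplecticForm, Matrix.one_apply] at h ⊢ <;>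
      (subst h; ring)
  refine (matrixRealization_osp (symmetricFormOdd_mul_self m) (symplecticForm_mul_self n)
    (symmetricFormOdd_map_star m) (symplecticForm_map_star n) (fun a => (d a : ℂ))
    (fun a b h => hinj (Int.cast_injective h))
    (fun a b h => by exact_mod_cast hd a b h)).nonempty_aut_mulEquiv
      (Sum.elim (fun i => Sum.inl (Sum.inr (Sum.inl i))) (fun j => Sum.inr (Sum.inl j)) :
        Fin m ⊕ Fin n → _) ?_ (by simp) x
  intro h hh hz
  have hz1 := fun i => hz (Sum.inl i)
  have hz2 := fun j => hz (Sum.inr j)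
  simp only [Sum.elim_inl, Sum.elim_inr, Submodule.subtype_apply] at hz1 hz2
  have hJ0 : Matrix.fromBlocks (symmetricFormOdd m) 0 0 (symplecticForm n)
      (Sum.inl (Sum.inl ())) (Sum.inl (Sum.inl ())) ≠ 0 := by simp [symmetricFormOdd]
  have hJ1 : ∀ i : Fin m, Matrix.fromBlocks (symmetricFormOdd m) 0 0 (symplecticForm n)
      (Sum.inl (Sum.inr (Sum.inl i))) (Sum.inl (Sum.inr (Sum.inr i))) ≠ 0 := by
    simp [symmetricFormOdd, symmetricFormEven]
  have hJ2 : ∀ j : Fin n, Matrix.fromBlocks (symmetricFormOdd m) 0 0 (symplecticForm n)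
      (Sum.inr (Sum.inl j)) (Sum.inr (Sum.inr j)) ≠ 0 := by simp [symplecticForm]
  rintro ((a | (a | a)) | (a | a))
  -- The vector `e_0` pairs with itself, so its diagonal entry is its own negative.
  · exact self_eq_neg.1 (eq_neg_of_add_eq_zero_left (diagonal_osp_add hh hJ0))
  · exact hz1 a
  · have := diagonal_osp_add hh (hJ1 a)
    rwa [hz1, zero_add] at this
  · exact hz2 a
  · have := diagonal_osp_add hh (hJ2 a)
    rwa [hz2, zero_add] at this

end Orthosymplectic

end LieSuperalgebra

end

theorem mainTheorem7 (m n : ℕ) :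
    (m ≠ n →
      ∀ x : ((slMN m n).cartanGraph (diagonalIn _) (Fin (m + n - 1))).WeylGroupoid,
        Nonempty (CategoryTheory.Aut x ≃* (slMN m n).evenWeylGroup (diagonalIn _))) ∧
    (∀ x : ((glMN n n).cartanGraph (diagonalMatrices _) (Fin (n + n - 1))).WeylGroupoid,
      Nonempty (CategoryTheory.Aut x ≃* (glMN n n).evenWeylGroup (diagonalMatrices _))) ∧
    (∀ x : ((ospOdd m n).cartanGraph (diagonalIn _) (Fin (m + n))).WeylGroupoid,
      Nonempty (CategoryTheory.Aut x ≃* (ospOdd m n).evenWeylGroup (diagonalIn _))) ∧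
    (∀ x : ((ospEven m n).cartanGraph (diagonalIn _) (Fin (m + n))).WeylGroupoid,
      Nonempty (CategoryTheory.Aut x ≃* (ospEven m n).evenWeylGroup (diagonalIn _))) := by
  refine ⟨fun hmn x => LieSuperalgebra.nonempty_aut_mulEquiv_sl (by simpa using hmn) ?_ x,
    fun x => LieSuperalgebra.nonempty_aut_mulEquiv_gl ?_ x,
    LieSuperalgebra.nonempty_aut_mulEquiv_ospOdd m n,
    LieSuperalgebra.nonempty_aut_mulEquiv_ospEven m n⟩
  · simp only [Fintype.card_sum, Fintype.card_fin]; omega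
  -- Truncated subtraction is harmless at `n = 0`, since only `2n ≤ N + 1` is needed.
  · simp only [Fintype.card_sum, Fintype.card_fin]; omega
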